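/- **Setting.** Let $X$ be a complete, connected, oriented $C^\infty$ Riemannian manifold with volume measure $m$, $m(X)=\infty$ (the orientation plays no role below). Let $\Gamma_X$ be the space of all locally finite subsets $\gamma\subset X$, with the vague topology, i.e. the coarsest one making all maps $\gamma\mapsto\langle f,\gamma\rangle:=\sum_{x\in\gamma}f(x)$, $f\in C_0(X)$ (continuous, compactly supported), continuous, and with its Borel $\sigma$-algebra. For $F:\Gamma_X\to\mathbb R$ and $x\in\gamma$ put $F_x(\gamma,y):=F((\gamma\setminus\{x\})\cup\{y\})$, $\nabla^X_xF(\gamma):=\nabla^XF_x(\gamma,\cdot)(x)$, $\Delta^X_xF(\gamma):=\Delta^XF_x(\gamma,\cdot)(x)$ and $$\nabla^\Gamma F(\gamma):=(\nabla_x^XF(\gamma))_{x\in\gamma},\qquad \Delta^\Gamma F(\gamma):=\sum_{x\in\gamma}\Delta_x^XF(\gamma),\qquad \langle V,W\rangle_\gamma:=\sum_{x\in\gamma}\langle V(\gamma,x),W(\gamma,x)\rangle_x .$$ Let $\mathcal FC_b^\infty$ be the set of functions $F(\gamma)=g(\langle\varphi_1,\gamma\rangle,\dots,\langle\varphi_N,\gamma\rangle)$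 with $N\in\mathbb N$, $\varphi_i\in C_0^\infty(X)$ and $g\in C^\infty(\mathbb R^N)$ bounded together with all its derivatives. Let $\mu$ be a probability measure on $\Gamma_X$ such that $\int\langle\varphi,\gamma\rangle^k\,\mu(d\gamma)<\infty$ for all $k\in\mathbb N$ and $0\le\varphi\in C_0(X)$. Suppose that there is a kernel $\sigma(\gamma,dx)$ from $\Gamma_X$ to $X$ such that for all measurable $F:\Gamma_X\times X\to[0,\infty]$ $$\int_{\Gamma_X}\sum_{x\in\gamma}F(\gamma,x)\,\mu(d\gamma)=\int_{\Gamma_X}\int_XF(\gamma\cup\{x\},x)\,\sigma(\gamma,dx)\,\mu(d\gamma),$$ and that $\sigma(\gamma,dx)=\rho(\gamma,x)\,m(dx)$ for $\mu$-a.e. $\gamma$, where $\rho$ is jointly measurable, $\rho>0$ $\mu\otimes m$-a.e., and, for $\mu$-a.e. $\gamma$, $\rho(\gamma,\cdot)$ is weakly differentiable on $X$ (locally integrable, with locally integrable weak gradient $\nabla^X\rho(\gamma,\cdot)$, i.e. $\int\rho\,\mathrm{div}V\,dm=-\int\langle\nabla^X\rho,V\rangle\,dm$ for all smooth compactly supported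 vector fields $V$); take a jointly measurable version of $\nabla^X\rho$. Put $\beta_\sigma:=\nabla^X\rho/\rho$ and $B_\mu(\gamma,x):=\beta_\sigma(\gamma\setminus\{x\},x)$ for $x\in\gamma$. **Theorem 3.1 and Corollary 3.2.** Suppose that for every relatively compact open $\Lambda\subset X$ $$\int_{\Gamma_X}\Big(\sum_{x\in\gamma\cap\Lambda}|B_\mu(\gamma,x)|_x\Big)^2\mu(d\gamma)<\infty .$$ For $F\in\mathcal FC_b^\infty$ put $\mathbf H_\mu F:=-\Delta^\Gamma F-\langle\nabla^\Gamma F,B_\mu\rangle_\gamma$. Then: 1. $F\in L^2(\mu)$ and $\mathbf H_\mu F\in L^2(\mu)$ for all $F\in\mathcal FC_b^\infty$. 2. For all $F_1,F_2\in\mathcal FC_b^\infty$ the function $\langle\nabla^\Gamma F_1,\nabla^\Gamma F_2\rangle_\gamma$ is $\mu$-integrable and $$\mathcal E_\mu(F_1,F_2):=\int_{\Gamma_X}\langle\nabla^\Gamma F_1(\gamma),\nabla^\Gamma F_2(\gamma)\rangle_\gamma\,\mu(d\gamma)=\int_{\Gamma_X}(\mathbf H_\mu F_1)(\gamma)\,F_2(\gamma)\,\mu(d\gamma).$$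 3. $\mathcal E_\mu$ and $\mathbf H_\mu$ are well defined on the $\mu$-classes of functions in $\mathcal FC_b^\infty$, and give a bilinear form and a densely defined, symmetric, nonnegative linear operator in $L^2(\mu)$. The form $(\mathcal E_\mu,\mathcal FC_b^\infty)$ is closable on $L^2(\mu)$, and its closure is associated with a nonnegative self-adjoint operator, the Friedrichs extension of $\mathbf H_\mu$. -/

import Mathlib

open MeasureTheory Set Filter Topology Manifold ProbabilityTheory Bundle
open scoped ENNReal NNReal ContDiff CompactlySupported InnerProductSpace

noncomputable section

/-! ## Riemannian calculus: gradient, divergence, Laplacian, volume, weak gradient -/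

namespace Riem

/-- A sequence of points the domains of whose charts cover `X` (for nonempty `X`). -/
theorem exists_chart_cover (d : ℕ) (X : Type*) [TopologicalSpace X]
    [ChartedSpace (EuclideanSpace ℝ (Fin d)) X] [SecondCountableTopology X] [Nonempty X] :
    ∃ c : ℕ → X, ⋃ n, (extChartAt (𝓡 d) (c n)).source = univ := by
  obtain ⟨s, hs, hU⟩ := TopologicalSpace.countable_cover_nhds
    (fun x : X => extChartAt_source_mem_nhds (I := 𝓡 d) x)
  have hne : s.Nonempty := by
    by_contra h
    rw [not_nonempty_iff_eq_empty] at h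
    subst h
    simp at hU
    exact absurd hU (Set.empty_ne_univ)
  obtain ⟨c, rfl⟩ := hs.exists_eq_range hne
  exact ⟨c, by simpa using hU⟩

variable {d : ℕ} {X : Type*} [TopologicalSpace X] [ChartedSpace (EuclideanSpace ℝ (Fin d)) X]
  [IsManifold (𝓡 d) ∞ X] [RiemannianBundle (fun x : X => TangentSpace (𝓡 d) x)]

/-- The Riemannian gradient of `f` at `x`: the Riesz representative of `df_x` (zero if `f` is not
differentiable at `x`). -/
def grad (f : X → ℝ) (x : X) : TangentSpace (𝓡 d) x :=
  haveI : FiniteDimensional ℝ (TangentSpace (𝓡 d) x) :=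
    inferInstanceAs (FiniteDimensional ℝ (EuclideanSpace ℝ (Fin d)))
  haveI : CompleteSpace (TangentSpace (𝓡 d) x) := FiniteDimensional.complete ℝ _
  (InnerProductSpace.toDual ℝ (TangentSpace (𝓡 d) x)).symm
    (show TangentSpace (𝓡 d) x →L[ℝ] ℝ from mfderiv (𝓡 d) 𝓘(ℝ, ℝ) f x)

/-- The coordinate vector `∂_i` of the chart centred at `c`, at the point with coordinates `y`. -/
def coordVector (c : X) (y : EuclideanSpace ℝ (Fin d)) (i : Fin d) :
    TangentSpace (𝓡 d) ((extChartAt (𝓡 d) c).symm y) :=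
  mfderiv 𝓘(ℝ, EuclideanSpace ℝ (Fin d)) (𝓡 d) (extChartAt (𝓡 d) c).symm y
    (EuclideanSpace.single i (1 : ℝ) : EuclideanSpace ℝ (Fin d))

/-- `√(det g_ij)` in the chart centred at `c`, as a function of the coordinates. -/
def sqrtDet (c : X) (y : EuclideanSpace ℝ (Fin d)) : ℝ :=
  √(Matrix.det (Matrix.of fun i j : Fin d =>
    (inner ℝ (coordVector c y i) (coordVector c y j) : ℝ)))

/-- The `i`-th component, in the chart centred at `c`, of the vector field `V`, as a function of the
coordinates. -/
def component (V : (x : X) → TangentSpace (𝓡 d) x) (c : X) (i : Fin d)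
    (y : EuclideanSpace ℝ (Fin d)) : ℝ :=
  (show EuclideanSpace ℝ (Fin d) from
    mfderiv (𝓡 d) 𝓘(ℝ, EuclideanSpace ℝ (Fin d)) (extChartAt (𝓡 d) c)
      ((extChartAt (𝓡 d) c).symm y) (V ((extChartAt (𝓡 d) c).symm y))) i

/-- The Riemannian divergence `div V = (det g)^{-1/2} ∑_i ∂_i ((det g)^{1/2} V^i)`, computed at `x`
in the preferred chart at `x`. -/
def divergence (V : (x : X) → TangentSpace (𝓡 d) x) (x : X) : ℝ :=
  (sqrtDet x (extChartAt (𝓡 d) x x))⁻¹ *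
    ∑ i : Fin d, fderiv ℝ (fun y => sqrtDet x y * component V x i y) (extChartAt (𝓡 d) x x)
      (EuclideanSpace.single i (1 : ℝ))

/-- The Laplace–Beltrami operator `Δ f = div grad f`. -/
def laplacian (f : X → ℝ) (x : X) : ℝ := divergence (d := d) (grad f) x

/-- The Riemannian volume inside the domain of the chart centred at `c`: the measure which reads
`√(det g) dy` in the coordinates. -/
def chartVolume [MeasurableSpace X] (c : X) : Measure X :=
  (((volume : Measure (EuclideanSpace ℝ (Fin d))).withDensity
      fun y => ENNReal.ofReal (sqrtDet c y)).restrict (extChartAt (𝓡 d) c).target).map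
    (extChartAt (𝓡 d) c).symm

variable (d X) in
/-- The Riemannian volume measure, glued from the chart volumes along a countable cover by chart
domains made disjoint. (The chart volumes agree on overlaps by the change of variables formula, so
it does not depend on the cover.) -/
def vol [SecondCountableTopology X] [Nonempty X] [MeasurableSpace X] : Measure X :=
  Measure.sum fun n : ℕ =>
    (chartVolume (d := d) ((exists_chart_cover d X).choose n)).restrict
      (disjointed (fun k => (extChartAt (𝓡 d) ((exists_chart_cover d X).choose k)).source) n)

instance [SecondCountableTopology X] [Nonempty X] [MeasurableSpace X] : SFinite (vol d X) := by
  unfold vol chartVolume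
  infer_instance

/-- Smooth vector fields with compact support. -/
def IsTestField (V : (x : X) → TangentSpace (𝓡 d) x) : Prop :=
  ContMDiff (𝓡 d) (𝓡 d).tangent ∞ (fun x => (⟨x, V x⟩ : TangentBundle (𝓡 d) X)) ∧
    ∃ K : Set X, IsCompact K ∧ ∀ x ∉ K, V x = 0

/-- `v` is the weak gradient of `f` with respect to `m`: both are locally integrable and
`∫ f div V dm = - ∫ ⟨v, V⟩ dm` for all smooth compactly supported vector fields `V`. -/
structure IsWeakGradient [MeasurableSpace X] (m : Measure X) (f : X → ℝ)
    (v : (x : X) → TangentSpace (𝓡 d) x) : Prop where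
  locallyIntegrable : LocallyIntegrable f m
  aemeasurable : @AEMeasurable X (TangentBundle (𝓡 d) X) (borel _) _ (fun x => ⟨x, v x⟩) m
  locallyIntegrable_norm : LocallyIntegrable (fun x => ‖v x‖) m
  integral_eq : ∀ V : (x : X) → TangentSpace (𝓡 d) x, IsTestField V →
    ∫ x, f x * divergence V x ∂m = - ∫ x, (inner ℝ (v x) (V x) : ℝ) ∂m

end Riem

/-! ## The configuration space -/

/-- Locally finite subsets of `X`. -/
structure Config (X : Type*) [TopologicalSpace X] where
  carrier : Set X
  locallyFinite : ∀ K : Set X, IsCompact K → (carrier ∩ K).Finite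

namespace Config

section Basic

variable {X : Type*} [TopologicalSpace X]

/-- `⟨f, γ⟩ = ∑_{x ∈ γ} f x` -/
def pair (f : X → ℝ) (γ : Config X) : ℝ := ∑' x : γ.carrier, f x

/-- The vague topology. -/
instance : TopologicalSpace (Config X) :=
  ⨅ f : C_c(X, ℝ), TopologicalSpace.induced (fun γ : Config X => pair f γ) inferInstance

instance : MeasurableSpace (Config X) := borel _

instance : BorelSpace (Config X) := ⟨rfl⟩

/-- `γ ∪ {x}`, that is, `γ + ε_x` when `x ∉ γ`. -/
def add (γ : Config X) (x : X) : Config X where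
  carrier := insert x γ.carrier
  locallyFinite K hK := ((γ.locallyFinite K hK).insert x).subset <| by
    rintro y ⟨rfl | hy, hyK⟩
    · exact mem_insert _ _
    · exact mem_insert_of_mem _ ⟨hy, hyK⟩

/-- `γ \ {x}`, that is, `γ - ε_x` when `x ∈ γ`. -/
def erase (γ : Config X) (x : X) : Config X where
  carrier := γ.carrier \ {x}
  locallyFinite K hK := (γ.locallyFinite K hK).subset
    (inter_subset_inter_left _ sdiff_subset)

/-- The function `y ↦ F_x(γ, y) = F(γ - ε_x + ε_y)`. -/
def moved (F : Config X → ℝ) (γ : Config X) (x y : X) : ℝ := F ((γ.erase x).add y)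

/-- All moments of `μ` are finite. -/
def HasAllMoments (μ : Measure (Config X)) : Prop :=
  ∀ (k : ℕ) (φ : C_c(X, ℝ)), (∀ x, 0 ≤ φ x) → Integrable (fun γ => pair φ γ ^ k) μ

/-- The generalized Mecke identity for `μ` with the kernel `σ`. -/
def MeckeIdentity [MeasurableSpace X] (μ : Measure (Config X)) (σ : Kernel (Config X) X) : Prop :=
  ∀ F : Config X × X → ℝ≥0∞, Measurable F →
    ∫⁻ γ, ∑' x : γ.carrier, F (γ, x) ∂μ = ∫⁻ γ, ∫⁻ x, F (γ.add x, x) ∂(σ γ) ∂μ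

end Basic

section Calculus

variable {d : ℕ} {X : Type*} [TopologicalSpace X] [ChartedSpace (EuclideanSpace ℝ (Fin d)) X]
  [IsManifold (𝓡 d) ∞ X] [RiemannianBundle (fun x : X => TangentSpace (𝓡 d) x)]

variable (d) in
/-- The cylinder functions `F(γ) = g(⟨φ_1, γ⟩, …, ⟨φ_N, γ⟩)`, with `g` smooth, bounded together with
all its derivatives, and `φ_i` smooth with compact support. -/
def IsCylinder (F : Config X → ℝ) : Prop :=
  ∃ (N : ℕ) (φ : Fin N → X → ℝ) (g : (Fin N → ℝ) → ℝ),
    (∀ i, ContMDiff (𝓡 d) 𝓘(ℝ, ℝ) ∞ (φ i) ∧ HasCompactSupport (φ i)) ∧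
    ContDiff ℝ ∞ g ∧ (∀ k : ℕ, ∃ C : ℝ, ∀ t, ‖iteratedFDeriv ℝ k g t‖ ≤ C) ∧
    ∀ γ, F γ = g fun i => pair (φ i) γ

/-- The component `∇^X_x F(γ)` at `x ∈ γ` of the gradient `∇^Γ F(γ)`. -/
def gradΓ (F : Config X → ℝ) (γ : Config X) (x : X) : TangentSpace (𝓡 d) x :=
  Riem.grad (moved F γ x) x

variable (d) in
/-- `Δ^Γ F(γ) = ∑_{x ∈ γ} Δ^X_x F(γ)` -/
def laplacianΓ (F : Config X → ℝ) (γ : Config X) : ℝ :=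
  ∑' x : γ.carrier, Riem.laplacian (d := d) (moved F γ x) x

/-- `⟨V, W⟩_γ = ∑_{x ∈ γ} ⟨V(γ, x), W(γ, x)⟩_x` -/
def innerΓ (V W : Config X → (x : X) → TangentSpace (𝓡 d) x) (γ : Config X) : ℝ :=
  ∑' x : γ.carrier, (inner ℝ (V γ x) (W γ x) : ℝ)

variable (d) in
/-- The bilinear form `E_μ(F₁, F₂) = ∫ ⟨∇^Γ F₁, ∇^Γ F₂⟩_γ μ(dγ)`. -/
def energy (μ : Measure (Config X)) (F₁ F₂ : Config X → ℝ) : ℝ :=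
  ∫ γ, innerΓ (d := d) (gradΓ F₁) (gradΓ F₂) γ ∂μ

/-- The logarithmic derivative `B_μ(γ, x) = β_σ(γ - ε_x, x)`, where
`β_σ(γ, x) = ∇_x ρ(γ, x) / ρ(γ, x)`, from the density `ρ` and its gradient `∇ρ`. -/
def logDeriv (ρ : Config X → X → ℝ≥0) (gradρ : Config X → (x : X) → TangentSpace (𝓡 d) x)
    (γ : Config X) (x : X) : TangentSpace (𝓡 d) x :=
  (ρ (γ.erase x) x : ℝ)⁻¹ • gradρ (γ.erase x) x

/-- `H F(γ) = - Δ^Γ F(γ) - ⟨∇^Γ F(γ), B(γ)⟩_γ` -/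
def hamiltonian (B : Config X → (x : X) → TangentSpace (𝓡 d) x) (F : Config X → ℝ)
    (γ : Config X) : ℝ :=
  - laplacianΓ d F γ - innerΓ (gradΓ F) B γ

end Calculus

end Config

/-! ## Bilinear forms in Hilbert spaces: closure, associated operator, Friedrichs extension -/

/-- A (not necessarily everywhere defined) bilinear form in `H`. -/
structure PartialForm (H : Type*) [AddCommGroup H] [Module ℝ H] where
  domain : Submodule ℝ H
  form : domain →ₗ[ℝ] domain →ₗ[ℝ] ℝ

namespace PartialForm

variable {H : Type*} [NormedAddCommGroup H] [InnerProductSpace ℝ H]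

/-- The sequence `u` in the domain is Cauchy for the form and converges to `x` in `H`. -/
def Approximates (q : PartialForm H) (u : ℕ → q.domain) (x : H) : Prop :=
  (∀ ε > 0, ∃ N, ∀ m ≥ N, ∀ n ≥ N, q.form (u m - u n) (u m - u n) < ε) ∧
    Tendsto (fun n => (u n : H)) atTop (𝓝 x)

/-- Closability of a (nonnegative symmetric) form. -/
def IsClosable (q : PartialForm H) : Prop :=
  ∀ u : ℕ → q.domain, q.Approximates u 0 → Tendsto (fun n => q.form (u n) (u n)) atTop (𝓝 0)

/-- `p` is the closure of the (nonnegative symmetric, closable) form `q`. -/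
structure IsClosureOf (p q : PartialForm H) : Prop where
  mem_domain_iff : ∀ x, x ∈ p.domain ↔ ∃ u, q.Approximates u x
  tendsto : ∀ (x y : p.domain) (u v : ℕ → q.domain), q.Approximates u x → q.Approximates v y →
    Tendsto (fun n => q.form (u n) (v n)) atTop (𝓝 (p.form x y))

/-- `A` is the operator associated with (the generator of) the form `q`: `x ∈ D(A)` and `A x = w`
exactly if `x ∈ D(q)` and `q(x, y) = (w, y)` for all `y ∈ D(q)`. -/
def IsAssociatedWith (q : PartialForm H) (A : H →ₗ.[ℝ] H) : Prop :=
  ∀ x w : H, (x, w) ∈ A.graph ↔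
    ∃ hx : x ∈ q.domain, ∀ y : q.domain, q.form ⟨x, hx⟩ y = inner ℝ w (y : H)

/-- The form `(x, y) ↦ (T x, y)` of an operator, on the domain of `T`. -/
def ofOperator (T : H →ₗ.[ℝ] H) : PartialForm H where
  domain := T.domain
  form := (innerₗ H).compl₁₂ T.toFun T.domain.subtype

end PartialForm

/-- `A` is the Friedrichs extension of the densely defined nonnegative symmetric operator `T`: the
operator associated with the closure of the form `(x, y) ↦ (T x, y)` on `D(T)`. -/
structure IsFriedrichsExtension {H : Type*} [NormedAddCommGroup H] [InnerProductSpace ℝ H]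
    (T A : H →ₗ.[ℝ] H) : Prop where
  dense_domain : Dense (T.domain : Set H)
  symmetric : ∀ x y : T.domain, inner ℝ (T x) (y : H) = inner ℝ (x : H) (T y)
  nonneg : ∀ x : T.domain, 0 ≤ inner ℝ (T x) (x : H)
  le : T ≤ A
  associated : ∃ p : PartialForm H,
    p.IsClosureOf (PartialForm.ofOperator T) ∧ p.IsAssociatedWith A

namespace Config

variable {d : ℕ} {X : Type*} [TopologicalSpace X] [ChartedSpace (EuclideanSpace ℝ (Fin d)) X]
  [IsManifold (𝓡 d) ∞ X] [RiemannianBundle (fun x : X => TangentSpace (𝓡 d) x)]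

variable (d) in
/-- `q` is the form `E_μ` in `L²(μ)`, with domain the `μ`-classes of cylinder functions. -/
structure IsEnergyForm (μ : Measure (Config X)) (q : PartialForm (Lp ℝ 2 μ)) : Prop where
  mem_domain_iff : ∀ u : Lp ℝ 2 μ, u ∈ q.domain ↔ ∃ F, IsCylinder d F ∧ u =ᵐ[μ] F
  form_eq : ∀ (u v : q.domain) (F G : Config X → ℝ), IsCylinder d F → IsCylinder d G →
    (u : Lp ℝ 2 μ) =ᵐ[μ] F → (v : Lp ℝ 2 μ) =ᵐ[μ] G → q.form u v = energy d μ F G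

/-- `T` is the operator `F ↦ - Δ^Γ F - ⟨∇^Γ F, B⟩` in `L²(μ)`, with domain the `μ`-classes of
cylinder functions. -/
structure IsHamiltonian (μ : Measure (Config X)) (B : Config X → (x : X) → TangentSpace (𝓡 d) x)
    (T : Lp ℝ 2 μ →ₗ.[ℝ] Lp ℝ 2 μ) : Prop where
  mem_domain_iff : ∀ u : Lp ℝ 2 μ, u ∈ T.domain ↔ ∃ F, IsCylinder d F ∧ u =ᵐ[μ] F
  apply_eq : ∀ (u : T.domain) (F : Config X → ℝ), IsCylinder d F →
    (u : Lp ℝ 2 μ) =ᵐ[μ] F → T u =ᵐ[μ] hamiltonian B F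

end Config

end

/-! Integration by parts is the heart. Let `F₁`, `F₂` be cylinder functions and fix a configuration
`γ`. The sections `fᵢ(x) = Fᵢ(γ ∪ {x})`, `x ∉ γ`, extend to smooth functions on `X` that are
constant off a compact set, so `f₂ ∇f₁` is an admissible test field for the weak gradient of `ρ(γ,
·)`. By the Leibniz rule the defining identity becomes `∫ ρ (f₂ Δf₁ + ⟨∇f₁, ∇f₂⟩ + f₂ ⟨∇f₁, ∇ρ/ρ⟩)
dm = 0`. In positive dimension `m` has no atoms, so `x ∉ γ` almost everywhere, and the bracket is
`G(γ ∪ {x}, x)` for the function `G(γ, x) = F₂ Δ_x F₁ + ⟨∇_x F₁, ∇_x F₂⟩ + F₂ ⟨∇_x F₁, B_μ⟩`.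
Integration over `μ` and the Mecke identity give `∫ ∑_{x ∈ γ} G(γ, x) dμ = 0`, which is `E(F₁, F₂) =
∫ (H F₁) F₂ dμ`. The core is `integral_divergenceAt_eq_zero`, `integral_tsum_divergenceAt` and
`energy_eq_integral_hamiltonian`.

Three kinds of input support this. Calculus: the divergence is defined in a different chart at each
point, and its continuity rests on independence of the chart (`chartDivergence_change`), which is
the Piola identity for the vector density `√(det g) V`. Measurability: finitely many cutoffs and
approximants control each pairing, so the vague Borel structure is generated by countably many
pairings, and configurations form a measurable, s-finite counting kernel; the Mecke identity is then
an identity of measures on `Config X × X`. Integrability: `g` and its derivatives are bounded, while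
gradients and Laplacians of the `φᵢ` are continuous with compact support, so their sums over `γ` are
dominated by some `⟨χ, γ⟩`, whose moments are finite; the drift term is dominated by the hypothesis
on `B_μ`.

The rest is Hilbert space theory. A function orthogonal to all cylinder functions vanishes, by a π-λ
argument. Symmetry of `∫ (H F) G dμ` together with this totality shows that `H` descends to classes
as a linear operator. The form of a nonnegative symmetric operator is closable because each
functional `q(·, y)` is continuous in the norm of `H`; the form completion with its injection `J`
into `H` then yields the Friedrichs extension through its resolvent `(A + 1)⁻¹ = J J*`. -/

set_option linter.unusedSectionVars false

noncomputable section

/-! ### Jacobi's formula and the Piola identity. -/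

section DetDerivative

variable {E : Type*} [NormedAddCommGroup E] [NormedSpace ℝ E]

/-- Jacobi's formula. The determinant is multilinear in the rows, so its derivative is a sum of
determinants with one row replaced; Cramer's rule expands each of them along the replaced row into
entries of the adjugate. -/
theorem Matrix.hasFDerivAt_det {n : Type*} [Fintype n] [DecidableEq n]
    {A : E → n → n → ℝ} {A' : E →L[ℝ] n → n → ℝ} {x : E} (hA : HasFDerivAt A A' x) :
    DifferentiableAt ℝ (fun y => Matrix.det (Matrix.of (A y))) x ∧
    ∀ h : E, fderiv ℝ (fun y => Matrix.det (Matrix.of (A y))) x h =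
      Matrix.trace (Matrix.adjugate (Matrix.of (A x)) * Matrix.of (A' h)) := by
  let D : ContinuousMultilinearMap ℝ (fun _ : n => n → ℝ) ℝ :=
    ⟨(Matrix.detRowAlternating (R := ℝ) (n := n)).toMultilinearMap,
      (continuous_id.matrix_det : Continuous fun M : Matrix n n ℝ => M.det)⟩
  have h1 : HasFDerivAt (fun y => D (A y)) ((D.linearDeriv (A x)).comp A') x :=
    (D.hasFDerivAt (A x)).comp x hA
  have h2 : HasFDerivAt (fun y => Matrix.det (Matrix.of (A y)))
      ((D.linearDeriv (A x)).comp A') x := h1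
  refine ⟨h2.differentiableAt, fun h => ?_⟩
  rw [h2.fderiv]
  change D.linearDeriv (A x) (A' h) = _
  rw [ContinuousMultilinearMap.linearDeriv_apply]
  have h3 : ∀ i, D (Function.update (A x) i (A' h i)) =
      ∑ j, A' h i j * Matrix.adjugate (Matrix.of (A x)) j i := by
    intro i
    change Matrix.det (Matrix.updateRow (Matrix.of (A x)) i (A' h i)) = _
    rw [← Matrix.cramer_transpose_apply]
    conv_lhs => rw [pi_eq_sum_univ (A' h i)]
    rw [map_sum, Finset.sum_apply]
    refine Finset.sum_congr rfl fun j _ => ?_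
    have h4 : (fun k => if j = k then (1 : ℝ) else 0) = Pi.single j 1 := by
      ext k
      simp [Pi.single_apply, eq_comm]
    rw [map_smul, Pi.smul_apply, smul_eq_mul, Matrix.adjugate_def, Matrix.of_apply, h4]
  simp_rw [h3, Matrix.trace, Matrix.diag, Matrix.mul_apply, Matrix.of_apply]
  rw [Finset.sum_comm]
  exact Finset.sum_congr rfl fun j _ => Finset.sum_congr rfl fun i _ => mul_comm _ _

variable [FiniteDimensional ℝ E]

/-- In a basis, the left inverse `K` makes the adjugate of `A x` equal to `det (A x) • K`, which
turns Jacobi's formula into a basis-free trace. -/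
theorem ContinuousLinearMap.fderiv_det {F : Type*} [NormedAddCommGroup F] [NormedSpace ℝ F]
    {A : F → E →L[ℝ] E} {x : F} (hA : DifferentiableAt ℝ A x)
    (K : E →L[ℝ] E) (hK : K ∘L A x = .id ℝ E) :
    DifferentiableAt ℝ (fun y => (A y).det) x ∧
    ∀ h : F, fderiv ℝ (fun y => (A y).det) x h =
      (A x).det * LinearMap.trace ℝ E (K ∘L fderiv ℝ A x h : E →L[ℝ] E) := by
  classical
  let b := Module.finBasis ℝ E
  let M : (E →L[ℝ] E) →ₗ[ℝ] (Fin (Module.finrank ℝ E) → Fin (Module.finrank ℝ E) → ℝ) :=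
    { toFun := fun B => LinearMap.toMatrix b b B
      map_add' := fun B C => by simp; rfl
      map_smul' := fun c B => by simp; rfl }
  let M' := LinearMap.toContinuousLinearMap M
  have hd : ∀ B : E →L[ℝ] E, B.det = Matrix.det (Matrix.of (M' B)) := fun B =>
    (LinearMap.det_toMatrix b (B : E →ₗ[ℝ] E)).symm
  have h1 : HasFDerivAt (fun y => M' (A y)) (M'.comp (fderiv ℝ A x)) x :=
    M'.hasFDerivAt.comp x hA.hasFDerivAt
  obtain ⟨h2, h3⟩ := Matrix.hasFDerivAt_det h1
  simp_rw [hd]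
  refine ⟨h2, fun h => ?_⟩
  rw [h3]
  have hmul : Matrix.of (M' K) * Matrix.of (M' (A x)) = 1 := by
    have h5 : LinearMap.toMatrix b b ((K ∘L A x : E →L[ℝ] E) : E →ₗ[ℝ] E) = 1 := by
      rw [hK]; simp
    rw [← h5, ContinuousLinearMap.toLinearMap_comp, LinearMap.toMatrix_comp b b b]; rfl
  have hadj : Matrix.adjugate (Matrix.of (M' (A x))) =
      Matrix.det (Matrix.of (M' (A x))) • Matrix.of (M' K) := by
    have h6 := congrArg (Matrix.of (M' K) * ·) (Matrix.mul_adjugate (Matrix.of (M' (A x))))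
    rw [← Matrix.mul_assoc, hmul, Matrix.one_mul] at h6
    rw [h6, Matrix.mul_smul, Matrix.mul_one]
  rw [hadj, Matrix.smul_mul, Matrix.trace_smul, smul_eq_mul]
  congr 1
  rw [LinearMap.trace_eq_matrix_trace ℝ b, ContinuousLinearMap.toLinearMap_comp,
    LinearMap.toMatrix_comp b b b]
  rfl

/-- The Piola identity: the divergence transforms under a change of variables by the Jacobian. -/
theorem trace_fderiv_of_piola {τ W W' : E → E} {x : E} (hτ : ContDiffAt ℝ 2 τ x)
    (K : E →L[ℝ] E) (hK : K ∘L fderiv ℝ τ x = .id ℝ E)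
    (hW : DifferentiableAt ℝ W x) (hW' : DifferentiableAt ℝ W' (τ x))
    (h : ∀ᶠ y in 𝓝 x, |(fderiv ℝ τ y).det| • W' (τ y) = fderiv ℝ τ y (W y)) :
    |(fderiv ℝ τ x).det| * LinearMap.trace ℝ E (fderiv ℝ W' (τ x) : E →L[ℝ] E) =
      LinearMap.trace ℝ E (fderiv ℝ W x : E →L[ℝ] E) := by
  have hJ : DifferentiableAt ℝ (fderiv ℝ τ) x :=
    (hτ.fderiv_right (m := 1) (by norm_num)).differentiableAt (by norm_num)
  have hτd : DifferentiableAt ℝ τ x := hτ.differentiableAt (by norm_num)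
  obtain ⟨hdet, hdet'⟩ := ContinuousLinearMap.fderiv_det hJ K hK
  have hK' : fderiv ℝ τ x ∘L K = .id ℝ E := by
    have : (fderiv ℝ τ x : E →ₗ[ℝ] E) ∘ₗ (K : E →ₗ[ℝ] E) = LinearMap.id := by
      rw [LinearMap.comp_eq_id_comm]
      exact congrArg (fun A : E →L[ℝ] E => (A : E →ₗ[ℝ] E)) hK
    ext v
    exact LinearMap.congr_fun this v
  have hne : (fderiv ℝ τ x).det ≠ 0 := by
    intro h0
    have h1 : LinearMap.det ((K ∘L fderiv ℝ τ x : E →L[ℝ] E) : E →ₗ[ℝ] E) = 1 := by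
      rw [hK]; simp
    rw [ContinuousLinearMap.toLinearMap_comp, LinearMap.det_comp] at h1
    change _ * (fderiv ℝ τ x).det = 1 at h1
    rw [h0, mul_zero] at h1
    exact zero_ne_one h1
  set J := fderiv ℝ τ x with hJdef
  set D2 := fderiv ℝ (fderiv ℝ τ) x with hD2
  -- Symmetry of the second derivative allows `v ↦ K (D2 v (W x))` to be read as the composition `K
  -- ∘ D2 (W x)`, whose trace also appears in the derivative of the Jacobian.
  have hsymm : ∀ v w, D2 v w = D2 w v := by
    have := hτ.isSymmSndFDerivAt (by simp)
    exact this.eq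
  have habs : ∀ v, fderiv ℝ (fun y => |(fderiv ℝ τ y).det|) x v =
      |J.det| * LinearMap.trace ℝ E (K ∘L D2 v : E →L[ℝ] E) := by
    intro v
    have h1 := (hdet.hasFDerivAt.abs hne).fderiv
    rw [h1, _root_.smul_apply, hdet', smul_eq_mul, ← mul_assoc]
    congr 1
    rcases lt_or_gt_of_ne hne with h0 | h0 <;> simp [← hJdef, h0, abs_of_neg, abs_of_pos]
  have hL : HasFDerivAt (fun y => |(fderiv ℝ τ y).det| • W' (τ y)) _ x :=
    (hdet.abs hne).hasFDerivAt.smul (hW'.hasFDerivAt.comp x hτd.hasFDerivAt)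
  have hR : HasFDerivAt (fun y => fderiv ℝ τ y (W y)) _ x := hJ.hasFDerivAt.clm_apply hW.hasFDerivAt
  have heq := (hL.congr_of_eventuallyEq (EventuallyEq.symm h)).unique hR
  have hx := h.self_of_nhds
  have hKW : K (W' (τ x)) = |J.det|⁻¹ • W x := by
    have h1 := congrArg K hx
    rw [map_smul] at h1
    have h2 : K (J (W x)) = W x := congrArg (fun A : E →L[ℝ] E => A (W x)) hK
    rw [h2] at h1
    rw [← h1, smul_smul, inv_mul_cancel₀ (abs_ne_zero.2 hne), one_smul]
  -- apply `K` and take traces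
  have hKL : |J.det| • (K ∘L fderiv ℝ W' (τ x) ∘L J) +
      (fderiv ℝ (fun y => |(fderiv ℝ τ y).det|) x).smulRight (K (W' (τ x))) =
      fderiv ℝ W x + K ∘L D2 (W x) := by
    ext v
    have h1 := congrArg (fun A : E →L[ℝ] E => K (A v)) heq
    simp only [_root_.add_apply, _root_.smul_apply,
      ContinuousLinearMap.comp_apply, ContinuousLinearMap.smulRight_apply,
      ContinuousLinearMap.flip_apply, map_add, map_smul] at h1 ⊢
    rw [h1, hsymm v (W x)]
    congr 1
    exact congrArg (fun A : E →L[ℝ] E => A (fderiv ℝ W x v)) hK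
  have htr := congrArg (fun A : E →L[ℝ] E => LinearMap.trace ℝ E (A : E →ₗ[ℝ] E)) hKL
  simp only [ContinuousLinearMap.toLinearMap_add, ContinuousLinearMap.toLinearMap_smul, map_add, map_smul] at htr
  have h1 : LinearMap.trace ℝ E ((K ∘L fderiv ℝ W' (τ x) ∘L J : E →L[ℝ] E) : E →ₗ[ℝ] E) =
      LinearMap.trace ℝ E (fderiv ℝ W' (τ x) : E →L[ℝ] E) := by
    rw [ContinuousLinearMap.toLinearMap_comp, LinearMap.trace_comp_comm', ← ContinuousLinearMap.toLinearMap_comp,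
      ContinuousLinearMap.comp_assoc, hK', ContinuousLinearMap.comp_id]
  -- The trace of the rank-one map `v ↦ ℓ(v) w` is `ℓ(w)`. Since `K (W' (τ x)) = |det J|⁻¹ W x`, the
  -- factor `|det J|` from the derivative of the Jacobian cancels, and so do the second-order terms
  -- on the two sides.
  have h2 : LinearMap.trace ℝ E (((fderiv ℝ (fun y => |(fderiv ℝ τ y).det|) x).smulRight
      (K (W' (τ x))) : E →L[ℝ] E) : E →ₗ[ℝ] E) =
      LinearMap.trace ℝ E (K ∘L D2 (W x) : E →L[ℝ] E) := by
    have h3 : (((fderiv ℝ (fun y => |(fderiv ℝ τ y).det|) x).smulRight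
      (K (W' (τ x))) : E →L[ℝ] E) : E →ₗ[ℝ] E) = LinearMap.smulRight
      (fderiv ℝ (fun y => |(fderiv ℝ τ y).det|) x : E →ₗ[ℝ] ℝ) (K (W' (τ x))) := rfl
    rw [h3, LinearMap.trace_smulRight]
    change fderiv ℝ (fun y => |(fderiv ℝ τ y).det|) x (K (W' (τ x))) = _
    rw [hKW, map_smul, habs, smul_eq_mul, inv_mul_cancel_left₀ (abs_ne_zero.2 hne)]
  rw [h1, h2, smul_eq_mul] at htr
  linarith

end DetDerivative

/-! ### Smoothness of determinants and inverses; Gram determinants. -/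

section MatrixSmoothness

variable {F : Type*} [NormedAddCommGroup F] [NormedSpace ℝ F] {ι : Type*} [Fintype ι]
  [DecidableEq ι] {M : F → Matrix ι ι ℝ} {x : F} {n : WithTop ℕ∞}

theorem ContDiffAt.matrix_det (hM : ∀ i j, ContDiffAt ℝ n (fun y => M y i j) x) :
    ContDiffAt ℝ n (fun y => (M y).det) x := by
  simp_rw [Matrix.det_apply, Units.smul_def, zsmul_eq_mul]
  exact ContDiffAt.sum fun σ _ => contDiffAt_const.mul (contDiffAt_prod fun i _ => hM _ _)

theorem ContDiffAt.matrix_inv (hM : ∀ i j, ContDiffAt ℝ n (fun y => M y i j) x)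
    (hx : (M x).det ≠ 0) (i j : ι) : ContDiffAt ℝ n (fun y => (M y)⁻¹ i j) x := by
  simp_rw [Matrix.inv_def, Matrix.smul_apply, Ring.inverse_eq_inv', smul_eq_mul,
    Matrix.adjugate_apply]
  refine ((ContDiffAt.matrix_det hM).inv hx).mul (ContDiffAt.matrix_det fun k l => ?_)
  by_cases hk : k = j
  · subst hk; simpa using contDiffAt_const
  · simpa [Matrix.updateRow_ne hk] using hM k l

end MatrixSmoothness

theorem Matrix.det_gram_pos {F ι : Type*} [NormedAddCommGroup F] [InnerProductSpace ℝ F] [Fintype ι]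
    [DecidableEq ι] {v : ι → F} (hv : LinearIndependent ℝ v) : 0 < (Matrix.gram ℝ v).det :=
  (Matrix.posDef_gram_of_linearIndependent hv).det_pos

/-- The Gram determinant scales by the square of the determinant. -/
theorem Matrix.sqrt_det_gram_sum {F ι : Type*} [NormedAddCommGroup F] [InnerProductSpace ℝ F]
    [Fintype ι] [DecidableEq ι] (M : Matrix ι ι ℝ) (w : ι → F) :
    √(Matrix.gram ℝ fun i => ∑ j, M i j • w j).det = |M.det| * √(Matrix.gram ℝ w).det := by
  have h : (Matrix.gram ℝ fun i => ∑ j, M i j • w j) = M * Matrix.gram ℝ w * M.transpose := by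
    ext i k
    simp only [Matrix.gram_apply, Matrix.mul_apply, Matrix.transpose_apply, sum_inner, inner_sum,
      real_inner_smul_left, real_inner_smul_right, Finset.sum_mul]
    exact Finset.sum_congr rfl fun j _ => Finset.sum_congr rfl fun l _ => by ring
  rw [h, Matrix.det_mul, Matrix.det_mul, Matrix.det_transpose, mul_right_comm, ← sq,
    Real.sqrt_mul (sq_nonneg _), Real.sqrt_sq_eq_abs]

/-! ### Chart differentials, coordinate frames and smoothness of the metric coefficients. -/

namespace Riem

variable {d : ℕ} {X : Type*} [TopologicalSpace X] [ChartedSpace (EuclideanSpace ℝ (Fin d)) X]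
  [IsManifold (𝓡 d) ∞ X]

section Charts

theorem mdifferentiableAt_extChartAt_symm {c : X} {y : EuclideanSpace ℝ (Fin d)}
    (hy : y ∈ (extChartAt (𝓡 d) c).target) :
    MDifferentiableAt 𝓘(ℝ, EuclideanSpace ℝ (Fin d)) (𝓡 d) (extChartAt (𝓡 d) c).symm y :=
  (mdifferentiableOn_extChartAt_symm y hy).mdifferentiableAt
    ((isOpen_extChartAt_target c).mem_nhds hy)

theorem mfderiv_extChartAt_comp_symm {c : X} {y : EuclideanSpace ℝ (Fin d)}
    (hy : y ∈ (extChartAt (𝓡 d) c).target) (v : EuclideanSpace ℝ (Fin d)) :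
    mfderiv (𝓡 d) 𝓘(ℝ, EuclideanSpace ℝ (Fin d)) (extChartAt (𝓡 d) c)
      ((extChartAt (𝓡 d) c).symm y)
      (mfderiv 𝓘(ℝ, EuclideanSpace ℝ (Fin d)) (𝓡 d) (extChartAt (𝓡 d) c).symm y v) = v := by
  have h := mfderiv_extChartAt_comp_mfderivWithin_extChartAt_symm (I := 𝓡 d) hy
  rw [ModelWithCorners.range_eq_univ, mfderivWithin_univ] at h
  exact congrArg (fun A => A v) h

/-- The differential of the chart centred at `c`, as a linear isomorphism. -/
def chartEquiv (c p : X) (hp : p ∈ (extChartAt (𝓡 d) c).source) :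
    TangentSpace (𝓡 d) p ≃ₗ[ℝ] EuclideanSpace ℝ (Fin d) :=
  LinearEquiv.ofBijective
    (mfderiv (𝓡 d) 𝓘(ℝ, EuclideanSpace ℝ (Fin d)) (extChartAt (𝓡 d) c) p).toLinearMap
    (isInvertible_mfderiv_extChartAt hp).bijective

theorem chartEquiv_apply (c p : X) (hp : p ∈ (extChartAt (𝓡 d) c).source)
    (v : TangentSpace (𝓡 d) p) : chartEquiv c p hp v =
      mfderiv (𝓡 d) 𝓘(ℝ, EuclideanSpace ℝ (Fin d)) (extChartAt (𝓡 d) c) p v := rfl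

variable [RiemannianBundle (fun x : X => TangentSpace (𝓡 d) x)]

theorem coordVector_eq {c : X} {y : EuclideanSpace ℝ (Fin d)}
    (hy : y ∈ (extChartAt (𝓡 d) c).target) (i : Fin d) :
    coordVector c y i = (chartEquiv c _ ((extChartAt (𝓡 d) c).map_target hy)).symm
      (EuclideanSpace.single i 1) := by
  rw [LinearEquiv.eq_symm_apply, chartEquiv_apply]
  exact mfderiv_extChartAt_comp_symm hy _

theorem component_eq {c : X} {y : EuclideanSpace ℝ (Fin d)}
    (hy : y ∈ (extChartAt (𝓡 d) c).target) (V : (x : X) → TangentSpace (𝓡 d) x) (i : Fin d) :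
    component V c i y = chartEquiv c _ ((extChartAt (𝓡 d) c).map_target hy)
      (V ((extChartAt (𝓡 d) c).symm y)) i := rfl

theorem sum_component_smul_coordVector {c : X} {y : EuclideanSpace ℝ (Fin d)}
    (hy : y ∈ (extChartAt (𝓡 d) c).target) (V : (x : X) → TangentSpace (𝓡 d) x) :
    ∑ i, component V c i y • coordVector c y i = V ((extChartAt (𝓡 d) c).symm y) := by
  apply (chartEquiv c _ ((extChartAt (𝓡 d) c).map_target hy)).injective
  rw [map_sum]
  simp_rw [map_smul, coordVector_eq hy, LinearEquiv.apply_symm_apply, component_eq hy]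
  ext j
  simp [Pi.single_apply]

theorem linearIndependent_coordVector {c : X} {y : EuclideanSpace ℝ (Fin d)}
    (hy : y ∈ (extChartAt (𝓡 d) c).target) : LinearIndependent ℝ (coordVector c y) := by
  have h : coordVector c y = ⇑((EuclideanSpace.basisFun (Fin d) ℝ).toBasis.map
      (chartEquiv c _ ((extChartAt (𝓡 d) c).map_target hy)).symm) := by
    ext1 i
    rw [coordVector_eq hy, Module.Basis.map_apply, OrthonormalBasis.coe_toBasis,
      EuclideanSpace.basisFun_apply]
  rw [h]
  exact Module.Basis.linearIndependent _

theorem det_gram_pos {c : X} {y : EuclideanSpace ℝ (Fin d)}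
    (hy : y ∈ (extChartAt (𝓡 d) c).target) : 0 < (Matrix.gram ℝ (coordVector c y)).det :=
  Matrix.det_gram_pos (linearIndependent_coordVector hy)

theorem sqrtDet_eq (c : X) (y : EuclideanSpace ℝ (Fin d)) :
    sqrtDet c y = √(Matrix.gram ℝ (coordVector c y)).det := rfl

theorem sqrtDet_pos {c : X} {y : EuclideanSpace ℝ (Fin d)}
    (hy : y ∈ (extChartAt (𝓡 d) c).target) : 0 < sqrtDet c y :=
  Real.sqrt_pos.2 (det_gram_pos hy)

theorem inner_grad {f : X → ℝ} {x : X} (v : TangentSpace (𝓡 d) x) :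
    (inner ℝ (grad f x) v : ℝ) = mfderiv (𝓡 d) 𝓘(ℝ, ℝ) f x v := by
  have : FiniteDimensional ℝ (TangentSpace (𝓡 d) x) :=
    inferInstanceAs (FiniteDimensional ℝ (EuclideanSpace ℝ (Fin d)))
  have : CompleteSpace (TangentSpace (𝓡 d) x) := FiniteDimensional.complete ℝ _
  exact InnerProductSpace.toDual_symm_apply

theorem grad_congr {f g : X → ℝ} {x : X} (h : f =ᶠ[𝓝 x] g) :
    grad (d := d) f x = grad g x := by
  simp only [grad, h.mfderiv_eq]

theorem fderiv_comp_extChartAt_symm {f : X → ℝ} {c : X} {y : EuclideanSpace ℝ (Fin d)}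
    (hy : y ∈ (extChartAt (𝓡 d) c).target)
    (hf : MDifferentiableAt (𝓡 d) 𝓘(ℝ, ℝ) f ((extChartAt (𝓡 d) c).symm y))
    (v : EuclideanSpace ℝ (Fin d)) :
    fderiv ℝ (f ∘ (extChartAt (𝓡 d) c).symm) y v =
      mfderiv (𝓡 d) 𝓘(ℝ, ℝ) f ((extChartAt (𝓡 d) c).symm y)
        (mfderiv 𝓘(ℝ, EuclideanSpace ℝ (Fin d)) (𝓡 d) (extChartAt (𝓡 d) c).symm y v) := by
  rw [← mfderiv_eq_fderiv, mfderiv_comp _ hf (mdifferentiableAt_extChartAt_symm hy)]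
  rfl

end Charts

section Smooth

variable [RiemannianBundle (fun x : X => TangentSpace (𝓡 d) x)]

/-- The coordinate field is the tangent map of the smooth inverse chart applied to a constant
section. -/
theorem contMDiffOn_coordVector (c : X) (i : Fin d) :
    ContMDiffOn 𝓘(ℝ, EuclideanSpace ℝ (Fin d)) (𝓡 d).tangent ∞
      (fun y => (⟨(extChartAt (𝓡 d) c).symm y, coordVector c y i⟩ : TangentBundle (𝓡 d) X))
      (extChartAt (𝓡 d) c).target := by
  have h1 := (contMDiffOn_extChartAt_symm (I := 𝓡 d) (n := ∞) c).contMDiffOn_tangentMapWithin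
    (m := ∞) (by simp) (isOpen_extChartAt_target c).uniqueMDiffOn
  have h2 : ContMDiff 𝓘(ℝ, EuclideanSpace ℝ (Fin d)) 𝓘(ℝ, EuclideanSpace ℝ (Fin d)).tangent ∞
      (fun y => (⟨y, (EuclideanSpace.single i 1 : EuclideanSpace ℝ (Fin d))⟩ :
        TangentBundle 𝓘(ℝ, EuclideanSpace ℝ (Fin d)) (EuclideanSpace ℝ (Fin d)))) :=
    contMDiff_vectorSpace_iff_contDiff.2 contDiff_const
  refine (h1.comp h2.contMDiffOn fun y hy => hy).congr fun y hy => ?_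
  rw [Function.comp, tangentMapWithin_eq_tangentMap
    ((isOpen_extChartAt_target c).uniqueMDiffOn _ hy) (mdifferentiableAt_extChartAt_symm hy)]
  rfl

variable [IsContMDiffRiemannianBundle (𝓡 d) ∞ (EuclideanSpace ℝ (Fin d))
      (fun x : X => TangentSpace (𝓡 d) x)]

theorem contDiffAt_gram {c : X} {y : EuclideanSpace ℝ (Fin d)}
    (hy : y ∈ (extChartAt (𝓡 d) c).target) (i j : Fin d) :
    ContDiffAt ℝ ∞ (fun y => Matrix.gram ℝ (coordVector c y) i j) y := by
  have h := (contMDiffOn_coordVector c i).inner_bundle (contMDiffOn_coordVector c j)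
  exact ((contMDiffOn_iff_contDiffOn.1 h) y hy).contDiffAt
    ((isOpen_extChartAt_target c).mem_nhds hy)

theorem contDiffAt_sqrtDet {c : X} {y : EuclideanSpace ℝ (Fin d)}
    (hy : y ∈ (extChartAt (𝓡 d) c).target) : ContDiffAt ℝ ∞ (sqrtDet c) y :=
  (ContDiffAt.matrix_det fun i j => contDiffAt_gram hy i j).sqrt (det_gram_pos hy).ne'

omit [IsContMDiffRiemannianBundle (𝓡 d) ∞ (EuclideanSpace ℝ (Fin d))
      (fun x : X => TangentSpace (𝓡 d) x)] in
-- The trivialization of the tangent bundle at `c` acts on vectors as the differential of the chart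
-- at `c`, so smoothness of a field can be tested on its chart components.
theorem contMDiffAt_section_iff_mfderiv {V : (x : X) → TangentSpace (𝓡 d) x} {c p : X}
    (hp : p ∈ (extChartAt (𝓡 d) c).source) :
    ContMDiffAt (𝓡 d) (𝓡 d).tangent ∞ (fun x => (⟨x, V x⟩ : TangentBundle (𝓡 d) X)) p ↔
    ContMDiffAt (𝓡 d) 𝓘(ℝ, EuclideanSpace ℝ (Fin d)) ∞ (fun x =>
      mfderiv (𝓡 d) 𝓘(ℝ, EuclideanSpace ℝ (Fin d)) (extChartAt (𝓡 d) c) x (V x)) p := by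
  let e := trivializationAt (EuclideanSpace ℝ (Fin d)) (TangentSpace (𝓡 d) : X → Type _) c
  have hp' : p ∈ e.baseSet := by simpa [e] using hp
  refine (e.contMDiffAt_section_iff (IB := 𝓡 d) (n := ∞) (s := V) hp').trans ?_
  apply Filter.EventuallyEq.contMDiffAt_iff
  filter_upwards [(isOpen_extChartAt_source c).mem_nhds hp] with x hx
  have hx' : x ∈ (chartAt (EuclideanSpace ℝ (Fin d)) c).source := by simpa using hx
  rw [← TangentBundle.continuousLinearMapAt_trivializationAt hx']
  exact (e.continuousLinearMapAt_apply_of_mem (R := ℝ) (by simpa [e] using hx) _).symm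

end Smooth

end Riem

/-! ### Fields in coordinates: components, gradient, vector density. -/

namespace Riem

variable {d : ℕ} {X : Type*} [TopologicalSpace X] [ChartedSpace (EuclideanSpace ℝ (Fin d)) X]
  [IsManifold (𝓡 d) ∞ X] [RiemannianBundle (fun x : X => TangentSpace (𝓡 d) x)]

/-- Smoothness of a vector field. -/
abbrev IsSmoothFieldAt (V : (x : X) → TangentSpace (𝓡 d) x) (p : X) : Prop :=
  ContMDiffAt (𝓡 d) (𝓡 d).tangent ∞ (fun x => (⟨x, V x⟩ : TangentBundle (𝓡 d) X)) p

theorem contDiffAt_component {V : (x : X) → TangentSpace (𝓡 d) x} {c : X}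
    {y : EuclideanSpace ℝ (Fin d)} (hy : y ∈ (extChartAt (𝓡 d) c).target)
    (hV : IsSmoothFieldAt V ((extChartAt (𝓡 d) c).symm y)) (i : Fin d) :
    ContDiffAt ℝ ∞ (component V c i) y := by
  have h1 := (contMDiffAt_section_iff_mfderiv ((extChartAt (𝓡 d) c).map_target hy)).1 hV
  have h2 := h1.comp y ((contMDiffOn_extChartAt_symm (I := 𝓡 d) (n := ∞) c).contMDiffAt
    ((isOpen_extChartAt_target c).mem_nhds hy))
  exact contDiffAt_euclidean.1 (contMDiffAt_iff_contDiffAt.1 h2) i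

theorem isSmoothFieldAt_of_component {V : (x : X) → TangentSpace (𝓡 d) x} {c p : X}
    (hp : p ∈ (extChartAt (𝓡 d) c).source)
    (h : ∀ i, ContDiffAt ℝ ∞ (component V c i) (extChartAt (𝓡 d) c p)) :
    IsSmoothFieldAt V p := by
  have hp' : p ∈ (chartAt (EuclideanSpace ℝ (Fin d)) c).source := by simpa using hp
  refine (contMDiffAt_section_iff_mfderiv hp).2 ?_
  have h1 : ContDiffAt ℝ ∞ (fun y => WithLp.toLp 2 fun i => component V c i y)
      (extChartAt (𝓡 d) c p) := contDiffAt_euclidean.2 h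
  have h2 := h1.contMDiffAt.comp p (contMDiffAt_extChartAt' (I := 𝓡 d) (n := ∞) hp')
  refine h2.congr_of_eventuallyEq ?_
  filter_upwards [(isOpen_extChartAt_source c).mem_nhds hp] with x hx
  ext i
  simp only [Function.comp, component]
  rw [(extChartAt (𝓡 d) c).left_inv hx]

/-- Raising the index: pairing the gradient with the coordinate vectors gives the partial
derivatives as the Gram matrix times the components, and the Gram matrix is invertible. -/
theorem component_grad {f : X → ℝ} {c : X} {y : EuclideanSpace ℝ (Fin d)}
    (hy : y ∈ (extChartAt (𝓡 d) c).target)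
    (hf : MDifferentiableAt (𝓡 d) 𝓘(ℝ, ℝ) f ((extChartAt (𝓡 d) c).symm y)) (i : Fin d) :
    component (grad f) c i y = ∑ j, (Matrix.gram ℝ (coordVector c y))⁻¹ i j *
      fderiv ℝ (f ∘ (extChartAt (𝓡 d) c).symm) y (EuclideanSpace.single j 1) := by
  have h1 : Matrix.mulVec (Matrix.gram ℝ (coordVector c y))
      (fun i => component (grad f) c i y) = fun j =>
      fderiv ℝ (f ∘ (extChartAt (𝓡 d) c).symm) y (EuclideanSpace.single j 1) := by
    ext j
    rw [fderiv_comp_extChartAt_symm hy hf]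
    change _ = mfderiv (𝓡 d) 𝓘(ℝ, ℝ) f _ (coordVector c y j)
    rw [← inner_grad, ← sum_component_smul_coordVector hy (grad f), sum_inner]
    simp only [Matrix.mulVec, dotProduct, Matrix.gram_apply]
    exact Finset.sum_congr rfl fun i _ => by
      rw [real_inner_smul_left, mul_comm, real_inner_comm]
  have h2 := congrArg (fun u => Matrix.mulVec (Matrix.gram ℝ (coordVector c y))⁻¹ u i) h1
  simp only [Matrix.mulVec_mulVec] at h2
  rw [Matrix.nonsing_inv_mul _ (isUnit_iff_ne_zero.2 (det_gram_pos hy).ne'), Matrix.one_mulVec]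
    at h2
  exact h2

variable [IsContMDiffRiemannianBundle (𝓡 d) ∞ (EuclideanSpace ℝ (Fin d))
      (fun x : X => TangentSpace (𝓡 d) x)]

theorem isSmoothFieldAt_grad {f : X → ℝ} (hf : ContMDiff (𝓡 d) 𝓘(ℝ, ℝ) ∞ f) (p : X) :
    IsSmoothFieldAt (d := d) (grad f) p := by
  have hp := mem_extChartAt_source (I := 𝓡 d) p
  have hy := (extChartAt (𝓡 d) p).map_source hp
  refine isSmoothFieldAt_of_component hp fun i => ?_
  have hsymm := (contMDiffOn_extChartAt_symm (I := 𝓡 d) (n := ∞) p).contMDiffAt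
    ((isOpen_extChartAt_target p).mem_nhds hy)
  have h1 : ContDiffAt ℝ ∞ (f ∘ (extChartAt (𝓡 d) p).symm) (extChartAt (𝓡 d) p p) :=
    contMDiffAt_iff_contDiffAt.1 (hf.contMDiffAt.comp _ hsymm)
  have h2 : ContDiffAt ℝ ∞ (fderiv ℝ (f ∘ (extChartAt (𝓡 d) p).symm)) (extChartAt (𝓡 d) p p) :=
    h1.fderiv_right (by simp)
  have h3 : ContDiffAt ℝ ∞ (fun y => ∑ j, (Matrix.gram ℝ (coordVector p y))⁻¹ i j *
      fderiv ℝ (f ∘ (extChartAt (𝓡 d) p).symm) y (EuclideanSpace.single j 1))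
      (extChartAt (𝓡 d) p p) :=
    ContDiffAt.sum fun j _ => (ContDiffAt.matrix_inv (fun i j => contDiffAt_gram hy i j)
      (det_gram_pos hy).ne' i j).mul (h2.clm_apply contDiffAt_const)
  refine h3.congr_of_eventuallyEq ?_
  filter_upwards [(isOpen_extChartAt_target p).mem_nhds hy] with y hy1
  exact component_grad hy1 (hf.mdifferentiable (by simp) _) i

/-- The vector field `V`, multiplied by `√(det g)`, in the coordinates of the chart at `c`. -/
def density (V : (x : X) → TangentSpace (𝓡 d) x) (c : X) (y : EuclideanSpace ℝ (Fin d)) :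
    EuclideanSpace ℝ (Fin d) :=
  WithLp.toLp 2 fun i => sqrtDet c y * component V c i y

theorem contDiffAt_density {V : (x : X) → TangentSpace (𝓡 d) x} {c : X}
    {y : EuclideanSpace ℝ (Fin d)} (hy : y ∈ (extChartAt (𝓡 d) c).target)
    (hV : IsSmoothFieldAt V ((extChartAt (𝓡 d) c).symm y)) :
    ContDiffAt ℝ ∞ (density V c) y :=
  contDiffAt_euclidean.2 fun i => (contDiffAt_sqrtDet hy).mul (contDiffAt_component hy hV i)

/-- Rewrites the coordinate divergence as a trace, the form in which the Piola identity applies. -/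
theorem trace_fderiv_eq_sum {W : EuclideanSpace ℝ (Fin d) → EuclideanSpace ℝ (Fin d)}
    {y : EuclideanSpace ℝ (Fin d)} (hW : DifferentiableAt ℝ W y) :
    LinearMap.trace ℝ _ (fderiv ℝ W y : EuclideanSpace ℝ (Fin d) →ₗ[ℝ] _) =
      ∑ i, fderiv ℝ (fun z => W z i) y (EuclideanSpace.single i 1) := by
  rw [LinearMap.trace_eq_sum_inner _ (EuclideanSpace.basisFun (Fin d) ℝ)]
  refine Finset.sum_congr rfl fun i _ => ?_
  have h : HasFDerivAt (fun z => W z i)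
      ((EuclideanSpace.proj i : EuclideanSpace ℝ (Fin d) →L[ℝ] ℝ).comp (fderiv ℝ W y)) y :=
    (EuclideanSpace.proj i : EuclideanSpace ℝ (Fin d) →L[ℝ] ℝ).hasFDerivAt.comp y hW.hasFDerivAt
  rw [h.fderiv]
  simp [EuclideanSpace.inner_single_left]

/-- The divergence computed in the chart centred at `c`. -/
def chartDivergence (V : (x : X) → TangentSpace (𝓡 d) x) (c : X)
    (y : EuclideanSpace ℝ (Fin d)) : ℝ :=
  (sqrtDet c y)⁻¹ * LinearMap.trace ℝ _ (fderiv ℝ (density V c) y :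
    EuclideanSpace ℝ (Fin d) →ₗ[ℝ] EuclideanSpace ℝ (Fin d))

theorem divergence_eq_chartDivergence_self {V : (x : X) → TangentSpace (𝓡 d) x} {x : X}
    (hV : IsSmoothFieldAt V x) :
    divergence V x = chartDivergence V x (extChartAt (𝓡 d) x x) := by
  have hx := mem_extChartAt_target (I := 𝓡 d) x
  have h := contDiffAt_density (V := V) hx (by rwa [(extChartAt (𝓡 d) x).left_inv (by simp)])
  rw [chartDivergence, trace_fderiv_eq_sum (h.differentiableAt (by simp))]
  rfl

/-- Both coordinate frames at `p` are images of the standard basis under inverse chart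
differentials, so they differ by the matrix of the transition differential; a Gram determinant
scales by the square of its determinant. -/
theorem sqrtDet_change {a b p : X} (ha : p ∈ (extChartAt (𝓡 d) a).source)
    (hb : p ∈ (extChartAt (𝓡 d) b).source) :
    sqrtDet a (extChartAt (𝓡 d) a p) =
      |LinearMap.det (((chartEquiv a p ha).symm.trans (chartEquiv b p hb)).toLinearMap)| *
        sqrtDet b (extChartAt (𝓡 d) b p) := by
  have key : ∀ (c : X) (hc : p ∈ (extChartAt (𝓡 d) c).source),
      sqrtDet c (extChartAt (𝓡 d) c p) = √(Matrix.gram ℝ fun i =>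
        (chartEquiv c p hc).symm (EuclideanSpace.single i 1)).det := by
    intro c hc
    have hy := (extChartAt (𝓡 d) c).map_source hc
    -- The coordinate vectors live in the tangent space at the inverse chart value, which equals `p`
    -- only propositionally; a variable base point `q` makes the substitution possible.
    have : ∀ (q : X) (hq : q = p) (hq' : q ∈ (extChartAt (𝓡 d) c).source),
        (Matrix.gram ℝ fun i => (chartEquiv c q hq').symm (EuclideanSpace.single i 1)) =
        (Matrix.gram ℝ fun i => (chartEquiv c p hc).symm (EuclideanSpace.single i 1)) := by
      rintro q rfl hq'; rfl
    rw [sqrtDet_eq, ← this _ ((extChartAt (𝓡 d) c).left_inv hc)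
      ((extChartAt (𝓡 d) c).map_target hy)]
    congr 2
    ext i j
    simp only [Matrix.gram_apply, coordVector_eq hy]
  rw [key a ha, key b hb]
  set A := ((chartEquiv a p ha).symm.trans (chartEquiv b p hb)).toLinearMap with hA
  let e := (EuclideanSpace.basisFun (Fin d) ℝ).toBasis
  rw [← LinearMap.det_toMatrix e, ← Matrix.det_transpose (LinearMap.toMatrix e e A), ← Matrix.sqrt_det_gram_sum]
  refine congrArg (fun G => √(Matrix.det G)) ?_
  refine congrArg (Matrix.gram (E := TangentSpace (𝓡 d) p) ℝ) (funext fun i => ?_)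
  apply (chartEquiv b p hb).injective
  rw [map_sum]
  simp_rw [map_smul, LinearEquiv.apply_symm_apply]
  ext j
  simp [LinearMap.toMatrix_apply, e, Pi.single_apply, hA]

end Riem

/-! ### Chart independence and Leibniz rules for the divergence. -/

namespace Riem

variable {d : ℕ} {X : Type*} [TopologicalSpace X] [ChartedSpace (EuclideanSpace ℝ (Fin d)) X]
  [IsManifold (𝓡 d) ∞ X] [RiemannianBundle (fun x : X => TangentSpace (𝓡 d) x)]
  [IsContMDiffRiemannianBundle (𝓡 d) ∞ (EuclideanSpace ℝ (Fin d))
      (fun x : X => TangentSpace (𝓡 d) x)]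

theorem component_zero (c : X) (i : Fin d) (y : EuclideanSpace ℝ (Fin d)) :
    component (fun x : X => (0 : TangentSpace (𝓡 d) x)) c i y = 0 :=
  congrArg (fun v : EuclideanSpace ℝ (Fin d) => v i)
    (map_zero (mfderiv (𝓡 d) 𝓘(ℝ, EuclideanSpace ℝ (Fin d)) (extChartAt (𝓡 d) c)
      ((extChartAt (𝓡 d) c).symm y)))

theorem component_add (V W : (x : X) → TangentSpace (𝓡 d) x) (c : X) (i : Fin d)
    (y : EuclideanSpace ℝ (Fin d)) :
    component (fun x => V x + W x) c i y = component V c i y + component W c i y :=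
  congrArg (fun v : EuclideanSpace ℝ (Fin d) => v i)
    (map_add (mfderiv (𝓡 d) 𝓘(ℝ, EuclideanSpace ℝ (Fin d)) (extChartAt (𝓡 d) c)
      ((extChartAt (𝓡 d) c).symm y)) (V _) (W _))

theorem component_smul (f : X → ℝ) (V : (x : X) → TangentSpace (𝓡 d) x) (c : X) (i : Fin d)
    (y : EuclideanSpace ℝ (Fin d)) :
    component (fun x => f x • V x) c i y = f ((extChartAt (𝓡 d) c).symm y) * component V c i y :=
  congrArg (fun v : EuclideanSpace ℝ (Fin d) => v i)
    (map_smul (mfderiv (𝓡 d) 𝓘(ℝ, EuclideanSpace ℝ (Fin d)) (extChartAt (𝓡 d) c)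
      ((extChartAt (𝓡 d) c).symm y)) (f _) (V _))

theorem density_extChartAt (V : (x : X) → TangentSpace (𝓡 d) x) {c q : X}
    (hq : q ∈ (extChartAt (𝓡 d) c).source) :
    density V c (extChartAt (𝓡 d) c q) =
      sqrtDet c (extChartAt (𝓡 d) c q) • chartEquiv c q hq (V q) := by
  ext i
  simp only [density, component, PiLp.smul_apply, smul_eq_mul]
  rw [(extChartAt (𝓡 d) c).left_inv hq]
  rfl

theorem fderiv_transition {a b q : X} (ha : q ∈ (extChartAt (𝓡 d) a).source)
    (hb : q ∈ (extChartAt (𝓡 d) b).source) :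
    (fderiv ℝ (extChartAt (𝓡 d) b ∘ (extChartAt (𝓡 d) a).symm) (extChartAt (𝓡 d) a q) :
      EuclideanSpace ℝ (Fin d) →ₗ[ℝ] EuclideanSpace ℝ (Fin d)) =
      ((chartEquiv a q ha).symm.trans (chartEquiv b q hb)).toLinearMap := by
  have hy := (extChartAt (𝓡 d) a).map_source ha
  have hq := (extChartAt (𝓡 d) a).left_inv ha
  have hb' : q ∈ (chartAt (EuclideanSpace ℝ (Fin d)) b).source := by simpa using hb
  have h1 := mfderiv_comp_of_eq (mdifferentiableAt_extChartAt (I := 𝓡 d) hb')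
    (mdifferentiableAt_extChartAt_symm hy) hq
  rw [mfderiv_eq_fderiv] at h1
  -- As the two base points are equal only propositionally, vectors are compared through the chart
  -- differential at a variable point `r`.
  have key : ∀ (r : X) (hr : r = q) (v : TangentSpace (𝓡 d) r)
      (hra : r ∈ (extChartAt (𝓡 d) a).source) (hrb : r ∈ (extChartAt (𝓡 d) b).source),
      (chartEquiv b r hrb v) = chartEquiv b q hb ((chartEquiv a q ha).symm
        (chartEquiv a r hra v)) := by
    rintro r rfl v _ _
    simp
  ext1 v
  have h2 := congrArg (fun A => A v) h1
  refine h2.trans ?_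
  have h3 := key _ hq (mfderiv 𝓘(ℝ, EuclideanSpace ℝ (Fin d)) (𝓡 d) (extChartAt (𝓡 d) a).symm
    (extChartAt (𝓡 d) a q) v) (hq.symm ▸ ha) (hq.symm ▸ hb)
  refine h3.trans ?_
  rw [chartEquiv_apply a, mfderiv_extChartAt_comp_symm hy]
  rfl

/-- Under the transition map `τ` the density `√(det g) V` satisfies `|det Dτ| W_b ∘ τ = Dτ W_a`,
because `√(det g)` picks up the Jacobian while `V` is pushed forward. The Piola identity then
equates the two traces up to the factor by which `√(det g)` changes. -/
theorem chartDivergence_change {V : (x : X) → TangentSpace (𝓡 d) x} {a b p : X}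
    (hV : ∀ x, IsSmoothFieldAt V x)
    (ha : p ∈ (extChartAt (𝓡 d) a).source) (hb : p ∈ (extChartAt (𝓡 d) b).source) :
    chartDivergence V a (extChartAt (𝓡 d) a p) = chartDivergence V b (extChartAt (𝓡 d) b p) := by
  have hb' : p ∈ (chartAt (EuclideanSpace ℝ (Fin d)) b).source := by simpa using hb
  have hya := (extChartAt (𝓡 d) a).map_source ha
  have hyb := (extChartAt (𝓡 d) b).map_source hb
  have hpa := (extChartAt (𝓡 d) a).left_inv ha
  set τ := extChartAt (𝓡 d) b ∘ (extChartAt (𝓡 d) a).symm with hτdef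
  have hτp : τ (extChartAt (𝓡 d) a p) = extChartAt (𝓡 d) b p := by rw [hτdef, Function.comp, hpa]
  have hsymm := (contMDiffOn_extChartAt_symm (I := 𝓡 d) (n := 2) a).contMDiffAt
    ((isOpen_extChartAt_target a).mem_nhds hya)
  have hτ : ContDiffAt ℝ 2 τ (extChartAt (𝓡 d) a p) := by
    refine contMDiffAt_iff_contDiffAt.1 (ContMDiffAt.comp _ ?_ hsymm)
    rw [hpa]
    exact contMDiffAt_extChartAt' hb'
  let A := (chartEquiv a p ha).symm.trans (chartEquiv b p hb)
  have hfd := fderiv_transition ha hb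
  have hK : (LinearMap.toContinuousLinearMap A.symm.toLinearMap) ∘L
      fderiv ℝ τ (extChartAt (𝓡 d) a p) = .id ℝ _ := by
    ext1 v
    have := LinearMap.congr_fun hfd v
    change A.symm (fderiv ℝ τ (extChartAt (𝓡 d) a p) v) = v
    rw [LinearEquiv.symm_apply_eq]
    exact this
  have hdW := (contDiffAt_density (V := V) hya (hV _)).differentiableAt (by simp)
  have hdW' : DifferentiableAt ℝ (density V b) (τ (extChartAt (𝓡 d) a p)) := by
    rw [hτp]
    exact (contDiffAt_density (V := V) hyb (hV _)).differentiableAt (by simp)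
  have hev : ∀ᶠ y in 𝓝 (extChartAt (𝓡 d) a p),
      |(fderiv ℝ τ y).det| • density V b (τ y) = fderiv ℝ τ y (density V a y) := by
    have h1 : ∀ᶠ y in 𝓝 (extChartAt (𝓡 d) a p),
        (extChartAt (𝓡 d) a).symm y ∈ (extChartAt (𝓡 d) b).source := by
      refine hsymm.continuousAt.eventually ?_
      rw [hpa]
      exact (isOpen_extChartAt_source b).mem_nhds hb
    filter_upwards [h1, (isOpen_extChartAt_target a).mem_nhds hya] with y hy1 hy2
    have hq := (extChartAt (𝓡 d) a).map_target hy2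
    obtain ⟨q, hqdef⟩ : ∃ q, q = (extChartAt (𝓡 d) a).symm y := ⟨_, rfl⟩
    rw [← hqdef] at hq hy1
    have hyq : y = extChartAt (𝓡 d) a q := by
      rw [hqdef, (extChartAt (𝓡 d) a).right_inv hy2]
    have hτq : τ y = extChartAt (𝓡 d) b q := by simp [hτdef, hqdef]
    have hfq := fderiv_transition hq hy1
    rw [hτq, hyq, density_extChartAt V hq, density_extChartAt V hy1, map_smul, smul_smul]
    have h4 : fderiv ℝ τ (extChartAt (𝓡 d) a q) (chartEquiv a q hq (V q)) =
        chartEquiv b q hy1 (V q) := by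
      refine (LinearMap.congr_fun hfq _).trans ?_
      simp
    have h5 : (fderiv ℝ τ (extChartAt (𝓡 d) a q)).det = LinearMap.det
        (((chartEquiv a q hq).symm.trans (chartEquiv b q hy1)).toLinearMap) :=
      congrArg LinearMap.det hfq
    rw [h4, h5, ← sqrtDet_change hq hy1]
  have hmain := trace_fderiv_of_piola hτ _ hK hdW hdW' hev
  have hdet : (fderiv ℝ τ (extChartAt (𝓡 d) a p)).det = LinearMap.det
        (((chartEquiv a p ha).symm.trans (chartEquiv b p hb)).toLinearMap) :=
      congrArg LinearMap.det hfd
  have hs := sqrtDet_change ha hb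
  have hsa := sqrtDet_pos hya
  have hsb := sqrtDet_pos hyb
  rw [hdet] at hmain
  rw [hτp] at hmain
  rw [chartDivergence, chartDivergence, ← hmain, hs]
  rw [hs] at hsa
  have h6 := (pos_iff_pos_of_mul_pos hsa).2 hsb
  rw [mul_inv, mul_mul_mul_comm, inv_mul_cancel₀ h6.ne', one_mul]

theorem divergence_eq_chartDivergence {V : (x : X) → TangentSpace (𝓡 d) x}
    (hV : ∀ x, IsSmoothFieldAt V x) {c p : X} (hp : p ∈ (extChartAt (𝓡 d) c).source) :
    divergence V p = chartDivergence V c (extChartAt (𝓡 d) c p) :=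
  (divergence_eq_chartDivergence_self (hV p)).trans
    (chartDivergence_change hV (mem_extChartAt_source p) hp)

/-- The definition changes chart from point to point; near `p` chart independence replaces all these
charts by the single one at `p`, where the formula is visibly continuous. -/
theorem continuous_divergence {V : (x : X) → TangentSpace (𝓡 d) x}
    (hV : ∀ x, IsSmoothFieldAt V x) : Continuous (divergence (d := d) V) := by
  refine continuous_iff_continuousAt.2 fun p => ?_
  have hp := mem_extChartAt_source (I := 𝓡 d) p
  have hy := (extChartAt (𝓡 d) p).map_source hp
  have h1 : ContinuousAt (chartDivergence V p) (extChartAt (𝓡 d) p p) := by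
    have h2 := contDiffAt_density (V := V) hy (hV _)
    have h3 : ContinuousAt (fderiv ℝ (density V p)) (extChartAt (𝓡 d) p p) :=
      (h2.fderiv_right (m := 0) (by simp)).continuousAt
    refine ((contDiffAt_sqrtDet hy).continuousAt.inv₀ (sqrtDet_pos hy).ne').mul ?_
    let L : (EuclideanSpace ℝ (Fin d) →L[ℝ] EuclideanSpace ℝ (Fin d)) →ₗ[ℝ] ℝ :=
      { toFun := fun A => LinearMap.trace ℝ _ (A : EuclideanSpace ℝ (Fin d) →ₗ[ℝ] _)
        map_add' := fun A B => by simp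
        map_smul' := fun c A => by simp }
    exact L.continuous_of_finiteDimensional.continuousAt.comp h3
  have h2 : ContinuousAt (chartDivergence V p ∘ extChartAt (𝓡 d) p) p :=
    h1.comp (continuousAt_extChartAt p)
  refine h2.congr ?_
  filter_upwards [(isOpen_extChartAt_source p).mem_nhds hp] with q hq
  exact (divergence_eq_chartDivergence hV hq).symm

theorem divergence_congr {V W : (x : X) → TangentSpace (𝓡 d) x} {x : X}
    (h : ∀ᶠ y in 𝓝 x, V y = W y) : divergence (d := d) V x = divergence W x := by
  have hc : ContinuousAt (extChartAt (𝓡 d) x).symm (extChartAt (𝓡 d) x x) :=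
    continuousAt_extChartAt_symm x
  have h1 : ∀ᶠ y in 𝓝 (extChartAt (𝓡 d) x x), V ((extChartAt (𝓡 d) x).symm y) =
      W ((extChartAt (𝓡 d) x).symm y) := by
    refine hc.eventually (p := fun z => V z = W z) ?_
    rwa [(extChartAt (𝓡 d) x).left_inv (by simp)]
  rw [divergence, divergence]
  congr 1
  refine Finset.sum_congr rfl fun i _ => ?_
  congr 1
  refine Filter.EventuallyEq.fderiv_eq ?_
  filter_upwards [h1] with y hy
  simp only [component, hy]

theorem laplacian_congr {f g : X → ℝ} {x : X} (h : f =ᶠ[𝓝 x] g) :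
    laplacian (d := d) f x = laplacian (d := d) g x :=
  divergence_congr (h.eventually_nhds.mono fun _ hy => grad_congr hy)

theorem divergence_zero (x : X) :
    divergence (d := d) (fun y : X => (0 : TangentSpace (𝓡 d) y)) x = 0 := by
  have : ∀ i : Fin d, (fun y => sqrtDet x y *
      component (fun y : X => (0 : TangentSpace (𝓡 d) y)) x i y) = fun _ => 0 := by
    intro i
    ext y
    rw [component_zero, mul_zero]
  simp [divergence, this]

theorem divergence_add {V W : (x : X) → TangentSpace (𝓡 d) x} {x : X}
    (hV : IsSmoothFieldAt V x) (hW : IsSmoothFieldAt W x) :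
    divergence (d := d) (fun y => V y + W y) x = divergence V x + divergence W x := by
  have hx := mem_extChartAt_target (I := 𝓡 d) x
  have hl := (extChartAt (𝓡 d) x).left_inv (mem_extChartAt_source (I := 𝓡 d) x)
  have hs := (contDiffAt_sqrtDet hx).differentiableAt (by simp)
  simp only [divergence, ← mul_add, ← Finset.sum_add_distrib]
  congr 1
  refine Finset.sum_congr rfl fun i _ => ?_
  have hVi := (contDiffAt_component (V := V) hx (by rwa [hl]) i).differentiableAt (by simp)
  have hWi := (contDiffAt_component (V := W) hx (by rwa [hl]) i).differentiableAt (by simp)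
  rw [← _root_.add_apply, ← fderiv_fun_add (hs.fun_mul hVi) (hs.fun_mul hWi)]
  congr 2
  ext y
  rw [component_add, mul_add]

theorem divergence_smul {f : X → ℝ} {V : (x : X) → TangentSpace (𝓡 d) x} {x : X}
    (hf : ContMDiffAt (𝓡 d) 𝓘(ℝ, ℝ) ∞ f x) (hV : IsSmoothFieldAt V x) :
    divergence (d := d) (fun y => f y • V y) x =
      f x * divergence V x + inner ℝ (grad f x) (V x) := by
  have hx := mem_extChartAt_target (I := 𝓡 d) x
  have hl := (extChartAt (𝓡 d) x).left_inv (mem_extChartAt_source (I := 𝓡 d) x)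
  have hs := (contDiffAt_sqrtDet hx).differentiableAt (by simp)
  set y₀ := extChartAt (𝓡 d) x x with hy₀
  have hfd : MDifferentiableAt (𝓡 d) 𝓘(ℝ, ℝ) f ((extChartAt (𝓡 d) x).symm y₀) := by
    rw [hl]; exact hf.mdifferentiableAt (by simp)
  have hfy : DifferentiableAt ℝ (f ∘ (extChartAt (𝓡 d) x).symm) y₀ :=
    (hfd.comp _ (mdifferentiableAt_extChartAt_symm hx)).differentiableAt
  have hterm : ∀ i : Fin d, fderiv ℝ (fun y => sqrtDet x y * component (fun y => f y • V y) x i y)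
      y₀ (EuclideanSpace.single i 1) = f x * fderiv ℝ (fun y => sqrtDet x y * component V x i y)
      y₀ (EuclideanSpace.single i 1) + sqrtDet x y₀ * (component V x i y₀ *
        inner ℝ (grad f ((extChartAt (𝓡 d) x).symm y₀)) (coordVector x y₀ i)) := by
    intro i
    have hVi := (contDiffAt_component (V := V) hx (by rwa [hl]) i).differentiableAt (by simp)
    have h1 : (fun y => sqrtDet x y * component (fun y => f y • V y) x i y) =
        fun y => (f ∘ (extChartAt (𝓡 d) x).symm) y * (sqrtDet x y * component V x i y) := by
      ext y
      rw [component_smul, Function.comp]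
      ring
    rw [h1, fderiv_fun_mul hfy (hs.fun_mul hVi)]
    simp only [_root_.add_apply, _root_.smul_apply, smul_eq_mul, Function.comp_apply, hl]
    have h3 : fderiv ℝ (f ∘ (extChartAt (𝓡 d) x).symm) y₀ (EuclideanSpace.single i 1) =
        inner ℝ (grad f ((extChartAt (𝓡 d) x).symm y₀)) (coordVector x y₀ i) :=
      (fderiv_comp_extChartAt_symm hx hfd _).trans (inner_grad _).symm
    rw [h3]
    ring
  -- The terms in which the derivative falls on `f` carry `∂_i f = ⟨grad f, ∂_i⟩`; recombining `V`
  -- from its components yields the inner product.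
  have hsum : ∑ i, component V x i y₀ *
      (inner ℝ (grad f ((extChartAt (𝓡 d) x).symm y₀)) (coordVector x y₀ i) : ℝ) =
      inner ℝ (grad f x) (V x) := by
    have h2 : ∀ q : X, q = x → (inner ℝ (grad f q) (V q) : ℝ) = inner ℝ (grad f x) (V x) := by
      rintro q rfl; rfl
    rw [← h2 _ hl, ← sum_component_smul_coordVector hx V, inner_sum]
    simp_rw [real_inner_smul_right]
  have hpos := sqrtDet_pos hx
  rw [divergence]
  simp_rw [← hy₀, hterm]
  rw [Finset.sum_add_distrib, ← Finset.mul_sum, ← Finset.mul_sum, hsum, divergence, ← hy₀]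
  rw [mul_add, inv_mul_cancel_left₀ hpos.ne']
  ring

end Riem

/-- The partial derivatives of a function on `Fin N → ℝ`. -/
def partialDeriv {N : ℕ} (i : Fin N) (g : (Fin N → ℝ) → ℝ) (t : Fin N → ℝ) : ℝ :=
  fderiv ℝ g t (Pi.single i 1)

theorem contDiff_partialDeriv {N : ℕ} {g : (Fin N → ℝ) → ℝ} (hg : ContDiff ℝ ∞ g) (i : Fin N) :
    ContDiff ℝ ∞ (partialDeriv i g) :=
  (hg.fderiv_right (m := ∞) (by simp)).clm_apply contDiff_const

/-! ### Chain rules for the gradient and the Laplacian; continuity on the tangent bundle. -/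

namespace Riem

variable {d : ℕ} {X : Type*} [TopologicalSpace X] [ChartedSpace (EuclideanSpace ℝ (Fin d)) X]
  [IsManifold (𝓡 d) ∞ X] [RiemannianBundle (fun x : X => TangentSpace (𝓡 d) x)]

theorem grad_const (c : ℝ) (x : X) : grad (d := d) (fun _ : X => c) x = 0 := by
  have h : ∀ v, (inner ℝ (grad (d := d) (fun _ : X => c) x) v : ℝ) = 0 := by
    intro v
    rw [inner_grad, mfderiv_const]
    rfl
  exact inner_self_eq_zero.1 (h _)

theorem grad_comp {N : ℕ} {g : (Fin N → ℝ) → ℝ} (hg : ContDiff ℝ ∞ g) {φ : Fin N → X → ℝ}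
    (hφ : ∀ i, ContMDiff (𝓡 d) 𝓘(ℝ, ℝ) ∞ (φ i)) (x : X) :
    grad (d := d) (fun y => g fun i => φ i y) x =
      ∑ i, partialDeriv i g (fun i => φ i x) • grad (φ i) x := by
  refine ext_inner_right ℝ fun v => ?_
  rw [inner_grad, sum_inner]
  simp_rw [real_inner_smul_left, inner_grad]
  have hΦ : MDifferentiableAt (𝓡 d) 𝓘(ℝ, Fin N → ℝ) (fun y i => φ i y) x :=
    (contMDiff_pi_space.2 hφ).mdifferentiable (by simp) x
  have hcomp : ∀ i, mfderiv (𝓡 d) 𝓘(ℝ, ℝ) (φ i) x v =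
      (show Fin N → ℝ from mfderiv (𝓡 d) 𝓘(ℝ, Fin N → ℝ) (fun y i => φ i y) x v) i := by
    intro i
    have hp : MDifferentiableAt 𝓘(ℝ, Fin N → ℝ) 𝓘(ℝ, ℝ)
        (ContinuousLinearMap.proj (R := ℝ) (φ := fun _ : Fin N => ℝ) i) (fun i => φ i x) :=
      (ContinuousLinearMap.proj (R := ℝ) (φ := fun _ : Fin N => ℝ) i).differentiableAt
        |>.mdifferentiableAt
    have h1 := mfderiv_comp (f := fun y i => φ i y) x hp hΦ
    rw [mfderiv_eq_fderiv, ContinuousLinearMap.fderiv] at h1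
    exact congrArg (fun A => A v) h1
  have hgd : MDifferentiableAt 𝓘(ℝ, Fin N → ℝ) 𝓘(ℝ, ℝ) g (fun i => φ i x) :=
    (hg.differentiable (by simp) _).mdifferentiableAt
  have h2 := mfderiv_comp (f := fun y i => φ i y) x hgd hΦ
  rw [mfderiv_eq_fderiv] at h2
  have h3 := congrArg (fun A => A v) h2
  refine h3.trans ?_
  change fderiv ℝ g (fun i => φ i x) (show Fin N → ℝ from
    mfderiv (𝓡 d) 𝓘(ℝ, Fin N → ℝ) (fun y i => φ i y) x v) = _
  set w : Fin N → ℝ := (show Fin N → ℝ from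
    mfderiv (𝓡 d) 𝓘(ℝ, Fin N → ℝ) (fun y i => φ i y) x v)
  conv_lhs => rw [← Finset.univ_sum_single w]
  rw [map_sum]
  refine Finset.sum_congr rfl fun i _ => ?_
  have h4 : Pi.single i (w i) = w i • (Pi.single i 1 : Fin N → ℝ) := by
    rw [← Pi.single_smul', smul_eq_mul, mul_one]
  rw [h4, map_smul]
  exact (mul_comm _ _).trans (congrArg (partialDeriv i g (fun i => φ i x) * ·) (hcomp i).symm)

variable [IsContMDiffRiemannianBundle (𝓡 d) ∞ (EuclideanSpace ℝ (Fin d))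
      (fun x : X => TangentSpace (𝓡 d) x)]

theorem isSmoothFieldAt_smul {f : X → ℝ} (hf : ContMDiff (𝓡 d) 𝓘(ℝ, ℝ) ∞ f)
    {V : (x : X) → TangentSpace (𝓡 d) x} {x : X} (hV : IsSmoothFieldAt V x) :
    IsSmoothFieldAt (fun y => f y • V y) x :=
  hf.contMDiffAt.smul_section hV

theorem isSmoothFieldAt_sum {ι : Type*} (s : Finset ι) {V : ι → (x : X) → TangentSpace (𝓡 d) x}
    {x : X} (hV : ∀ i, IsSmoothFieldAt (V i) x) :
    IsSmoothFieldAt (fun y => ∑ i ∈ s, V i y) x :=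
  ContMDiffAt.sum_section fun i _ => hV i

theorem divergence_sum {ι : Type*} (s : Finset ι) {V : ι → (x : X) → TangentSpace (𝓡 d) x}
    {x : X} (hV : ∀ i, IsSmoothFieldAt (V i) x) :
    divergence (d := d) (fun y => ∑ i ∈ s, V i y) x = ∑ i ∈ s, divergence (V i) x := by
  classical
  induction s using Finset.induction_on with
  | empty => simpa using divergence_zero x
  | insert a s ha ih =>
    simp only [Finset.sum_insert ha]
    rw [divergence_add (hV a) (isSmoothFieldAt_sum s hV), ih]

theorem contMDiff_comp_pi {N : ℕ} {g : (Fin N → ℝ) → ℝ} (hg : ContDiff ℝ ∞ g)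
    {φ : Fin N → X → ℝ} (hφ : ∀ i, ContMDiff (𝓡 d) 𝓘(ℝ, ℝ) ∞ (φ i)) :
    ContMDiff (𝓡 d) 𝓘(ℝ, ℝ) ∞ (fun y => g fun i => φ i y) :=
  hg.contMDiff.comp (contMDiff_pi_space.2 hφ)

/-- Leibniz rule applied to `div (∑ ∂_i g(φ) ∇φ_i)`. The result separates derivatives of `g`, which
are bounded for cylinder functions, from functions of `x` alone built from the `φ_i`. -/
theorem laplacian_comp {N : ℕ} {g : (Fin N → ℝ) → ℝ} (hg : ContDiff ℝ ∞ g) {φ : Fin N → X → ℝ}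
    (hφ : ∀ i, ContMDiff (𝓡 d) 𝓘(ℝ, ℝ) ∞ (φ i)) (x : X) :
    laplacian (d := d) (fun y => g fun i => φ i y) x =
      ∑ i, (partialDeriv i g (fun i => φ i x) * laplacian (d := d) (φ i) x +
        ∑ j, partialDeriv j (partialDeriv i g) (fun i => φ i x) *
          inner ℝ (grad (d := d) (φ j) x) (grad (φ i) x)) := by
  have h1 : grad (d := d) (fun y => g fun i => φ i y) =
      fun x => ∑ i, partialDeriv i g (fun i => φ i x) • grad (φ i) x :=
    funext fun x => grad_comp hg hφ x
  rw [laplacian, h1]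
  rw [divergence_sum (V := fun i y => partialDeriv i g (fun i => φ i y) • grad (φ i) y) _
    fun i => isSmoothFieldAt_smul (contMDiff_comp_pi (contDiff_partialDeriv hg i) hφ)
      (isSmoothFieldAt_grad (hφ i) x)]
  refine Finset.sum_congr rfl fun i _ => ?_
  rw [divergence_smul (contMDiff_comp_pi (contDiff_partialDeriv hg i) hφ x)
    (isSmoothFieldAt_grad (hφ i) x), grad_comp (contDiff_partialDeriv hg i) hφ, sum_inner]
  simp_rw [real_inner_smul_left]
  rfl

theorem grad_eq_zero_of_notMem_tsupport {f : X → ℝ} {x : X} (hx : x ∉ tsupport f) :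
    grad (d := d) f x = 0 := by
  have h : f =ᶠ[𝓝 x] fun _ => 0 := notMem_tsupport_iff_eventuallyEq.1 hx
  rw [grad_congr h, grad_const]

theorem laplacian_eq_zero_of_notMem_tsupport {f : X → ℝ} {x : X} (hx : x ∉ tsupport f) :
    laplacian (d := d) f x = 0 := by
  have h : f =ᶠ[𝓝 x] fun _ => 0 := notMem_tsupport_iff_eventuallyEq.1 hx
  rw [laplacian_congr h, laplacian]
  rw [show grad (d := d) (fun _ : X => (0 : ℝ)) = fun y => (0 : TangentSpace (𝓡 d) y) from
    funext fun y => grad_const 0 y]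
  exact divergence_zero x

theorem continuous_laplacian {f : X → ℝ} (hf : ContMDiff (𝓡 d) 𝓘(ℝ, ℝ) ∞ f) :
    Continuous (laplacian (d := d) f) :=
  continuous_divergence fun x => isSmoothFieldAt_grad hf x

theorem continuous_inner_grad {f g : X → ℝ} (hf : ContMDiff (𝓡 d) 𝓘(ℝ, ℝ) ∞ f)
    (hg : ContMDiff (𝓡 d) 𝓘(ℝ, ℝ) ∞ g) :
    Continuous fun x => (inner ℝ (grad (d := d) f x) (grad g x) : ℝ) := by
  have h : ContMDiff (𝓡 d) 𝓘(ℝ, ℝ) ∞ fun x => (inner ℝ (grad (d := d) f x) (grad g x) : ℝ) :=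
    ContMDiff.inner_bundle (fun x => isSmoothFieldAt_grad hf x) fun x => isSmoothFieldAt_grad hg x
  exact h.continuous

/-- The identity of the tangent bundle is a smooth section along the projection, so the smooth
metric may be evaluated on it. Facts of this kind turn measurable bundle-valued maps into measurable
scalar functions. -/
theorem continuous_tangentBundle_norm :
    Continuous fun v : TangentBundle (𝓡 d) X => ‖v.2‖ := by
  have h : ContMDiff (𝓡 d).tangent 𝓘(ℝ, ℝ) ∞
      fun v : TangentBundle (𝓡 d) X => (inner ℝ v.2 v.2 : ℝ) :=
    ContMDiff.inner_bundle (n := ∞) (IB := 𝓡 d) (b := fun v : TangentBundle (𝓡 d) X => v.1)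
      (v := fun v => v.2) (w := fun v => v.2) contMDiff_id contMDiff_id
  have h2 := Real.continuous_sqrt.comp h.continuous
  refine h2.congr fun v => ?_
  rw [Function.comp, norm_eq_sqrt_real_inner]

theorem continuous_tangentBundle_inner_grad {f : X → ℝ} (hf : ContMDiff (𝓡 d) 𝓘(ℝ, ℝ) ∞ f) :
    Continuous fun v : TangentBundle (𝓡 d) X => (inner ℝ (grad f v.1) v.2 : ℝ) := by
  have h1 : ContMDiff (𝓡 d) (𝓡 d).tangent ∞
      (fun x : X => (⟨x, grad f x⟩ : TangentBundle (𝓡 d) X)) := fun x => isSmoothFieldAt_grad hf x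
  have h : ContMDiff (𝓡 d).tangent 𝓘(ℝ, ℝ) ∞
      fun v : TangentBundle (𝓡 d) X => (inner ℝ (grad f v.1) v.2 : ℝ) :=
    ContMDiff.inner_bundle (n := ∞) (IB := 𝓡 d) (b := fun v : TangentBundle (𝓡 d) X => v.1)
      (v := fun v => grad f v.1) (w := fun v => v.2)
      (h1.comp (contMDiff_proj (TangentSpace (𝓡 d) : X → Type _))) contMDiff_id
  exact h.continuous

theorem isTestField_smul_grad {f g : X → ℝ} (hf : ContMDiff (𝓡 d) 𝓘(ℝ, ℝ) ∞ f)
    (hg : ContMDiff (𝓡 d) 𝓘(ℝ, ℝ) ∞ g) {K : Set X} (hK : IsCompact K)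
    (hgK : ∀ x ∉ K, grad (d := d) g x = 0) :
    IsTestField (d := d) (fun x => f x • grad g x) :=
  ⟨fun x => isSmoothFieldAt_smul hf (isSmoothFieldAt_grad hg x), K, hK, fun x hx => by
    simp only [hgK x hx, smul_zero]⟩

end Riem

/-! ### Sums over configurations; adding and removing points. -/

namespace Config

section Sums

variable {X : Type*} [TopologicalSpace X]

/-- The points of a configuration in a compact set. -/
def finsetIn (γ : Config X) {K : Set X} (hK : IsCompact K) : Finset X :=
  (γ.locallyFinite K hK).toFinset

theorem mem_finsetIn {γ : Config X} {K : Set X} {hK : IsCompact K} {x : X} :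
    x ∈ γ.finsetIn hK ↔ x ∈ γ.carrier ∧ x ∈ K := by
  simp [finsetIn]

theorem tsum_eq_sum_finsetIn {M : Type*} [AddCommMonoid M] [TopologicalSpace M] (γ : Config X)
    {K : Set X} (hK : IsCompact K) {f : X → M} (hf : ∀ x ∉ K, f x = 0) :
    ∑' x : γ.carrier, f x = ∑ x ∈ γ.finsetIn hK, f x := by
  rw [tsum_subtype γ.carrier f, tsum_eq_sum (s := γ.finsetIn hK)]
  · refine Finset.sum_congr rfl fun x hx => ?_
    rw [indicator_of_mem (mem_finsetIn.1 hx).1]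
  · intro x hx
    by_cases h1 : x ∈ γ.carrier
    · rw [indicator_of_mem h1, hf x fun h2 => hx (mem_finsetIn.2 ⟨h1, h2⟩)]
    · exact indicator_of_notMem h1 _

theorem pair_eq_sum (γ : Config X) {K : Set X} (hK : IsCompact K) {f : X → ℝ}
    (hf : ∀ x ∉ K, f x = 0) : pair f γ = ∑ x ∈ γ.finsetIn hK, f x :=
  tsum_eq_sum_finsetIn γ hK hf

theorem eq_zero_of_notMem_tsupport {f : X → ℝ} (x : X) (hx : x ∉ tsupport f) : f x = 0 :=
  image_eq_zero_of_notMem_tsupport hx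

theorem isClosed_carrier [T2Space X] [LocallyCompactSpace X] (γ : Config X) :
    IsClosed γ.carrier := by
  rw [← isOpen_compl_iff, isOpen_iff_mem_nhds]
  intro x hx
  obtain ⟨K, hK, hxK⟩ := exists_compact_mem_nhds x
  have h1 : ((γ.carrier ∩ K : Set X))ᶜ ∈ 𝓝 x :=
    (γ.locallyFinite K hK).isClosed.isOpen_compl.mem_nhds fun h => hx h.1
  filter_upwards [h1, hxK] with y hy hyK hyγ using hy ⟨hyγ, hyK⟩

/-- Near each point, a configuration has no other points. -/
theorem eventually_notMem_erase [T2Space X] [LocallyCompactSpace X] (γ : Config X) (x : X) :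
    ∀ᶠ y in 𝓝 x, y ∉ (γ.erase x).carrier :=
  (isClosed_carrier (γ.erase x)).isOpen_compl.mem_nhds fun h => h.2 rfl

theorem countable_carrier [SigmaCompactSpace X] (γ : Config X) : γ.carrier.Countable := by
  have : γ.carrier = ⋃ n, γ.carrier ∩ compactCovering X n := by
    rw [← inter_iUnion, iUnion_compactCovering, inter_univ]
  rw [this]
  exact countable_iUnion fun n =>
    (γ.locallyFinite _ (isCompact_compactCovering X n)).countable

theorem pair_add_config {f : X → ℝ} (hf : HasCompactSupport f) {γ : Config X} {x : X}
    (hx : x ∉ γ.carrier) : pair f (γ.add x) = pair f γ + f x := by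
  classical
  have hK := (isCompact_singleton (x := x)).union hf
  have h0 : ∀ y ∉ {x} ∪ tsupport f, f y = 0 := fun y hy =>
    eq_zero_of_notMem_tsupport y fun h => hy (Or.inr h)
  rw [pair_eq_sum _ hK h0, pair_eq_sum _ hK h0]
  have h1 : (γ.add x).finsetIn hK = insert x (γ.finsetIn hK) := by
    ext y
    simp only [mem_finsetIn, Finset.mem_insert, add, mem_insert_iff]
    constructor
    · rintro ⟨h | h, h'⟩
      exacts [Or.inl h, Or.inr ⟨h, h'⟩]
    · rintro (rfl | h)
      exacts [⟨Or.inl rfl, Or.inl rfl⟩, ⟨Or.inr h.1, h.2⟩]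
  rw [h1, Finset.sum_insert fun h => hx (mem_finsetIn.1 h).1, add_comm]

theorem add_of_mem {γ : Config X} {x : X} (hx : x ∈ γ.carrier) : γ.add x = γ := by
  cases γ
  simpa [add] using hx

theorem erase_of_notMem {γ : Config X} {x : X} (hx : x ∉ γ.carrier) : γ.erase x = γ := by
  cases γ
  simpa [erase] using hx

theorem erase_add_self {γ : Config X} {x : X} (hx : x ∈ γ.carrier) : (γ.erase x).add x = γ := by
  cases γ
  simpa [erase, add] using hx

theorem add_erase_self {γ : Config X} {x : X} (hx : x ∉ γ.carrier) : (γ.add x).erase x = γ := by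
  cases γ
  simpa [erase, add] using hx

theorem notMem_erase {γ : Config X} {x : X} : x ∉ (γ.erase x).carrier := fun h => h.2 rfl

theorem pair_erase {f : X → ℝ} (hf : HasCompactSupport f) {γ : Config X} {x : X}
    (hx : x ∈ γ.carrier) : pair f (γ.erase x) = pair f γ - f x := by
  have h := pair_add_config hf (notMem_erase (γ := γ) (x := x))
  rw [erase_add_self hx] at h
  rw [h, add_sub_cancel_right]

theorem abs_pair_sub_le {f g χ : X → ℝ} (hf : HasCompactSupport f) (hg : HasCompactSupport g)
    (hχ : HasCompactSupport χ) {ε : ℝ} (h : ∀ x, |f x - g x| ≤ ε * χ x) (γ : Config X) :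
    |pair f γ - pair g γ| ≤ ε * pair χ γ := by
  have hK := (IsCompact.union hf hg).union hχ
  rw [pair_eq_sum γ hK fun x hx => eq_zero_of_notMem_tsupport x fun h => hx (Or.inl (Or.inl h)),
    pair_eq_sum γ hK fun x hx => eq_zero_of_notMem_tsupport x fun h => hx (Or.inl (Or.inr h)),
    pair_eq_sum γ hK fun x hx => eq_zero_of_notMem_tsupport x fun h => hx (Or.inr h),
    ← Finset.sum_sub_distrib, Finset.mul_sum]
  exact (Finset.abs_sum_le_sum_abs _ _).trans (Finset.sum_le_sum fun x _ => h x)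

end Sums

/-! ### The vague topology and its Borel structure. -/

section VagueTopology

variable {X : Type*} [MetricSpace X] [LocallyCompactSpace X] [SecondCountableTopology X]

theorem continuous_pair (f : C_c(X, ℝ)) : Continuous (pair (X := X) f) :=
  continuous_iff_le_induced.2 (iInf_le _ f)

theorem continuous_pair_of_hasCompactSupport {f : X → ℝ} (hf : Continuous f)
    (hf' : HasCompactSupport f) : Continuous (pair f) :=
  continuous_pair ⟨⟨f, hf⟩, hf'⟩

theorem exists_cutoff {K : Set X} (hK : IsCompact K) :
    ∃ χ : C_c(X, ℝ), (∀ x ∈ K, χ x = 1) ∧ ∀ x, 0 ≤ χ x ∧ χ x ≤ 1 := by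
  obtain ⟨f, h1, -, h2, h3⟩ := exists_continuous_one_zero_of_isCompact hK isClosed_empty
    (disjoint_empty K)
  exact ⟨⟨f, h2⟩, fun x hx => h1 hx, fun x => h3 x⟩

/-- The family consists of cutoffs `χ_n` of an exhaustion and their products with a dense sequence
of `C(X, ℝ)`. As `f = χ_n f` for large `n`, approximation of `f` on the support of `χ_n` gives an
error weighted by `χ_n`, itself a member of the family. -/
theorem exists_countable_approximating_family (X : Type*) [MetricSpace X] [LocallyCompactSpace X]
    [SecondCountableTopology X] : ∃ e : ℕ ⊕ ℕ × ℕ → C_c(X, ℝ), ∀ f : C_c(X, ℝ),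
      ∃ i, (∀ x, 0 ≤ e i x) ∧ ∀ ε > 0, ∃ j, ∀ x, |f x - e j x| ≤ ε * e i x := by
  let h := TopologicalSpace.denseSeq C(X, ℝ)
  let K := CompactExhaustion.choice X
  choose χ hχ1 hχ using fun n => exists_cutoff (K.isCompact n)
  refine ⟨Sum.elim χ fun p => ⟨(χ p.1).toContinuousMap * h p.2,
    (χ p.1).hasCompactSupport.mul_right⟩, fun f => ?_⟩
  obtain ⟨n, hn⟩ := K.exists_superset_of_isCompact f.hasCompactSupport
  refine ⟨Sum.inl n, fun x => (hχ n x).1, fun ε hε => ?_⟩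
  obtain ⟨u, hu, hlim⟩ := mem_closure_iff_seq_limit.1
    (TopologicalSpace.denseRange_denseSeq C(X, ℝ) f.toContinuousMap)
  have h1 := ContinuousMap.tendsto_iff_forall_isCompact_tendstoUniformlyOn.1 hlim
    _ (χ n).hasCompactSupport
  obtain ⟨m, hm⟩ := (Metric.tendstoUniformlyOn_iff.1 h1 ε hε).exists
  obtain ⟨k, hk⟩ := hu m
  refine ⟨Sum.inr (n, k), fun x => ?_⟩
  have h2 : f x = χ n x * f x := by
    by_cases hx : x ∈ tsupport f
    · rw [hχ1 n x (hn hx), one_mul]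
    · rw [eq_zero_of_notMem_tsupport x hx, mul_zero]
  change |f x - χ n x * h k x| ≤ ε * χ n x
  rw [h2, ← mul_sub, abs_mul, abs_of_nonneg (hχ n x).1, mul_comm]
  by_cases hx : x ∈ tsupport (χ n)
  · have h3 := (hm x hx).le
    rw [← hk, Real.dist_eq] at h3
    exact mul_le_mul_of_nonneg_right h3 (hχ n x).1
  · simp [eq_zero_of_notMem_tsupport x hx]

/-- A countable family of functions whose pairings induce the vague topology. -/
def basicFun (X : Type*) [MetricSpace X] [LocallyCompactSpace X] [SecondCountableTopology X] :
    ℕ ⊕ ℕ × ℕ → C_c(X, ℝ) := (exists_countable_approximating_family X).choose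

/-- The pairing with `f` is approximated by that with `e_j` up to a small multiple of `⟨e_i, γ⟩`,
and the latter is locally bounded in the topology induced by the family. -/
theorem isInducing_pair_basicFun :
    IsInducing fun (γ : Config X) (i : ℕ ⊕ ℕ × ℕ) => pair (basicFun X i) γ := by
  refine ⟨le_antisymm ?_ ?_⟩
  · exact continuous_iff_le_induced.1 (continuous_pi fun i => continuous_pair _)
  · refine le_iInf fun f => ?_
    rw [← continuous_iff_le_induced]
    set t : TopologicalSpace (Config X) := TopologicalSpace.induced
      (fun (γ : Config X) (i : ℕ ⊕ ℕ × ℕ) => pair (basicFun X i) γ) inferInstance with ht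
    have hd : Continuous[t, Pi.topologicalSpace]
        (fun (γ : Config X) (i : ℕ ⊕ ℕ × ℕ) => pair (basicFun X i) γ) := continuous_induced_dom
    have hc : ∀ i, Continuous[t, _] (pair (basicFun X i)) := fun i =>
      @Continuous.comp _ _ _ t _ _ _ _ (continuous_apply i) hd
    rw [@continuous_iff_continuousAt _ _ t]
    intro γ₀
    rw [@ContinuousAt, Metric.tendsto_nhds]
    intro ε hε
    obtain ⟨i, hi0, hi⟩ := (exists_countable_approximating_family X).choose_spec f
    change ∀ x, 0 ≤ basicFun X i x at hi0
    set M := pair (basicFun X i) γ₀ with hM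
    have hM0 : 0 ≤ M := tsum_nonneg fun x => hi0 x
    -- Where `⟨e_i, γ⟩ < M + 1` this factor makes each of the two replacements of `f` by `e_j` cost
    -- at most `ε / 4`; the variation of `⟨e_j, ·⟩` costs another `ε / 4`.
    obtain ⟨j, hj⟩ := hi (ε / (4 * (M + 1))) (by positivity)
    change ∀ x, |f x - basicFun X j x| ≤ _ * basicFun X i x at hj
    have hdiff := fun γ => abs_pair_sub_le f.hasCompactSupport (basicFun X j).hasCompactSupport
      (basicFun X i).hasCompactSupport hj γ
    have h1 : ∀ᶠ γ in @nhds _ t γ₀, |pair (basicFun X j) γ - pair (basicFun X j) γ₀| < ε / 4 :=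
      (Metric.tendsto_nhds.1 ((hc j).continuousAt (x := γ₀))) _ (by positivity)
    have h2 : ∀ᶠ γ in @nhds _ t γ₀, |pair (basicFun X i) γ - pair (basicFun X i) γ₀| < 1 :=
      (Metric.tendsto_nhds.1 ((hc i).continuousAt (x := γ₀))) _ one_pos
    filter_upwards [h1, h2] with γ h1 h2
    have h3 : ε / (4 * (M + 1)) * pair (basicFun X i) γ ≤ ε / 4 := by
      rw [div_mul_eq_mul_div, div_le_div_iff₀ (by positivity) (by positivity)]
      have := (abs_lt.1 h2).2
      nlinarith
    have h4 : ε / (4 * (M + 1)) * pair (basicFun X i) γ₀ ≤ ε / 4 := by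
      rw [div_mul_eq_mul_div, div_le_div_iff₀ (by positivity) (by positivity), ← hM]
      nlinarith
    have h5 := abs_le.1 ((hdiff γ).trans h3)
    have h6 := abs_le.1 ((hdiff γ₀).trans h4)
    have h7 := abs_lt.1 h1
    rw [Real.dist_eq, abs_lt]
    constructor <;> linarith [h5.1, h5.2, h6.1, h6.2, h7.1, h7.2]

instance : SecondCountableTopology (Config X) :=
  isInducing_pair_basicFun.secondCountableTopology

theorem borel_eq_comap : borel (Config X) =
    MeasurableSpace.comap (fun (γ : Config X) (i : ℕ ⊕ ℕ × ℕ) => pair (basicFun X i) γ)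
      inferInstance := by
  have h := borel_comap (f := fun (γ : Config X) (i : ℕ ⊕ ℕ × ℕ) => pair (basicFun X i) γ)
    (t := inferInstance)
  rw [← isInducing_pair_basicFun.eq_induced] at h
  refine h.trans ?_
  rw [← BorelSpace.measurable_eq (α := ℕ ⊕ ℕ × ℕ → ℝ)]

theorem measurable_pair (f : C_c(X, ℝ)) : Measurable (pair (X := X) f) :=
  (continuous_pair f).measurable

theorem measurable_of_measurable_pair {α : Type*} [MeasurableSpace α] {g : α → Config X}
    (hg : ∀ f : C_c(X, ℝ), Measurable fun a => pair f (g a)) : Measurable g := by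
  change @Measurable _ _ _ (borel (Config X)) g
  rw [borel_eq_comap, measurable_comap_iff]
  exact measurable_pi_lambda _ fun i => hg _

variable [MeasurableSpace X] [BorelSpace X]

/-- If `x ∉ γ`, take a bump function equal to one on a compact neighbourhood of `x` and to zero on
`γ`. Its pairing with `γ` is zero, so it stays below one for nearby configurations, which therefore
have no point in that neighbourhood. -/
theorem isClosed_setOf_mem : IsClosed {p : Config X × X | p.2 ∈ p.1.carrier} := by
  rw [← isOpen_compl_iff, isOpen_iff_mem_nhds]
  rintro ⟨γ, x⟩ hx
  obtain ⟨K, hK, hxK, hKγ⟩ := exists_compact_subset (isClosed_carrier γ).isOpen_compl hx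
  obtain ⟨f, hf1, hf2, hf3, hf4⟩ := exists_continuous_one_zero_of_isCompact hK
    (isClosed_carrier γ) (disjoint_left.2 fun y hy hy' => hKγ hy hy')
  have h0 : pair f γ < 1 := by
    have : pair f γ = 0 := by
      rw [pair, ← tsum_zero (β := γ.carrier)]
      exact tsum_congr fun y => hf2 y.2
    linarith
  have hopen : IsOpen {p : Config X × X | pair f p.1 < 1 ∧ p.2 ∈ interior K} :=
    (isOpen_lt ((continuous_pair_of_hasCompactSupport f.continuous hf3).comp continuous_fst)
      continuous_const).inter (isOpen_interior.preimage continuous_snd)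
  refine mem_of_superset (hopen.mem_nhds ⟨h0, hxK⟩) ?_
  rintro ⟨γ', y⟩ ⟨h1, h2⟩ h3
  have h4 := pair_eq_sum γ' hf3 fun x hx => eq_zero_of_notMem_tsupport x hx
  have h5 : f y ≤ ∑ x ∈ γ'.finsetIn hf3, f x := by
    refine Finset.single_le_sum (fun x _ => (hf4 x).1) (mem_finsetIn.2 ⟨h3, ?_⟩)
    by_contra h
    have := eq_zero_of_notMem_tsupport y h
    rw [hf1 (interior_subset h2)] at this
    exact one_ne_zero this
  rw [hf1 (interior_subset h2), ← h4] at h5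
  exact absurd h1 (not_lt.2 h5)

theorem measurableSet_setOf_mem : MeasurableSet {p : Config X × X | p.2 ∈ p.1.carrier} :=
  isClosed_setOf_mem.measurableSet

theorem measurable_erase : Measurable fun p : Config X × X => p.1.erase p.2 := by
  classical
  refine measurable_of_measurable_pair fun f => ?_
  have h : (fun p : Config X × X => pair f (p.1.erase p.2)) = fun p =>
      if p ∈ {p : Config X × X | p.2 ∈ p.1.carrier} then pair f p.1 - f p.2 else pair f p.1 := by
    ext p
    split_ifs with hp
    · exact pair_erase f.hasCompactSupport hp
    · rw [erase_of_notMem hp]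
  rw [h]
  exact Measurable.ite measurableSet_setOf_mem
    (((measurable_pair f).comp measurable_fst).sub (f.continuous.measurable.comp measurable_snd))
    ((measurable_pair f).comp measurable_fst)

theorem measurable_add : Measurable fun p : Config X × X => p.1.add p.2 := by
  classical
  refine measurable_of_measurable_pair fun f => ?_
  have h : (fun p : Config X × X => pair f (p.1.add p.2)) = fun p =>
      if p ∈ {p : Config X × X | p.2 ∈ p.1.carrier} then pair f p.1 else pair f p.1 + f p.2 := by
    ext p
    split_ifs with hp
    · rw [add_of_mem hp]
    · exact pair_add_config f.hasCompactSupport hp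
  rw [h]
  exact Measurable.ite measurableSet_setOf_mem ((measurable_pair f).comp measurable_fst)
    (((measurable_pair f).comp measurable_fst).add (f.continuous.measurable.comp measurable_snd))

end VagueTopology

/-! ### Configurations as an s-finite counting kernel. -/

section CountingKernel

variable {X : Type*} [MeasurableSpace X]

/-- A finite kernel needs a uniform mass bound; cutting the source according to the integer part of
the total mass provides one on each piece. -/
theorem _root_.ProbabilityTheory.Kernel.isSFiniteKernel_of_isFiniteMeasure {α β : Type*}
    [MeasurableSpace α] [MeasurableSpace β] (κ : Kernel α β) (h : ∀ a, IsFiniteMeasure (κ a)) :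
    IsSFiniteKernel κ := by
  classical
  have hm : Measurable fun a => (κ a univ).toNNReal :=
    (κ.measurable_coe MeasurableSet.univ).ennreal_toNNReal
  have hB : ∀ k : ℕ, MeasurableSet {a | ⌊(κ a univ).toNNReal⌋₊ = k} := fun k =>
    (Nat.measurable_floor.comp hm) (measurableSet_singleton k)
  have hsum : κ = Kernel.sum fun k : ℕ => Kernel.piecewise (hB k) κ 0 := by
    ext a s hs
    rw [Kernel.sum_apply' _ _ hs, tsum_eq_single ⌊(κ a univ).toNNReal⌋₊]
    · simp [Kernel.piecewise_apply]
    · intro k hk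
      simp [Kernel.piecewise_apply, hk.symm]
  rw [hsum]
  have hfin : ∀ k : ℕ, IsFiniteKernel (Kernel.piecewise (hB k) κ 0) := by
    intro k
    refine ⟨⟨((k + 1 : ℕ) : ℝ≥0∞), ENNReal.natCast_lt_top _, fun a => ?_⟩⟩
    rw [Kernel.piecewise_apply]
    split_ifs with hk
    · have h1 := Nat.lt_floor_add_one (κ a univ).toNNReal
      have hk' : ⌊(κ a univ).toNNReal⌋₊ = k := hk
      rw [hk'] at h1
      rw [← ENNReal.coe_toNNReal (measure_ne_top (κ a) univ)]
      exact_mod_cast h1.le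
    · simp
  exact Kernel.isSFiniteKernel_sum (hκs := fun k => inferInstance)

variable [MetricSpace X] [LocallyCompactSpace X] [SecondCountableTopology X] [BorelSpace X]

/-- The counting measure of a configuration. -/
def countMeasure (γ : Config X) : Measure X := Measure.sum fun x : γ.carrier => Measure.dirac x.1

theorem lintegral_countMeasure (γ : Config X) {f : X → ℝ≥0∞} (hf : Measurable f) :
    ∫⁻ x, f x ∂(countMeasure γ) = ∑' x : γ.carrier, f x := by
  rw [countMeasure, lintegral_sum_measure]
  exact tsum_congr fun x => lintegral_dirac' _ hf

theorem countMeasure_apply (γ : Config X) {s : Set X} (hs : MeasurableSet s) :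
    countMeasure γ s = ∑' x : γ.carrier, s.indicator (1 : X → ℝ≥0∞) x := by
  rw [← lintegral_countMeasure γ (measurable_one.indicator hs), lintegral_indicator_one hs]

theorem countMeasure_apply_of_subset (γ : Config X) {s K : Set X} (hs : MeasurableSet s)
    (hK : IsCompact K) (hsK : s ⊆ K) :
    countMeasure γ s = ∑ x ∈ γ.finsetIn hK, s.indicator (1 : X → ℝ≥0∞) x := by
  rw [countMeasure_apply γ hs, tsum_eq_sum_finsetIn γ hK]
  exact fun x hx => indicator_of_notMem (fun h => hx (hsK h)) _

theorem countMeasure_lt_top (γ : Config X) {K : Set X} (hK : IsCompact K) :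
    countMeasure γ K < ⊤ := by
  rw [countMeasure_apply_of_subset γ hK.measurableSet hK subset_rfl]
  refine ENNReal.sum_lt_top.2 fun x _ => ?_
  by_cases hx : x ∈ K <;> simp [hx]

/-- In a metric space a compact set is `G_δ`, so some compactly supported continuous `f` with values
in `[0, 1]` equals one exactly on `K`. Its powers tend to the indicator of `K`, and their pairings
to the number of points in `K`. -/
theorem measurable_countMeasure_of_isCompact {K : Set X} (hK : IsCompact K) :
    Measurable fun γ : Config X => countMeasure γ K := by
  have hG : IsGδ K := hK.isClosed.isGδ
  obtain ⟨f, h1, -, h3, h4⟩ := exists_continuous_one_zero_of_isCompact_of_isGδ hK hG isClosed_empty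
    (disjoint_empty K)
  -- The exponent starts at one, since the zeroth power is the constant one and has no compact
  -- support in general.
  have hpow : ∀ n, HasCompactSupport fun x => f x ^ (n + 1) := fun n =>
    h3.comp_left (g := fun t : ℝ => t ^ (n + 1)) (by simp)
  have hmeas : ∀ n, Measurable fun γ : Config X => ENNReal.ofReal (pair (fun x => f x ^ (n + 1)) γ) :=
    fun n => (continuous_pair_of_hasCompactSupport (f.continuous.pow _)
      (hpow n)).measurable.ennreal_ofReal
  refine measurable_of_tendsto_metrizable hmeas (tendsto_pi_nhds.2 fun γ => ?_)
  have hKf : K ⊆ tsupport f := fun x hx => subset_closure (by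
    rw [h1] at hx
    have hx' : f x = 1 := hx
    simp [hx'])
  rw [countMeasure_apply_of_subset γ hK.measurableSet h3 hKf]
  have h5 : ∀ n, ENNReal.ofReal (pair (fun x => f x ^ (n + 1)) γ) =
      ∑ x ∈ γ.finsetIn h3, ENNReal.ofReal (f x ^ (n + 1)) := by
    intro n
    rw [pair_eq_sum γ h3 fun x hx => by simp [eq_zero_of_notMem_tsupport x hx],
      ENNReal.ofReal_sum_of_nonneg fun x _ => pow_nonneg (h4 x).1 _]
  simp_rw [h5]
  refine tendsto_finsetSum _ fun x _ => ?_
  by_cases hx : x ∈ K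
  · have hx' : f x = 1 := by rw [h1] at hx; exact hx
    simp [hx, hx']
  · have hx' : f x < 1 := lt_of_le_of_ne (h4 x).2 fun h => hx (by rw [h1]; exact h)
    rw [indicator_of_notMem hx, ← ENNReal.ofReal_zero]
    exact (ENNReal.continuous_ofReal.tendsto 0).comp
      ((tendsto_pow_atTop_nhds_zero_of_lt_one (h4 x).1 hx').comp (tendsto_add_atTop_nat 1))

/-- On a member of the exhaustion the counting measures are finite, and the closed sets form a
generating π-system whose traces there are compact. Monotone limits remove the restriction. -/
theorem measurable_countMeasure : Measurable (countMeasure (X := X)) := by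
  let K := CompactExhaustion.choice X
  have hfin : ∀ n (γ : Config X), IsFiniteMeasure ((countMeasure γ).restrict (K n)) := fun n γ =>
    ⟨by rw [Measure.restrict_apply_univ]; exact countMeasure_lt_top γ (K.isCompact n)⟩
  have hK : ∀ n, Measurable fun γ : Config X => (countMeasure γ).restrict (K n) := by
    intro n
    refine Measurable.measure_of_isPiSystem
      (BorelSpace.measurable_eq.trans borel_eq_generateFrom_isClosed) isPiSystem_isClosed ?_ ?_
    · intro s hs
      simp_rw [Measure.restrict_apply (IsClosed.measurableSet hs)]
      exact measurable_countMeasure_of_isCompact ((K.isCompact n).inter_left hs)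
    · simp_rw [Measure.restrict_apply_univ]
      exact measurable_countMeasure_of_isCompact (K.isCompact n)
  refine Measure.measurable_of_measurable_coe _ fun s hs => ?_
  have h1 : ∀ γ : Config X, countMeasure γ s = ⨆ n, (countMeasure γ).restrict (K n) s := by
    intro γ
    simp_rw [Measure.restrict_apply hs]
    rw [← (show Monotone fun n => s ∩ K n from fun m n h =>
      inter_subset_inter_right _ (K.subset h)).measure_iUnion, ← inter_iUnion, K.iUnion_eq,
      inter_univ]
  simp_rw [h1]
  exact Measurable.iSup fun n => (Measure.measurable_coe hs).comp (hK n)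

/-- The counting measures of configurations, as a kernel. -/
def countKernel (X : Type*) [MeasurableSpace X] [MetricSpace X] [LocallyCompactSpace X]
    [SecondCountableTopology X] [BorelSpace X] : Kernel (Config X) X :=
  ⟨countMeasure, measurable_countMeasure⟩

/-- The differences of a compact exhaustion carry finitely many points of each configuration, though
not uniformly many. -/
instance : IsSFiniteKernel (countKernel X) := by
  let K := CompactExhaustion.choice X
  have hD : ∀ n, MeasurableSet (disjointed K n) :=
    MeasurableSet.disjointed fun n => (K.isCompact n).measurableSet
  have hsum : countKernel X = Kernel.sum fun n => (countKernel X).restrict (hD n) := by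
    ext γ : 1
    rw [Kernel.sum_apply]
    simp_rw [Kernel.restrict_apply]
    rw [← Measure.restrict_iUnion (disjoint_disjointed _) hD, iUnion_disjointed, K.iUnion_eq,
      Measure.restrict_univ]
  rw [hsum]
  have : ∀ n, IsSFiniteKernel ((countKernel X).restrict (hD n)) := fun n =>
    Kernel.isSFiniteKernel_of_isFiniteMeasure _ fun γ => ⟨by
      rw [Kernel.restrict_apply, Measure.restrict_apply_univ]
      exact (measure_mono (disjointed_subset _ _)).trans_lt
        (countMeasure_lt_top γ (K.isCompact n))⟩
  exact Kernel.isSFiniteKernel_sum (hκs := this)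

theorem integral_countMeasure (γ : Config X) {K : Set X} (hK : IsCompact K) {f : X → ℝ}
    (hf : Measurable f) (hf0 : ∀ x ∉ K, f x = 0) :
    ∫ x, f x ∂(countMeasure γ) = ∑' x : γ.carrier, f x := by
  have hint : Integrable f (countMeasure γ) := by
    refine ⟨hf.aestronglyMeasurable, ?_⟩
    rw [HasFiniteIntegral, lintegral_countMeasure γ hf.enorm,
      tsum_eq_sum_finsetIn γ hK (f := fun x => ‖f x‖ₑ) fun x hx => by simp [hf0 x hx]]
    exact ENNReal.sum_lt_top.2 fun x _ => enorm_lt_top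
  rw [countMeasure] at hint ⊢
  rw [integral_sum_measure hint]
  exact tsum_congr fun x => integral_dirac _ _

end CountingKernel

end Config

namespace Config

/-! ### The Mecke identity for measures and for integrals. -/

section Mecke

variable {X : Type*} [MeasurableSpace X] [MetricSpace X] [LocallyCompactSpace X]
  [SecondCountableTopology X] [BorelSpace X]

/-- The generalized Mecke identity as an identity of measures on `Config X × X`. -/
theorem compProd_countKernel_eq {μ : Measure (Config X)} [SFinite μ] {m : Measure X} [SFinite m]
    {σ : Kernel (Config X) X} (hMecke : MeckeIdentity μ σ) {ρ : Config X → X → ℝ≥0}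
    (hρ : Measurable (Function.uncurry ρ))
    (hσρ : ∀ᵐ γ ∂μ, σ γ = m.withDensity fun x => (ρ γ x : ℝ≥0∞)) :
    μ ⊗ₘ countKernel X = ((μ.prod m).withDensity fun p => (ρ p.1 p.2 : ℝ≥0∞)).map
      fun p => (p.1.add p.2, p.2) := by
  have hadd : Measurable fun p : Config X × X => (p.1.add p.2, p.2) :=
    measurable_add.prodMk measurable_snd
  have hρ' : Measurable fun p : Config X × X => (ρ p.1 p.2 : ℝ≥0∞) := hρ.coe_nnreal_ennreal
  refine Measure.ext_of_lintegral _ fun F hF => ?_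
  have hF2 : Measurable fun p : Config X × X => F (p.1.add p.2, p.2) := hF.comp hadd
  rw [Measure.lintegral_compProd hF, lintegral_map hF hadd,
    lintegral_withDensity_eq_lintegral_mul _ hρ' hF2,
    lintegral_prod _ (hρ'.mul hF2).aemeasurable]
  have h1 : ∀ γ, ∫⁻ x, F (γ, x) ∂(countKernel X γ) = ∑' x : γ.carrier, F (γ, x) := fun γ =>
    lintegral_countMeasure γ (hF.comp measurable_prodMk_left)
  simp_rw [h1]
  rw [hMecke F hF]
  refine lintegral_congr_ae ?_
  filter_upwards [hσρ] with γ hγ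
  rw [hγ]
  exact lintegral_withDensity_eq_lintegral_mul _ (hρ'.comp measurable_prodMk_left)
    (hF2.comp measurable_prodMk_left)

/-- Measurability of sums over the points of a configuration. -/
theorem measurable_tsum_carrier {G : Config X × X → ℝ} (hG : Measurable G) {K : Set X}
    (hK : IsCompact K) (hG0 : ∀ γ, ∀ x ∉ K, G (γ, x) = 0) :
    Measurable fun γ : Config X => ∑' x : γ.carrier, G (γ, x) := by
  have h : (fun γ : Config X => ∑' x : γ.carrier, G (γ, x)) =
      fun γ => ∫ x, G (γ, x) ∂(countKernel X γ) := by
    ext γ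
    exact (integral_countMeasure γ hK (hG.comp measurable_prodMk_left) (hG0 γ)).symm
  rw [h]
  exact (hG.stronglyMeasurable.integral_kernel_prod_right' (κ := countKernel X)).measurable

/-- The Mecke identity for integrals of sums over the points in a compact set. -/
theorem integral_tsum_carrier {μ : Measure (Config X)} [SFinite μ] {m : Measure X} [SFinite m]
    {σ : Kernel (Config X) X} (hMecke : MeckeIdentity μ σ) {ρ : Config X → X → ℝ≥0}
    (hρ : Measurable (Function.uncurry ρ))
    (hσρ : ∀ᵐ γ ∂μ, σ γ = m.withDensity fun x => (ρ γ x : ℝ≥0∞))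
    {G : Config X × X → ℝ} (hG : Measurable G) {K : Set X} (hK : IsCompact K)
    (hG0 : ∀ γ, ∀ x ∉ K, G (γ, x) = 0)
    (hint : ∫⁻ γ, ∑' x : γ.carrier, ‖G (γ, x)‖ₑ ∂μ < ⊤) :
    ∫ γ, ∑' x : γ.carrier, G (γ, x) ∂μ =
      ∫ γ, ∫ x, (ρ γ x : ℝ) * G (γ.add x, x) ∂m ∂μ := by
  have hadd : Measurable fun p : Config X × X => (p.1.add p.2, p.2) :=
    measurable_add.prodMk measurable_snd
  have hI : Integrable G (μ ⊗ₘ countKernel X) := by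
    refine ⟨hG.aestronglyMeasurable, ?_⟩
    rw [HasFiniteIntegral, Measure.lintegral_compProd hG.enorm]
    refine lt_of_eq_of_lt (lintegral_congr fun γ => ?_) hint
    exact lintegral_countMeasure γ (f := fun x => ‖G (γ, x)‖ₑ)
      (hG.comp measurable_prodMk_left).enorm
  have h1 : ∫ γ, ∑' x : γ.carrier, G (γ, x) ∂μ = ∫ p, G p ∂(μ ⊗ₘ countKernel X) := by
    rw [Measure.integral_compProd hI]
    refine integral_congr_ae (Eventually.of_forall fun γ => ?_)
    exact (integral_countMeasure γ hK (hG.comp measurable_prodMk_left) (hG0 γ)).symm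
  have heq := compProd_countKernel_eq (m := m) hMecke hρ hσρ
  rw [h1, heq, integral_map hadd.aemeasurable hG.aestronglyMeasurable]
  rw [heq, integrable_map_measure hG.aestronglyMeasurable hadd.aemeasurable] at hI
  have hI' := (integrable_withDensity_iff_integrable_smul (μ := μ.prod m)
    (f := fun p : Config X × X => ρ p.1 p.2) hρ).1 hI
  rw [integral_withDensity_eq_integral_smul (f := fun p : Config X × X => ρ p.1 p.2) hρ,
    integral_prod (fun p : Config X × X => ρ p.1 p.2 • G (p.1.add p.2, p.2)) hI']
  rfl

end Mecke

end Config

/-! ### The volume measure has no atoms in positive dimension. -/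

namespace Riem

variable {d : ℕ} {X : Type*} [TopologicalSpace X] [ChartedSpace (EuclideanSpace ℝ (Fin d)) X]
  [IsManifold (𝓡 d) ∞ X] [RiemannianBundle (fun x : X => TangentSpace (𝓡 d) x)]
  [SecondCountableTopology X] [Nonempty X] [MeasurableSpace X] [MeasurableSingletonClass X]

theorem chartVolume_singleton [Nonempty (Fin d)] (c x : X) :
    chartVolume (d := d) c {x} = 0 := by
  by_cases hm : AEMeasurable (extChartAt (𝓡 d) c).symm
    (((volume : Measure (EuclideanSpace ℝ (Fin d))).withDensity
      fun y => ENNReal.ofReal (sqrtDet c y)).restrict (extChartAt (𝓡 d) c).target)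
  · rw [chartVolume, Measure.map_apply_of_aemeasurable hm (measurableSet_singleton x),
      Measure.restrict_apply' (isOpen_extChartAt_target c).measurableSet]
    refine withDensity_absolutelyContinuous _ _ (measure_mono_null (t := {extChartAt (𝓡 d) c x})
      ?_ (measure_singleton _))
    rintro y ⟨hy1, hy2⟩
    have hy1' : (extChartAt (𝓡 d) c).symm y = x := hy1
    rw [mem_singleton_iff, ← hy1', (extChartAt (𝓡 d) c).right_inv hy2]
  -- Without almost everywhere measurability the push-forward is the zero measure by convention.
  · rw [chartVolume, Measure.map_of_not_aemeasurable hm]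
    rfl

theorem vol_singleton [Nonempty (Fin d)] (x : X) : vol d X {x} = 0 := by
  rw [vol, Measure.sum_apply _ (measurableSet_singleton x), ENNReal.tsum_eq_zero]
  exact fun n => le_antisymm ((Measure.restrict_apply_le _ _).trans
    (chartVolume_singleton _ _).le) zero_le

theorem vol_countable [Nonempty (Fin d)] {s : Set X} (hs : s.Countable) : vol d X s = 0 := by
  rw [← biUnion_of_singleton s]
  exact (measure_biUnion_null_iff hs).2 fun x _ => vol_singleton x

end Riem

/-! ### Closed forms and self-adjoint operators from a form completion. -/

namespace PartialForm

variable {H : Type*} [NormedAddCommGroup H] [InnerProductSpace ℝ H]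

/-- A Hilbert space realizing the completion of the domain of `q` for the form norm
`q(x, x) + ‖x‖²`, embedded into `H`. -/
structure FormCompletion (q : PartialForm H) (V : Type*) [NormedAddCommGroup V]
    [InnerProductSpace ℝ V] where
  embed : q.domain →ₗ[ℝ] V
  incl : V →L[ℝ] H
  denseRange : DenseRange embed
  injective : Function.Injective incl
  incl_embed : ∀ x, incl (embed x) = x
  inner_embed : ∀ x y, inner ℝ (embed x) (embed y) = q.form x y + inner ℝ (x : H) (y : H)

namespace FormCompletion

variable {q : PartialForm H} {V : Type*} [NormedAddCommGroup V] [InnerProductSpace ℝ V]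
  (c : q.FormCompletion V)

theorem form_eq (x y : q.domain) :
    q.form x y = inner ℝ (c.embed x) (c.embed y) - inner ℝ (x : H) (y : H) := by
  rw [c.inner_embed]; ring

theorem norm_sq_embed (x : q.domain) : ‖c.embed x‖ ^ 2 = q.form x x + ‖(x : H)‖ ^ 2 := by
  rw [← real_inner_self_eq_norm_sq, c.inner_embed, real_inner_self_eq_norm_sq]

theorem approximates_of_tendsto {u : ℕ → q.domain} {v : V}
    (h : Tendsto (fun n => c.embed (u n)) atTop (𝓝 v)) : q.Approximates u (c.incl v) := by
  refine ⟨fun ε hε => ?_, ?_⟩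
  · obtain ⟨N, hN⟩ := Metric.cauchySeq_iff.1 h.cauchySeq (√ε) (Real.sqrt_pos.2 hε)
    refine ⟨N, fun m hm n hn => ?_⟩
    have h1 := hN m hm n hn
    rw [dist_eq_norm, ← map_sub] at h1
    have h2 : ‖c.embed (u m - u n)‖ ^ 2 < ε := by
      rw [← Real.lt_sqrt (norm_nonneg _)]; exact h1
    rw [c.norm_sq_embed] at h2
    nlinarith [sq_nonneg ‖((u m - u n : q.domain) : H)‖]
  · simpa [Function.comp_def, c.incl_embed] using (c.incl.continuous.tendsto v).comp h

/-- Cauchy for the form and convergent in `H` together mean Cauchy for the form norm, so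
completeness supplies a limit; continuity of the inclusion identifies its image. -/
theorem exists_tendsto [CompleteSpace V] {u : ℕ → q.domain} {x : H} (h : q.Approximates u x) :
    ∃ v, c.incl v = x ∧ Tendsto (fun n => c.embed (u n)) atTop (𝓝 v) := by
  have hC : CauchySeq fun n => c.embed (u n) := by
    refine Metric.cauchySeq_iff.2 fun ε hε => ?_
    -- The squared form norm of a difference is then below `ε² / 2 + ε² / 4 < ε²`.
    obtain ⟨N₁, hN₁⟩ := h.1 (ε ^ 2 / 2) (by positivity)
    obtain ⟨N₂, hN₂⟩ := Metric.cauchySeq_iff.1 h.2.cauchySeq (ε / 2) (by positivity)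
    refine ⟨max N₁ N₂, fun m hm n hn => ?_⟩
    have h1 := hN₁ m (le_of_max_le_left hm) n (le_of_max_le_left hn)
    have h2 := hN₂ m (le_of_max_le_right hm) n (le_of_max_le_right hn)
    rw [dist_eq_norm, ← Submodule.coe_sub] at h2
    rw [dist_eq_norm, ← map_sub]
    refine lt_of_pow_lt_pow_left₀ 2 hε.le ?_
    rw [c.norm_sq_embed]
    nlinarith [norm_nonneg ((u m - u n : q.domain) : H)]
  obtain ⟨v, hv⟩ := cauchySeq_tendsto_of_complete hC
  exact ⟨v, tendsto_nhds_unique (c.approximates_of_tendsto hv).2 h.2, hv⟩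

/-- Injectivity of the inclusion does the work: the limit in the completion of a sequence tending to
zero in `H` must itself be zero. -/
theorem isClosable [CompleteSpace V] (c : q.FormCompletion V) : q.IsClosable := by
  intro u hu
  obtain ⟨v, hv, hlim⟩ := c.exists_tendsto hu
  obtain rfl : v = 0 := c.injective (hv.trans (map_zero c.incl).symm)
  have h := (hlim.inner (𝕜 := ℝ) hlim).sub (hu.2.inner (𝕜 := ℝ) hu.2)
  simpa [c.form_eq] using h

/-- The closure of `q`. -/
def closure : PartialForm H where
  domain := LinearMap.range (c.incl : V →ₗ[ℝ] H)
  form := (innerₗ V).compl₁₂ (LinearEquiv.ofInjective (c.incl : V →ₗ[ℝ] H) c.injective).symm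
      (LinearEquiv.ofInjective (c.incl : V →ₗ[ℝ] H) c.injective).symm -
    (innerₗ H).compl₁₂ (Submodule.subtype _) (Submodule.subtype _)

theorem incl_mem (v : V) : c.incl v ∈ c.closure.domain := ⟨v, rfl⟩

theorem closure_form (v w : V) : c.closure.form ⟨c.incl v, c.incl_mem v⟩ ⟨c.incl w, c.incl_mem w⟩ =
    inner ℝ v w - inner ℝ (c.incl v) (c.incl w) := by
  have h : ∀ (v : V) (h : c.incl v ∈ LinearMap.range (c.incl : V →ₗ[ℝ] H)),
      (LinearEquiv.ofInjective (c.incl : V →ₗ[ℝ] H) c.injective).symm ⟨c.incl v, h⟩ = v :=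
    fun v _ => by rw [LinearEquiv.symm_apply_eq]; rfl
  exact congrArg₂ (· - ·) (congrArg₂ (inner ℝ) (h v ⟨v, rfl⟩) (h w ⟨w, rfl⟩)) rfl

theorem isClosureOf [CompleteSpace V] : c.closure.IsClosureOf q where
  mem_domain_iff x := by
    constructor
    · rintro ⟨v, rfl⟩
      obtain ⟨w, hw, hlim⟩ := mem_closure_iff_seq_limit.1 (c.denseRange v)
      choose u hu using hw
      exact ⟨u, c.approximates_of_tendsto (by simpa [hu] using hlim)⟩
    · rintro ⟨u, hu⟩
      obtain ⟨v, rfl, -⟩ := c.exists_tendsto hu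
      exact c.incl_mem v
  tendsto := by
    rintro ⟨x, hx⟩ ⟨y, hy⟩ u v hu hv
    obtain ⟨x, rfl, hx'⟩ := c.exists_tendsto hu
    obtain ⟨y, rfl, hy'⟩ := c.exists_tendsto hv
    rw [closure_form]
    simpa [c.form_eq] using (hx'.inner hy').sub (hu.2.inner hv.2)

section Operator

variable [CompleteSpace V] [CompleteSpace H]

/-- The resolvent `(A + 1)⁻¹` of the operator `A` associated with the closure of `q`. -/
def resolvent : H →L[ℝ] H := c.incl ∘L c.incl.adjoint

theorem resolvent_apply (w : H) : c.resolvent w = c.incl (c.incl.adjoint w) := rfl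

theorem inner_resolvent (w w' : H) : inner ℝ (c.resolvent w) w' = inner ℝ w (c.resolvent w') := by
  simp only [resolvent_apply]
  rw [← ContinuousLinearMap.adjoint_inner_right, ContinuousLinearMap.adjoint_inner_left]

theorem dense_range_incl (hq : Dense (q.domain : Set H)) : DenseRange c.incl :=
  hq.mono fun x hx => ⟨c.embed ⟨x, hx⟩, c.incl_embed _⟩

theorem injective_adjoint (hq : Dense (q.domain : Set H)) :
    Function.Injective c.incl.adjoint := by
  refine (injective_iff_map_eq_zero _).2 fun w hw => ?_
  refine (c.dense_range_incl hq).eq_zero_of_inner_left ℝ fun v => ?_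
  rw [← ContinuousLinearMap.adjoint_inner_left, hw, inner_zero_left]

theorem injective_resolvent (hq : Dense (q.domain : Set H)) :
    Function.Injective c.resolvent :=
  c.injective.comp (c.injective_adjoint hq)

/-- The operator associated with the closure of `q`. -/
def operator (hq : Dense (q.domain : Set H)) : H →ₗ.[ℝ] H where
  domain := LinearMap.range (c.resolvent : H →ₗ[ℝ] H)
  toFun := ((LinearEquiv.ofInjective (c.resolvent : H →ₗ[ℝ] H)
    (c.injective_resolvent hq)).symm : _ →ₗ[ℝ] H) - Submodule.subtype _

theorem operator_apply (hq : Dense (q.domain : Set H)) (w : H)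
    (h : c.resolvent w ∈ (c.operator hq).domain) :
    c.operator hq ⟨c.resolvent w, h⟩ = w - c.resolvent w := by
  refine congrArg (· - c.resolvent w) (?_ : (LinearEquiv.ofInjective (c.resolvent : H →ₗ[ℝ] H)
    (c.injective_resolvent hq)).symm ⟨c.resolvent w, h⟩ = w)
  rw [LinearEquiv.symm_apply_eq]; rfl

theorem mem_graph_operator (hq : Dense (q.domain : Set H)) {x w : H} :
    (x, w) ∈ (c.operator hq).graph ↔ c.resolvent (w + x) = x := by
  rw [LinearPMap.mem_graph_iff]
  constructor
  · rintro ⟨⟨_, a, rfl⟩, rfl, rfl⟩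
    erw [operator_apply]
    simp
  · intro h
    refine ⟨⟨x, w + x, h⟩, rfl, ?_⟩
    have h1 := c.operator_apply hq (w + x) ⟨w + x, rfl⟩
    simp only [h] at h1
    rw [h1]
    simp

/-- Writing `x = J v`, the condition `q(x, J u) = (w, J u)` for all `u` says `(v, u)_V = (w + x, J
u)_H`, that is `v = J* (w + x)`, or `x = J J* (w + x)`. -/
theorem isAssociatedWith (hq : Dense (q.domain : Set H)) :
    c.closure.IsAssociatedWith (c.operator hq) := by
  intro x w
  rw [mem_graph_operator]
  constructor
  · intro h
    have hx : c.incl (c.incl.adjoint (w + x)) = x := h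
    refine ⟨hx ▸ c.incl_mem _, ?_⟩
    rintro ⟨_, v, rfl⟩
    have h1 := c.closure_form (c.incl.adjoint (w + x)) v
    rw [ContinuousLinearMap.adjoint_inner_left] at h1
    simp only [hx] at h1
    refine h1.trans ?_
    rw [inner_add_left, add_sub_cancel_right]
    rfl
  · rintro ⟨⟨v, rfl⟩, h⟩
    have h1 : c.incl.adjoint (w + c.incl v) = v := by
      refine ext_inner_right ℝ fun u => ?_
      rw [ContinuousLinearMap.adjoint_inner_left, inner_add_left]
      have h2 := (c.closure_form v u).symm.trans (h ⟨c.incl u, c.incl_mem u⟩)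
      linarith
    exact congrArg c.incl h1

/-- The resolvent is symmetric, so a vector orthogonal to its range lies in its kernel, which is
trivial. -/
theorem dense_domain_operator (hq : Dense (q.domain : Set H)) :
    Dense ((c.operator hq).domain : Set H) := by
  refine Submodule.dense_iff_topologicalClosure_eq_top.2 ?_
  rw [← Submodule.orthogonal_eq_bot_iff, Submodule.orthogonal_closure, Submodule.eq_bot_iff]
  intro y hy
  refine (injective_iff_map_eq_zero _).1 (c.injective_resolvent hq) y ?_
  refine ext_inner_left ℝ fun w => ?_
  rw [← inner_resolvent, inner_zero_right]
  exact (Submodule.mem_orthogonal _ _).1 hy _ ⟨w, rfl⟩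

theorem symmetric_operator (hq : Dense (q.domain : Set H)) :
    (c.operator hq).IsFormalAdjoint (c.operator hq) := by
  rintro ⟨_, a, rfl⟩ ⟨_, b, rfl⟩
  erw [operator_apply, operator_apply]
  change inner ℝ _ (c.resolvent b) = inner ℝ (c.resolvent a) _
  rw [inner_sub_left, inner_sub_right, c.inner_resolvent, c.inner_resolvent]

/-- Only `D(A*) ⊆ D(A)` is at stake. For `y ∈ D(A*)`, symmetry of the resolvent `R` gives `(w, R (A*
y + y)) = (w - R w, y) + (R w, y) = (w, y)` for all `w`, so `y` lies in the range of `R`. -/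
theorem isSelfAdjoint_operator (hq : Dense (q.domain : Set H)) :
    IsSelfAdjoint (c.operator hq) := by
  have hd := c.dense_domain_operator hq
  have hle := (c.symmetric_operator hq).le_adjoint hd
  rw [LinearPMap.isSelfAdjoint_def]
  refine (LinearPMap.eq_of_le_of_domain_eq hle (le_antisymm hle.1 fun y hy => ?_)).symm
  refine ⟨(c.operator hq).adjoint ⟨y, hy⟩ + y, ext_inner_left ℝ fun w => ?_⟩
  have h1 := (LinearPMap.adjoint_isFormalAdjoint hd) ⟨y, hy⟩ ⟨c.resolvent w, w, rfl⟩
  erw [c.operator_apply] at h1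
  change inner ℝ _ (c.resolvent w) = inner ℝ y _ at h1
  change inner ℝ w (c.resolvent _) = _
  rw [← c.inner_resolvent, inner_add_right, real_inner_comm, h1, inner_sub_right,
    real_inner_comm (c.resolvent w) y, real_inner_comm w y]
  ring

theorem norm_incl_le (hnn : ∀ x, 0 ≤ q.form x x) (v : V) : ‖c.incl v‖ ≤ ‖v‖ := by
  refine c.denseRange.induction_on (p := fun v => ‖c.incl v‖ ≤ ‖v‖) v
    (isClosed_le (by fun_prop) (by fun_prop)) fun x => ?_
  refine (sq_le_sq₀ (norm_nonneg _) (norm_nonneg _)).1 ?_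
  rw [c.norm_sq_embed, c.incl_embed]
  linarith [hnn x]

theorem nonneg_operator (hq : Dense (q.domain : Set H)) (hnn : ∀ x, 0 ≤ q.form x x)
    (x : (c.operator hq).domain) : 0 ≤ inner ℝ (c.operator hq x) (x : H) := by
  obtain ⟨_, a, rfl⟩ := x
  erw [operator_apply]
  change 0 ≤ inner ℝ _ (c.resolvent a)
  -- With `x = J J* a` the quantity is `‖J* a‖² - ‖J J* a‖²`, and `J` is a contraction for a
  -- nonnegative form.
  rw [inner_sub_left, resolvent_apply, ← ContinuousLinearMap.adjoint_inner_left,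
    real_inner_self_eq_norm_sq, real_inner_self_eq_norm_sq, sub_nonneg]
  gcongr
  exact c.norm_incl_le hnn _

end Operator

end FormCompletion

/-- Testing against the dense embedded domain shows `J* (T x + x) = x` in the completion, so the
resolvent maps `T x + x` to `x`. -/
theorem le_operator {T : H →ₗ.[ℝ] H} {V : Type*} [NormedAddCommGroup V] [InnerProductSpace ℝ V]
    [CompleteSpace V] [CompleteSpace H] (c : (ofOperator T).FormCompletion V)
    (hT : Dense ((ofOperator T).domain : Set H)) : T ≤ c.operator hT := by
  refine LinearPMap.le_of_le_graph ?_
  rintro ⟨x, w⟩ hx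
  obtain ⟨x, rfl, rfl⟩ := (LinearPMap.mem_graph_iff _).1 hx
  rw [c.mem_graph_operator]
  have h : c.incl.adjoint (T x + x) = c.embed x := by
    refine c.denseRange.eq_of_inner_left ℝ fun y => ?_
    rw [ContinuousLinearMap.adjoint_inner_left, c.incl_embed, inner_add_left]
    exact (c.inner_embed x y).symm
  rw [c.resolvent_apply, h]
  exact c.incl_embed x

end PartialForm

/-! ### The form completion of a symmetric operator, and its Friedrichs extension. -/

namespace PartialForm

universe u

variable {H : Type u} [NormedAddCommGroup H] [InnerProductSpace ℝ H]

/-- The domain of a partial form, to be equipped with the form norm. -/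
def FormDomain (q : PartialForm H) : Type u := q.domain

instance (q : PartialForm H) : AddCommGroup q.FormDomain := inferInstanceAs (AddCommGroup q.domain)

instance (q : PartialForm H) : Module ℝ q.FormDomain := inferInstanceAs (Module ℝ q.domain)

/-- The inner product `q(x, y) + (x, y)` on the domain of a nonnegative symmetric form. -/
abbrev formCore (q : PartialForm H) (hsymm : ∀ x y, q.form x y = q.form y x)
    (hnn : ∀ x, 0 ≤ q.form x x) : InnerProductSpace.Core ℝ q.FormDomain where
  inner x y := q.form x y + inner ℝ (x.1 : H) y.1
  conj_inner_symm x y := by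
    simp only [conj_trivial]
    rw [hsymm y x, real_inner_comm]
  re_inner_nonneg x := add_nonneg (hnn x) real_inner_self_nonneg
  add_left x y z := by
    have h : ∀ x y z : q.domain, q.form (x + y) z + inner ℝ ((x : H) + y) (z : H) =
        q.form x z + inner ℝ (x : H) (z : H) + (q.form y z + inner ℝ (y : H) (z : H)) := by
      intro x y z
      rw [map_add, LinearMap.add_apply, inner_add_left]
      ring
    exact h x y z
  smul_left x y r := by
    have h : ∀ x y : q.domain, q.form (r • x) y + inner ℝ (r • (x : H)) (y : H) =
        r * (q.form x y + inner ℝ (x : H) (y : H)) := by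
      intro x y
      rw [map_smul, LinearMap.smul_apply, real_inner_smul_left, smul_eq_mul, mul_add]
    exact h x y
  definite x hx := by
    have h1 : q.form x x + inner ℝ (x.1 : H) x.1 = 0 := hx
    have h2 : inner ℝ (x.1 : H) x.1 = 0 := by linarith [hnn x, real_inner_self_nonneg (x := x.1)]
    exact Subtype.ext (inner_self_eq_zero.1 h2)

/-- The crucial point is injectivity of the extended inclusion `J`. Since `q(·, y)` is represented
by a vector `w` of `H`, the form inner product of `v` with `y` equals `(J v, w + y)` on the domain
and hence, by continuity, for all `v` in the completion; so `J v = 0` makes `v` orthogonal to a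
dense set. -/
theorem exists_formCompletion [CompleteSpace H] {q : PartialForm H}
    (hsymm : ∀ x y, q.form x y = q.form y x) (hnn : ∀ x, 0 ≤ q.form x x)
    (hrep : ∀ y, ∃ w : H, ∀ x : q.domain, q.form x y = inner ℝ (x : H) w) :
    ∃ (V : Type u) (_ : NormedAddCommGroup V) (_ : InnerProductSpace ℝ V) (_ : CompleteSpace V),
      Nonempty (q.FormCompletion V) := by
  let core := q.formCore hsymm hnn
  let : NormedAddCommGroup q.FormDomain := core.toNormedAddCommGroup
  let : InnerProductSpace ℝ q.FormDomain := InnerProductSpace.ofCore core.toCore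
  have hin : ∀ x y : q.FormDomain, inner ℝ x y = q.form x y + inner ℝ (x.1 : H) y.1 :=
    fun _ _ => rfl
  let toForm : q.domain →ₗ[ℝ] q.FormDomain :=
    { toFun := fun x => x, map_add' := fun _ _ => rfl, map_smul' := fun _ _ => rfl }
  let i₀ : q.FormDomain →ₗ[ℝ] H :=
    { toFun := fun x => x.1, map_add' := fun _ _ => rfl, map_smul' := fun _ _ => rfl }
  let i : q.FormDomain →L[ℝ] H := i₀.mkContinuous 1 fun x => by
    rw [one_mul, ← sq_le_sq₀ (norm_nonneg _) (norm_nonneg _), ← real_inner_self_eq_norm_sq,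
      ← real_inner_self_eq_norm_sq, hin]
    exact le_add_of_nonneg_left (hnn x)
  let e : q.domain →ₗ[ℝ] UniformSpace.Completion q.FormDomain :=
    (UniformSpace.Completion.toComplₗᵢ (𝕜 := ℝ) (E := q.FormDomain)).toLinearMap ∘ₗ toForm
  have he : DenseRange e := UniformSpace.Completion.denseRange_coe (α := q.FormDomain)
  have hie : ∀ x, i.fromCompletion (e x) = x := fun x =>
    i.fromCompletion_apply_coe (toForm x)
  have hee : ∀ x y, inner ℝ (e x) (e y) = q.form x y + inner ℝ (x : H) (y : H) := fun x y =>
    UniformSpace.Completion.inner_coe (𝕜 := ℝ) (toForm x) (toForm y)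
  refine ⟨UniformSpace.Completion q.FormDomain, inferInstance, inferInstance, inferInstance,
    ⟨⟨e, i.fromCompletion, he, (injective_iff_map_eq_zero _).2 fun v hv => ?_, hie, hee⟩⟩⟩
  refine he.eq_zero_of_inner_left ℝ fun y => ?_
  obtain ⟨w, hw⟩ := hrep y
  have h : inner ℝ v (e y) = inner ℝ (i.fromCompletion v) (w + y) := by
    refine he.induction_on
      (p := fun v => inner ℝ v (e y) = inner ℝ (i.fromCompletion v) (w + (y : H))) v
      (isClosed_eq (by fun_prop) (by fun_prop)) fun x => ?_
    rw [hee, hie, hw, inner_add_right]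
  rw [h, hv, inner_zero_left]

end PartialForm

/-- Closability of the form of a densely defined nonnegative symmetric operator, and existence of
its Friedrichs extension. -/
theorem exists_isFriedrichsExtension {H : Type*} [NormedAddCommGroup H] [InnerProductSpace ℝ H]
    [CompleteSpace H] {T : H →ₗ.[ℝ] H} (hT : Dense (T.domain : Set H))
    (hsymm : ∀ x y : T.domain, inner ℝ (T x) (y : H) = inner ℝ (x : H) (T y))
    (hnn : ∀ x : T.domain, 0 ≤ inner ℝ (T x) (x : H)) :
    (PartialForm.ofOperator T).IsClosable ∧ ∃ (p : PartialForm H) (A : H →ₗ.[ℝ] H),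
      p.IsClosureOf (PartialForm.ofOperator T) ∧ p.IsAssociatedWith A ∧ IsSelfAdjoint A ∧
      (∀ x : A.domain, 0 ≤ inner ℝ (A x) (x : H)) ∧ IsFriedrichsExtension T A := by
  obtain ⟨V, _, _, _, ⟨c⟩⟩ := PartialForm.exists_formCompletion (q := PartialForm.ofOperator T)
    (fun x y => (hsymm x y).trans (real_inner_comm _ _)) hnn fun y => ⟨T y, fun x => hsymm x y⟩
  exact ⟨c.isClosable, c.closure, c.operator hT, c.isClosureOf, c.isAssociatedWith hT,
    c.isSelfAdjoint_operator hT, c.nonneg_operator hT hnn, hT, hsymm, hnn,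
    PartialForm.le_operator c hT, c.closure, c.isClosureOf, c.isAssociatedWith hT⟩

/-! ### Stability of smooth functions with bounded derivatives. -/

section BoundedDerivs

variable {E F : Type*} [NormedAddCommGroup E] [NormedSpace ℝ E] [NormedAddCommGroup F]
  [NormedSpace ℝ F]

/-- Smooth functions bounded together with all their derivatives. -/
def BoundedDerivs (g : E → ℝ) : Prop :=
  ContDiff ℝ ∞ g ∧ ∀ k : ℕ, ∃ C : ℝ, ∀ t, ‖iteratedFDeriv ℝ k g t‖ ≤ C

namespace BoundedDerivs

theorem const (c : ℝ) : BoundedDerivs fun _ : E => c := by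
  refine ⟨contDiff_const, fun k => ?_⟩
  rcases eq_or_ne k 0 with rfl | hk
  · exact ⟨‖c‖, fun t => by rw [norm_iteratedFDeriv_zero]⟩
  · exact ⟨0, fun t => by rw [iteratedFDeriv_const_of_ne hk]; simp⟩

theorem add {g h : E → ℝ} (hg : BoundedDerivs g) (hh : BoundedDerivs h) :
    BoundedDerivs fun t => g t + h t := by
  refine ⟨hg.1.add hh.1, fun k => ?_⟩
  obtain ⟨C, hC⟩ := hg.2 k
  obtain ⟨D, hD⟩ := hh.2 k
  refine ⟨C + D, fun t => ?_⟩
  have h1 : iteratedFDeriv ℝ k (fun t => g t + h t) t = _ := iteratedFDeriv_add_apply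
    ((hg.1.of_le (mod_cast le_top)).contDiffAt) ((hh.1.of_le (mod_cast le_top)).contDiffAt)
  rw [h1]
  exact (norm_add_le _ _).trans (add_le_add (hC t) (hD t))

theorem mul {g h : E → ℝ} (hg : BoundedDerivs g) (hh : BoundedDerivs h) :
    BoundedDerivs fun t => g t * h t := by
  refine ⟨hg.1.mul hh.1, fun k => ?_⟩
  choose C hC using hg.2
  choose D hD using hh.2
  refine ⟨∑ i ∈ Finset.range (k + 1), (k.choose i) * C i * D (k - i), fun t => ?_⟩
  refine (norm_iteratedFDeriv_mul_le hg.1 hh.1 t (n := k) (mod_cast le_top)).trans ?_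
  refine Finset.sum_le_sum fun i _ => ?_
  have h1 : 0 ≤ C i := (norm_nonneg _).trans (hC i t)
  gcongr
  · exact hC i t
  · exact hD _ t

theorem comp_clm {g : E → ℝ} (hg : BoundedDerivs g) (L : F →L[ℝ] E) :
    BoundedDerivs fun t => g (L t) := by
  refine ⟨hg.1.comp L.contDiff, fun k => ?_⟩
  obtain ⟨C, hC⟩ := hg.2 k
  refine ⟨C * ∏ _i : Fin k, ‖L‖, fun t => ?_⟩
  have h1 : iteratedFDeriv ℝ k (fun t => g (L t)) t = _ :=
    L.iteratedFDeriv_comp_right hg.1 t (i := k) (mod_cast le_top)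
  rw [h1]
  refine (ContinuousMultilinearMap.norm_compContinuousLinearMap_le _ _).trans ?_
  gcongr
  exact hC _

theorem fderiv_apply {g : E → ℝ} (hg : BoundedDerivs g) (v : E) :
    BoundedDerivs fun t => fderiv ℝ g t v := by
  have hf : ContDiff ℝ ∞ (fderiv ℝ g) := hg.1.fderiv_right (by simp)
  refine ⟨hf.clm_apply contDiff_const, fun k => ?_⟩
  obtain ⟨C, hC⟩ := hg.2 (k + 1)
  refine ⟨‖ContinuousLinearMap.apply ℝ ℝ v‖ * C, fun t => ?_⟩
  refine ((ContinuousLinearMap.apply ℝ ℝ v).norm_iteratedFDeriv_comp_left (f := fderiv ℝ g)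
    (x := t) (n := k) hf.contDiffAt (mod_cast le_top)).trans ?_
  rw [norm_iteratedFDeriv_fderiv]
  gcongr
  exact hC t

theorem exists_bound {g : E → ℝ} (hg : BoundedDerivs g) : ∃ C, 0 ≤ C ∧ ∀ t, |g t| ≤ C := by
  obtain ⟨C, hC⟩ := hg.2 0
  refine ⟨C, (norm_nonneg _).trans (hC 0), fun t => ?_⟩
  simpa [norm_iteratedFDeriv_zero] using hC t

/-- All derivatives of positive order are supported in `[0, 1]` and continuous, hence bounded. This
makes smooth approximations of half-line indicators available to cylinder functions. -/
theorem smoothTransition : BoundedDerivs Real.smoothTransition := by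
  refine ⟨Real.smoothTransition.contDiff, fun k => ?_⟩
  rcases k with _ | k
  · refine ⟨1, fun t => ?_⟩
    rw [norm_iteratedFDeriv_zero, Real.norm_of_nonneg (Real.smoothTransition.nonneg t)]
    exact Real.smoothTransition.le_one t
  · have hf : ContDiff ℝ ∞ (fderiv ℝ Real.smoothTransition) :=
      Real.smoothTransition.contDiff (n := ⊤) |>.fderiv_right (by simp)
    have hc : HasCompactSupport (fderiv ℝ Real.smoothTransition) := by
      refine HasCompactSupport.intro (isCompact_Icc (a := (0 : ℝ)) (b := 1)) fun t ht => ?_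
      rcases lt_or_ge t 0 with h | h
      · have : Real.smoothTransition =ᶠ[𝓝 t] fun _ => 0 := by
          filter_upwards [gt_mem_nhds h] with s hs
          exact Real.smoothTransition.zero_of_nonpos hs.le
        rw [this.fderiv_eq]; simp
      · have h1 : 1 < t := by
          by_contra h2
          exact ht ⟨h, not_lt.1 h2⟩
        have : Real.smoothTransition =ᶠ[𝓝 t] fun _ => 1 := by
          filter_upwards [lt_mem_nhds h1] with s hs
          exact Real.smoothTransition.one_of_one_le hs.le
        rw [this.fderiv_eq]; simp
    obtain ⟨C, hC⟩ := (hc.iteratedFDeriv (𝕜 := ℝ) k).exists_bound_of_continuous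
      (hf.continuous_iteratedFDeriv (m := k) (mod_cast le_top))
    exact ⟨C, fun t => by rw [← norm_iteratedFDeriv_fderiv]; exact hC t⟩

theorem comp_add_const {g : E → ℝ} (hg : BoundedDerivs g) (a : E) :
    BoundedDerivs fun t => g (t + a) := by
  refine ⟨hg.1.comp (contDiff_id.add contDiff_const), fun k => ?_⟩
  obtain ⟨C, hC⟩ := hg.2 k
  refine ⟨C, fun t => ?_⟩
  rw [iteratedFDeriv_comp_add_right]
  exact hC _

theorem partialDeriv {N : ℕ} {g : (Fin N → ℝ) → ℝ} (hg : BoundedDerivs g) (i : Fin N) :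
    BoundedDerivs (_root_.partialDeriv i g) :=
  hg.fderiv_apply _

end BoundedDerivs

end BoundedDerivs

/-! ### The algebra of cylinder functions. -/

namespace Config

variable {d : ℕ} {X : Type*} [TopologicalSpace X] [ChartedSpace (EuclideanSpace ℝ (Fin d)) X]
  [IsManifold (𝓡 d) ∞ X] [RiemannianBundle (fun x : X => TangentSpace (𝓡 d) x)]

namespace IsCylinder

theorem const (c : ℝ) : IsCylinder d (fun _ : Config X => c) :=
  ⟨0, fun _ _ => 0, fun _ => c, fun i => i.elim0, (BoundedDerivs.const c).1,
    (BoundedDerivs.const c).2, fun _ => rfl⟩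

/-- Two presentations are merged by concatenating the lists of the `φ_i` and composing each outer
function with a coordinate projection. -/
theorem comp₂ {F G : Config X → ℝ} (hF : IsCylinder d F) (hG : IsCylinder d G) (op : ℝ → ℝ → ℝ)
    (hop : ∀ {n : ℕ} {g h : (Fin n → ℝ) → ℝ}, BoundedDerivs g → BoundedDerivs h →
      BoundedDerivs fun t => op (g t) (h t)) :
    IsCylinder d fun γ => op (F γ) (G γ) := by
  obtain ⟨N, φ, g, hφ, hg, hg', hF⟩ := hF
  obtain ⟨M, ψ, h, hψ, hh, hh', hG⟩ := hG
  let L : (Fin (N + M) → ℝ) →L[ℝ] (Fin N → ℝ) :=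
    ContinuousLinearMap.pi fun i => ContinuousLinearMap.proj (Fin.castAdd M i)
  let R : (Fin (N + M) → ℝ) →L[ℝ] (Fin M → ℝ) :=
    ContinuousLinearMap.pi fun i => ContinuousLinearMap.proj (Fin.natAdd N i)
  have hb := hop (BoundedDerivs.comp_clm ⟨hg, hg'⟩ L) (BoundedDerivs.comp_clm ⟨hh, hh'⟩ R)
  refine ⟨N + M, Fin.append φ ψ, _, fun i => ?_, hb.1, hb.2, fun γ => ?_⟩
  · refine Fin.addCases (fun i => ?_) (fun i => ?_) i
    · simpa using hφ i
    · simpa using hψ i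
  · change op (F γ) (G γ) = _
    rw [hF, hG]
    congr 2 <;> ext i
    · simp [L]
    · simp [R]

theorem add {F G : Config X → ℝ} (hF : IsCylinder d F) (hG : IsCylinder d G) :
    IsCylinder d fun γ => F γ + G γ :=
  hF.comp₂ hG _ BoundedDerivs.add

theorem mul {F G : Config X → ℝ} (hF : IsCylinder d F) (hG : IsCylinder d G) :
    IsCylinder d fun γ => F γ * G γ :=
  hF.comp₂ hG _ BoundedDerivs.mul

theorem const_mul {F : Config X → ℝ} (c : ℝ) (hF : IsCylinder d F) :
    IsCylinder d fun γ => c * F γ :=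
  (const c).mul hF

theorem comp_pair {φ : X → ℝ} (hφ : ContMDiff (𝓡 d) 𝓘(ℝ, ℝ) ∞ φ) (hφ' : HasCompactSupport φ)
    {g : ℝ → ℝ} (hg : BoundedDerivs g) : IsCylinder d fun γ => g (pair φ γ) := by
  have h := hg.comp_clm (ContinuousLinearMap.proj (R := ℝ) (φ := fun _ : Fin 1 => ℝ) 0)
  exact ⟨1, fun _ => φ, _, fun _ => ⟨hφ, hφ'⟩, h.1, h.2, fun _ => rfl⟩

end IsCylinder

end Config

/-! ### Square integrability of sums of bounded, compactly supported functions. -/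

namespace Config

section BoundedSupportedIn

variable {X : Type*} [MetricSpace X] [LocallyCompactSpace X] [SecondCountableTopology X]
  [MeasurableSpace X] [BorelSpace X]

/-- Bounded measurable functions of a configuration and a point, vanishing unless the point lies
in `K`. -/
structure IsBoundedOn (K : Set X) (G : Config X × X → ℝ) : Prop where
  measurable : Measurable G
  exists_bound : ∃ C, 0 ≤ C ∧ ∀ p, |G p| ≤ C
  eq_zero : ∀ γ, ∀ x ∉ K, G (γ, x) = 0

namespace IsBoundedOn

variable {K : Set X}

theorem mul_left {G : Config X × X → ℝ} (hG : IsBoundedOn K G) {a : Config X → ℝ}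
    (ha : Measurable a) (ha' : ∃ C, 0 ≤ C ∧ ∀ γ, |a γ| ≤ C) :
    IsBoundedOn K fun p => a p.1 * G p where
  measurable := (ha.comp measurable_fst).mul hG.measurable
  exists_bound := by
    obtain ⟨C, hC0, hC⟩ := ha'
    obtain ⟨D, hD0, hD⟩ := hG.exists_bound
    refine ⟨C * D, by positivity, fun p => ?_⟩
    rw [abs_mul]
    exact mul_le_mul (hC _) (hD _) (abs_nonneg _) hC0
  eq_zero γ x hx := by simp [hG.eq_zero γ x hx]

theorem sum {ι : Type*} (s : Finset ι) {G : ι → Config X × X → ℝ}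
    (hG : ∀ i ∈ s, IsBoundedOn K (G i)) : IsBoundedOn K fun p => ∑ i ∈ s, G i p where
  measurable := Finset.measurable_sum s fun i hi => (hG i hi).measurable
  exists_bound := by
    have h : ∀ i, ∃ C, 0 ≤ C ∧ (i ∈ s → ∀ p, |G i p| ≤ C) := fun i => by
      by_cases hi : i ∈ s
      · obtain ⟨C, hC0, hC⟩ := (hG i hi).exists_bound
        exact ⟨C, hC0, fun _ => hC⟩
      · exact ⟨0, le_rfl, fun h => absurd h hi⟩
    choose C hC0 hC using h
    exact ⟨∑ i ∈ s, C i, Finset.sum_nonneg fun i _ => hC0 i, fun p =>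
      (Finset.abs_sum_le_sum_abs _ _).trans (Finset.sum_le_sum fun i hi => hC i hi p)⟩
  eq_zero γ x hx := Finset.sum_eq_zero fun i hi => (hG i hi).eq_zero γ x hx

theorem add {G₁ G₂ : Config X × X → ℝ} (h₁ : IsBoundedOn K G₁) (h₂ : IsBoundedOn K G₂) :
    IsBoundedOn K fun p => G₁ p + G₂ p where
  measurable := h₁.measurable.add h₂.measurable
  exists_bound := by
    obtain ⟨C, hC0, hC⟩ := h₁.exists_bound
    obtain ⟨D, hD0, hD⟩ := h₂.exists_bound
    exact ⟨C + D, by positivity, fun p => (abs_add_le _ _).trans (add_le_add (hC p) (hD p))⟩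
  eq_zero γ x hx := by simp [h₁.eq_zero γ x hx, h₂.eq_zero γ x hx]

theorem of_continuous {h : X → ℝ} (hh : Continuous h) (hK : IsCompact K) (h0 : ∀ x ∉ K, h x = 0) :
    IsBoundedOn K fun p : Config X × X => h p.2 where
  measurable := hh.measurable.comp measurable_snd
  exists_bound := by
    obtain ⟨C, hC⟩ := (HasCompactSupport.intro hK h0).exists_bound_of_continuous hh
    exact ⟨max C 0, le_max_right _ _, fun p => (hC p.2).trans (le_max_left _ _)⟩
  eq_zero _ := h0

/-- A bound times a cutoff of `K` dominates the summands, which brings the moments of `μ` into play.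
-/
theorem exists_abs_tsum_le {G : Config X × X → ℝ} (hG : IsBoundedOn K G) (hK : IsCompact K) :
    ∃ χ : C_c(X, ℝ), (∀ x, 0 ≤ χ x) ∧ ∀ γ : Config X,
      ∑' x : γ.carrier, ‖G (γ, x)‖ₑ ≤ ENNReal.ofReal (pair χ γ) := by
  obtain ⟨C, hC0, hC⟩ := hG.exists_bound
  obtain ⟨χ, hχ1, hχ⟩ := exists_cutoff hK
  refine ⟨C • χ, fun x => mul_nonneg hC0 (hχ x).1, fun γ => ?_⟩
  have hcs : IsCompact (tsupport (C • χ : C_c(X, ℝ))) := (C • χ).hasCompactSupport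
  have hKχ : ∀ x ∉ tsupport (C • χ : C_c(X, ℝ)), G (γ, x) = 0 := fun x hx => by
    by_cases hxK : x ∈ K
    · have h0 : (C • χ) x = 0 := image_eq_zero_of_notMem_tsupport hx
      have h1 : C * χ x = 0 := h0
      rw [hχ1 x hxK, mul_one] at h1
      have h2 := hC (γ, x)
      rw [h1] at h2
      exact abs_nonpos_iff.1 h2
    · exact hG.eq_zero γ x hxK
  rw [pair_eq_sum γ hcs fun x hx => image_eq_zero_of_notMem_tsupport hx,
    tsum_eq_sum_finsetIn γ hcs (f := fun x => ‖G (γ, x)‖ₑ) fun x hx => by simp [hKχ x hx],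
    ENNReal.ofReal_sum_of_nonneg (f := fun x => (C • χ) x) fun x _ => mul_nonneg hC0 (hχ x).1]
  refine Finset.sum_le_sum fun x _ => ?_
  rw [Real.enorm_eq_ofReal_abs]
  refine ENNReal.ofReal_le_ofReal ?_
  change _ ≤ C * χ x
  by_cases hxK : x ∈ K
  · rw [hχ1 x hxK, mul_one]; exact hC _
  · rw [hG.eq_zero γ x hxK, abs_zero]; exact mul_nonneg hC0 (hχ x).1

end IsBoundedOn

theorem enorm_tsum_carrier_le (γ : Config X) {K : Set X} (hK : IsCompact K) {f : X → ℝ}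
    (hf : ∀ x ∉ K, f x = 0) : ‖∑' x : γ.carrier, f x‖ₑ ≤ ∑' x : γ.carrier, ‖f x‖ₑ := by
  rw [tsum_eq_sum_finsetIn γ hK hf, tsum_eq_sum_finsetIn γ hK (f := fun x => ‖f x‖ₑ)
    fun x hx => by simp [hf x hx]]
  exact enorm_sum_le _ _

/-- The majorant may be any function with finite upper integral of its square, which suits the sums
of `|B_μ|`. -/
theorem memLp_two_of_enorm_le {α : Type*} [MeasurableSpace α] {μ : Measure α} {f : α → ℝ}
    (hf : AEStronglyMeasurable f μ) {b : α → ℝ≥0∞} (hb : ∫⁻ a, b a ^ 2 ∂μ < ⊤)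
    (hfb : ∀ a, ‖f a‖ₑ ≤ b a) : MemLp f 2 μ := by
  refine ⟨hf, ?_⟩
  rw [eLpNorm_lt_top_iff_lintegral_rpow_enorm_lt_top two_ne_zero ENNReal.ofNat_ne_top]
  refine lt_of_le_of_lt (lintegral_mono fun a => ?_) hb
  simpa using pow_le_pow_left' (hfb a) 2

theorem HasAllMoments.lintegral_pair_sq_lt_top {μ : Measure (Config X)} (h : HasAllMoments μ)
    {χ : C_c(X, ℝ)} (hχ : ∀ x, 0 ≤ χ x) :
    ∫⁻ γ, ENNReal.ofReal (pair χ γ) ^ 2 ∂μ < ⊤ := by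
  have h2 := (h 2 χ hχ).lintegral_lt_top
  refine lt_of_le_of_lt (lintegral_mono fun γ => ?_) h2
  rw [ENNReal.ofReal_pow]
  exact tsum_nonneg fun x => hχ _

theorem IsBoundedOn.memLp_tsum {K : Set X} (hK : IsCompact K) {μ : Measure (Config X)}
    (hμ : HasAllMoments μ) {G : Config X × X → ℝ} (hG : IsBoundedOn K G) :
    MemLp (fun γ : Config X => ∑' x : γ.carrier, G (γ, x)) 2 μ := by
  obtain ⟨χ, hχ, hb⟩ := hG.exists_abs_tsum_le hK
  exact memLp_two_of_enorm_le
    (measurable_tsum_carrier hG.measurable hK hG.eq_zero).aestronglyMeasurable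
    (hμ.lintegral_pair_sq_lt_top hχ) fun γ =>
      (enorm_tsum_carrier_le γ hK (hG.eq_zero γ)).trans (hb γ)

end BoundedSupportedIn

/-- A presentation `F(γ) = g(⟨φ_1, γ⟩, …, ⟨φ_N, γ⟩)` of a cylinder function. -/
structure CylinderData (d : ℕ) (X : Type*) [TopologicalSpace X]
    [ChartedSpace (EuclideanSpace ℝ (Fin d)) X] where
  N : ℕ
  φ : Fin N → X → ℝ
  g : (Fin N → ℝ) → ℝ
  contMDiff : ∀ i, ContMDiff (𝓡 d) 𝓘(ℝ, ℝ) ∞ (φ i)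
  hasCompactSupport : ∀ i, HasCompactSupport (φ i)
  boundedDerivs : BoundedDerivs g

theorem IsCylinder.exists_data {d : ℕ} {X : Type*} [TopologicalSpace X]
    [ChartedSpace (EuclideanSpace ℝ (Fin d)) X] {F : Config X → ℝ} (hF : IsCylinder d F) :
    ∃ C : CylinderData d X, F = fun γ => C.g fun i => pair (C.φ i) γ := by
  obtain ⟨N, φ, g, hφ, hg, hg', h⟩ := hF
  exact ⟨⟨N, φ, g, fun i => (hφ i).1, fun i => (hφ i).2, hg, hg'⟩, funext h⟩

/-! ### Gradient and Laplacian of a cylinder function in explicit form. -/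

namespace CylinderData

variable {d : ℕ} {X : Type*} [MetricSpace X] [LocallyCompactSpace X] [SecondCountableTopology X]
  [MeasurableSpace X] [BorelSpace X] [ChartedSpace (EuclideanSpace ℝ (Fin d)) X]
  [IsManifold (𝓡 d) ∞ X] [RiemannianBundle (fun x : X => TangentSpace (𝓡 d) x)]
  [IsContMDiffRiemannianBundle (𝓡 d) ∞ (EuclideanSpace ℝ (Fin d))
    (fun x : X => TangentSpace (𝓡 d) x)]
  (C : CylinderData d X)

/-- The arguments `⟨φ_i, γ⟩`. -/
def args (γ : Config X) (i : Fin C.N) : ℝ := pair (C.φ i) γ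

/-- The cylinder function. -/
def val (γ : Config X) : ℝ := C.g (C.args γ)

/-- A compact set containing the supports of the `φ_i`. -/
def supp : Set X := ⋃ i, tsupport (C.φ i)

/-- The function `y ↦ F(γ + ε_y)`. -/
def sect (γ : Config X) (y : X) : ℝ := C.g fun i => C.args γ i + C.φ i y

/-- The gradient of the cylinder function in the direction of the point `x`. -/
def gradAt (γ : Config X) (x : X) : TangentSpace (𝓡 d) x :=
  ∑ i, partialDeriv i C.g (C.args γ) • Riem.grad (C.φ i) x

/-- The Laplacian of the cylinder function in the direction of the point `x`. -/
def laplacianAt (γ : Config X) (x : X) : ℝ :=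
  ∑ i, (partialDeriv i C.g (C.args γ) * Riem.laplacian (d := d) (C.φ i) x +
    ∑ j, partialDeriv j (partialDeriv i C.g) (C.args γ) *
      inner ℝ (Riem.grad (d := d) (C.φ j) x) (Riem.grad (C.φ i) x))

theorem isCompact_supp : IsCompact C.supp :=
  isCompact_iUnion fun i => C.hasCompactSupport i

theorem notMem_tsupport {x : X} (hx : x ∉ C.supp) (i : Fin C.N) : x ∉ tsupport (C.φ i) :=
  fun h => hx (mem_iUnion.2 ⟨i, h⟩)

theorem measurable_args : Measurable C.args :=
  measurable_pi_lambda _ fun i => (continuous_pair_of_hasCompactSupport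
    (C.contMDiff i).continuous (C.hasCompactSupport i)).measurable

theorem measurable_comp_args {h : (Fin C.N → ℝ) → ℝ} (hh : BoundedDerivs h) :
    Measurable fun γ => h (C.args γ) :=
  hh.1.continuous.measurable.comp C.measurable_args

theorem exists_bound_comp_args {h : (Fin C.N → ℝ) → ℝ} (hh : BoundedDerivs h) :
    ∃ D, 0 ≤ D ∧ ∀ γ, |h (C.args γ)| ≤ D := by
  obtain ⟨D, hD0, hD⟩ := hh.exists_bound
  exact ⟨D, hD0, fun γ => hD _⟩

theorem args_add {γ : Config X} {x : X} (hx : x ∉ γ.carrier) :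
    C.args (γ.add x) = fun i => C.args γ i + C.φ i x :=
  funext fun i => pair_add_config (C.hasCompactSupport i) hx

theorem val_add {γ : Config X} {x : X} (hx : x ∉ γ.carrier) : C.val (γ.add x) = C.sect γ x := by
  rw [val, C.args_add hx, sect]

theorem contDiff_shift (γ : Config X) : ContDiff ℝ ∞ fun t => C.g (C.args γ + t) :=
  C.boundedDerivs.1.comp (contDiff_const.add contDiff_id)

theorem contMDiff_sect (γ : Config X) : ContMDiff (𝓡 d) 𝓘(ℝ, ℝ) ∞ (C.sect γ) :=
  Riem.contMDiff_comp_pi (C.contDiff_shift γ) C.contMDiff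

theorem _root_.partialDeriv_shift {N : ℕ} (g : (Fin N → ℝ) → ℝ) (a : Fin N → ℝ) (i : Fin N) :
    partialDeriv i (fun t => g (a + t)) = fun t => partialDeriv i g (a + t) := by
  ext t
  rw [partialDeriv, fderiv_comp_add_left]
  rfl

theorem grad_sect {γ : Config X} {x : X} (hx : x ∉ γ.carrier) :
    Riem.grad (d := d) (C.sect γ) x = C.gradAt (γ.add x) x := by
  refine (Riem.grad_comp (C.contDiff_shift γ) C.contMDiff x).trans ?_
  rw [gradAt, C.args_add hx]
  simp only [partialDeriv_shift]
  rfl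

theorem laplacian_sect {γ : Config X} {x : X} (hx : x ∉ γ.carrier) :
    Riem.laplacian (d := d) (C.sect γ) x = C.laplacianAt (γ.add x) x := by
  refine (Riem.laplacian_comp (C.contDiff_shift γ) C.contMDiff x).trans ?_
  rw [laplacianAt, C.args_add hx]
  simp only [partialDeriv_shift]
  rfl

/-- Configurations are sets, so moving `x` onto another point of `γ` merges the two and the additive
formula fails there. Such points do not accumulate at `x`, so derivatives at `x` are unaffected. -/
theorem moved_eventuallyEq (γ : Config X) (x : X) :
    moved C.val γ x =ᶠ[𝓝 x] C.sect (γ.erase x) := by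
  filter_upwards [eventually_notMem_erase γ x] with y hy
  exact C.val_add hy

theorem gradΓ_val {γ : Config X} {x : X} (hx : x ∈ γ.carrier) :
    gradΓ (d := d) C.val γ x = C.gradAt γ x := by
  rw [gradΓ, Riem.grad_congr (C.moved_eventuallyEq γ x), C.grad_sect notMem_erase, erase_add_self hx]

theorem laplacian_moved {γ : Config X} {x : X} (hx : x ∈ γ.carrier) :
    Riem.laplacian (d := d) (moved C.val γ x) x = C.laplacianAt γ x := by
  rw [Riem.laplacian_congr (C.moved_eventuallyEq γ x), C.laplacian_sect notMem_erase,
    erase_add_self hx]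

theorem laplacianΓ_val (γ : Config X) :
    laplacianΓ d C.val γ = ∑' x : γ.carrier, C.laplacianAt γ x :=
  tsum_congr fun x => C.laplacian_moved x.2

theorem innerΓ_val (D : CylinderData d X) (γ : Config X) :
    innerΓ (d := d) (gradΓ C.val) (gradΓ D.val) γ =
      ∑' x : γ.carrier, (inner ℝ (C.gradAt γ x) (D.gradAt γ x) : ℝ) :=
  tsum_congr fun x => by rw [C.gradΓ_val x.2, D.gradΓ_val x.2]

theorem innerΓ_val_left (B : Config X → (x : X) → TangentSpace (𝓡 d) x) (γ : Config X) :
    innerΓ (d := d) (gradΓ C.val) B γ =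
      ∑' x : γ.carrier, (inner ℝ (C.gradAt γ x) (B γ x) : ℝ) :=
  tsum_congr fun x => by rw [C.gradΓ_val x.2]

theorem gradAt_eq_zero (γ : Config X) {x : X} (hx : x ∉ C.supp) : C.gradAt γ x = 0 :=
  Finset.sum_eq_zero fun i _ => by
    rw [Riem.grad_eq_zero_of_notMem_tsupport (C.notMem_tsupport hx i), smul_zero]

theorem measurable_val : Measurable C.val := C.measurable_comp_args C.boundedDerivs

theorem exists_bound_val : ∃ D, 0 ≤ D ∧ ∀ γ, |C.val γ| ≤ D :=
  C.exists_bound_comp_args C.boundedDerivs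

theorem isBoundedOn_laplacianAt : IsBoundedOn C.supp fun p => C.laplacianAt p.1 p.2 := by
  refine IsBoundedOn.sum _ fun i _ => IsBoundedOn.add ?_ (IsBoundedOn.sum _ fun j _ => ?_)
  · have hb := C.boundedDerivs.partialDeriv i
    exact IsBoundedOn.mul_left (IsBoundedOn.of_continuous
      (Riem.continuous_laplacian (C.contMDiff i)) C.isCompact_supp fun x hx =>
        Riem.laplacian_eq_zero_of_notMem_tsupport (C.notMem_tsupport hx i))
      (C.measurable_comp_args hb) (C.exists_bound_comp_args hb)
  · have hb := (C.boundedDerivs.partialDeriv i).partialDeriv j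
    exact IsBoundedOn.mul_left (IsBoundedOn.of_continuous
      (Riem.continuous_inner_grad (C.contMDiff j) (C.contMDiff i)) C.isCompact_supp fun x hx => by
        rw [Riem.grad_eq_zero_of_notMem_tsupport (C.notMem_tsupport hx i), inner_zero_right])
      (C.measurable_comp_args hb) (C.exists_bound_comp_args hb)

theorem isBoundedOn_inner_gradAt (D : CylinderData d X) :
    IsBoundedOn C.supp fun p : Config X × X =>
      (inner ℝ (C.gradAt p.1 p.2) (D.gradAt p.1 p.2) : ℝ) := by
  simp only [gradAt, sum_inner, inner_sum, real_inner_smul_left, real_inner_smul_right]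
  refine IsBoundedOn.sum _ fun j _ => IsBoundedOn.sum _ fun i _ => ?_
  have hbi := C.boundedDerivs.partialDeriv i
  have hbj := D.boundedDerivs.partialDeriv j
  have h := IsBoundedOn.of_continuous (Riem.continuous_inner_grad (C.contMDiff i) (D.contMDiff j))
    C.isCompact_supp fun x hx => by
      rw [Riem.grad_eq_zero_of_notMem_tsupport (C.notMem_tsupport hx i), inner_zero_left]
  exact (h.mul_left (C.measurable_comp_args hbi) (C.exists_bound_comp_args hbi)).mul_left
    (D.measurable_comp_args hbj) (D.exists_bound_comp_args hbj)

theorem exists_bound_gradAt : ∃ D, 0 ≤ D ∧ ∀ γ x, ‖C.gradAt γ x‖ ≤ D := by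
  obtain ⟨D, hD0, hD⟩ := (C.isBoundedOn_inner_gradAt C).exists_bound
  refine ⟨√D, Real.sqrt_nonneg _, fun γ x => ?_⟩
  refine Real.le_sqrt_of_sq_le ?_
  rw [← real_inner_self_eq_norm_sq]
  exact (le_abs_self _).trans (hD (γ, x))

end CylinderData

end Config

/-! ### Weak gradients tested on fields `f ∇g`. -/

namespace Riem

variable {d : ℕ} {X : Type*} [MetricSpace X] [LocallyCompactSpace X] [SecondCountableTopology X]
  [MeasurableSpace X] [BorelSpace X] [ChartedSpace (EuclideanSpace ℝ (Fin d)) X]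
  [IsManifold (𝓡 d) ∞ X] [RiemannianBundle (fun x : X => TangentSpace (𝓡 d) x)]
  [IsContMDiffRiemannianBundle (𝓡 d) ∞ (EuclideanSpace ℝ (Fin d))
    (fun x : X => TangentSpace (𝓡 d) x)]

theorem IsTestField.hasCompactSupport_divergence {V : (x : X) → TangentSpace (𝓡 d) x}
    (hV : IsTestField V) : HasCompactSupport (divergence (d := d) V) := by
  obtain ⟨-, K, hK, h0⟩ := hV
  refine HasCompactSupport.intro hK fun x hx => ?_
  rw [divergence_congr (W := fun y => (0 : TangentSpace (𝓡 d) y))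
    ((hK.isClosed.isOpen_compl.eventually_mem hx).mono fun y hy => h0 y hy)]
  exact divergence_zero x

/-- The defining identity of the weak gradient for the field `f ∇g`. -/
theorem IsWeakGradient.integral_add_eq_zero {m : Measure X} {r : X → ℝ}
    {v : (x : X) → TangentSpace (𝓡 d) x} (h : IsWeakGradient m r v) {f g : X → ℝ}
    (hf : ContMDiff (𝓡 d) 𝓘(ℝ, ℝ) ∞ f) (hg : ContMDiff (𝓡 d) 𝓘(ℝ, ℝ) ∞ g) {K : Set X}
    (hK : IsCompact K) (hgK : ∀ x ∉ K, grad (d := d) g x = 0) :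
    ∫ x, (r x * divergence (d := d) (fun y => f y • grad g y) x +
      f x * inner ℝ (grad g x) (v x)) ∂m = 0 := by
  have hV := isTestField_smul_grad (d := d) hf hg hK hgK
  have h1 : Integrable (fun x => r x * divergence (d := d) (fun y => f y • grad g y) x) m := by
    simpa [smul_eq_mul, mul_comm] using
      h.locallyIntegrable.integrable_smul_left_of_hasCompactSupport
        (continuous_divergence fun x => hV.1 x) hV.hasCompactSupport_divergence
  have hVn : Continuous fun x => ‖f x • grad (d := d) g x‖ :=
    continuous_tangentBundle_norm.comp hV.1.continuous
  have hVc : HasCompactSupport fun x => ‖f x • grad (d := d) g x‖ :=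
    HasCompactSupport.intro hK fun x hx => by rw [hgK x hx, smul_zero, norm_zero]
  have h2 : Integrable (fun x => f x * (inner ℝ (grad g x) (v x) : ℝ)) m := by
    refine Integrable.mono' (h.locallyIntegrable_norm.integrable_smul_left_of_hasCompactSupport
      hVn hVc) ?_ (Eventually.of_forall fun x => ?_)
    · let : MeasurableSpace (TangentBundle (𝓡 d) X) := borel _
      have : BorelSpace (TangentBundle (𝓡 d) X) := ⟨rfl⟩
      exact hf.continuous.aestronglyMeasurable.mul
        ((continuous_tangentBundle_inner_grad hg).measurable.comp_aemeasurable
          h.aemeasurable).aestronglyMeasurable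
    · rw [← real_inner_smul_left]
      exact abs_real_inner_le_norm _ _
  rw [integral_add h1 h2, h.integral_eq _ hV, neg_add_eq_zero]
  refine integral_congr_ae (Eventually.of_forall fun x => ?_)
  simp only [real_inner_smul_right]
  rw [real_inner_comm]

end Riem

/-! ### Integrability of the drift and integration by parts. -/

namespace Config

theorem lintegral_lt_top_of_sq {α : Type*} [MeasurableSpace α] {μ : Measure α} [IsFiniteMeasure μ]
    {b : α → ℝ≥0∞} (hb : ∫⁻ a, b a ^ 2 ∂μ < ⊤) : ∫⁻ a, b a ∂μ < ⊤ := by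
  have h : ∀ a, b a ≤ 1 + b a ^ 2 := fun a => by
    rcases le_total (b a) 1 with h | h
    · exact h.trans le_self_add
    · refine le_trans ?_ le_add_self
      rw [sq]
      exact le_mul_of_one_le_left' h
  refine (lintegral_mono h).trans_lt ?_
  rw [lintegral_add_left measurable_const]
  simpa using hb

theorem tsum_enorm_le_of_support {X : Type*} [TopologicalSpace X] (γ : Config X) {Λ : Set X}
    {f : X → ℝ} {b : X → ℝ≥0∞} {c : ℝ≥0∞} (hf : ∀ x ∉ Λ, f x = 0) (hb : ∀ x, ‖f x‖ₑ ≤ c * b x) :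
    ∑' x : γ.carrier, ‖f x‖ₑ ≤ c * ∑' x : (γ.carrier ∩ Λ : Set X), b x := by
  rw [tsum_subtype γ.carrier fun x => ‖f x‖ₑ, tsum_subtype (γ.carrier ∩ Λ) b,
    ← ENNReal.tsum_mul_left]
  refine ENNReal.tsum_le_tsum fun x => ?_
  by_cases hx : x ∈ γ.carrier
  · by_cases hΛ : x ∈ Λ
    · rw [indicator_of_mem hx, indicator_of_mem (show x ∈ γ.carrier ∩ Λ from ⟨hx, hΛ⟩)]
      exact hb x
    · rw [indicator_of_mem hx, hf x hΛ]
      simp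
  · rw [indicator_of_notMem hx]
    exact zero_le

namespace CylinderData

variable {d : ℕ} {X : Type*} [MetricSpace X] [LocallyCompactSpace X] [SecondCountableTopology X]
  [MeasurableSpace X] [BorelSpace X] [ChartedSpace (EuclideanSpace ℝ (Fin d)) X]
  [IsManifold (𝓡 d) ∞ X] [RiemannianBundle (fun x : X => TangentSpace (𝓡 d) x)]
  [IsContMDiffRiemannianBundle (𝓡 d) ∞ (EuclideanSpace ℝ (Fin d))
    (fun x : X => TangentSpace (𝓡 d) x)]
  (C : CylinderData d X) {μ : Measure (Config X)} {ρ : Config X → X → ℝ≥0}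
  {gradρ : Config X → (x : X) → TangentSpace (𝓡 d) x}

theorem measurable_inner_logDeriv (hρ : Measurable (Function.uncurry ρ))
    (hgradρ : @Measurable (Config X × X) (TangentBundle (𝓡 d) X) _ (borel _)
      fun p => ⟨p.2, gradρ p.1 p.2⟩) :
    Measurable fun p : Config X × X =>
      (inner ℝ (C.gradAt p.1 p.2) (logDeriv ρ gradρ p.1 p.2) : ℝ) := by
  have he : Measurable fun p : Config X × X => (p.1.erase p.2, p.2) :=
    measurable_erase.prodMk measurable_snd
  have hρe : Measurable fun p : Config X × X => (ρ (p.1.erase p.2) p.2 : ℝ) :=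
    (hρ.comp he).coe_nnreal_real
  have hg : ∀ i, Measurable fun p : Config X × X =>
      (inner ℝ (Riem.grad (C.φ i) p.2) (gradρ (p.1.erase p.2) p.2) : ℝ) := fun i => by
    have h := Riem.continuous_tangentBundle_inner_grad (d := d) (C.contMDiff i)
    exact (h.borel_measurable.comp hgradρ).comp he
  simp only [gradAt, logDeriv, sum_inner, real_inner_smul_left, real_inner_smul_right]
  refine Finset.measurable_sum _ fun i _ => ?_
  have hc : Measurable fun p : Config X × X => partialDeriv i C.g (C.args p.1) :=
    (C.measurable_comp_args (C.boundedDerivs.partialDeriv i)).comp measurable_fst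
  exact hρe.inv.mul (hc.mul (hg i))

/-- The support of the gradient lies in a relatively compact open set, where the hypothesis on the
logarithmic derivative applies, and the gradient is uniformly bounded. -/
theorem exists_sq_integrable_bound
    (hB : ∀ Λ : Set X, IsOpen Λ → IsCompact (closure Λ) →
      ∫⁻ γ, (∑' x : (γ.carrier ∩ Λ : Set X), ‖logDeriv ρ gradρ γ x‖ₑ) ^ 2 ∂μ < ⊤) :
    ∃ b : Config X → ℝ≥0∞, ∫⁻ γ, b γ ^ 2 ∂μ < ⊤ ∧ ∀ γ : Config X,
      ∑' x : γ.carrier, ‖(inner ℝ (C.gradAt γ x) (logDeriv ρ gradρ γ x) : ℝ)‖ₑ ≤ b γ := by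
  obtain ⟨Λ, hΛ, hKΛ, hΛc⟩ := exists_isOpen_superset_and_isCompact_closure C.isCompact_supp
  obtain ⟨D, hD0, hD⟩ := C.exists_bound_gradAt
  refine ⟨fun γ => ENNReal.ofReal D *
    ∑' x : (γ.carrier ∩ Λ : Set X), ‖logDeriv ρ gradρ γ x‖ₑ, ?_, fun γ => ?_⟩
  · simp_rw [mul_pow]
    rw [lintegral_const_mul' _ _ (by finiteness)]
    exact ENNReal.mul_lt_top (by finiteness) (hB Λ hΛ hΛc)
  · refine tsum_enorm_le_of_support γ
      (f := fun x => (inner ℝ (C.gradAt γ x) (logDeriv ρ gradρ γ x) : ℝ))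
      (b := fun x => ‖logDeriv ρ gradρ γ x‖ₑ) (fun x hx => ?_) fun x => ?_
    · simp only [C.gradAt_eq_zero γ fun h => hx (hKΛ h), inner_zero_left]
    · rw [Real.enorm_eq_ofReal_abs, ← ofReal_norm, ← ENNReal.ofReal_mul hD0]
      refine ENNReal.ofReal_le_ofReal ((abs_real_inner_le_norm _ _).trans ?_)
      gcongr
      exact hD γ x

theorem memLp_val [IsFiniteMeasure μ] : MemLp C.val 2 μ := by
  obtain ⟨D, -, hD⟩ := C.exists_bound_val
  exact MemLp.of_bound C.measurable_val.aestronglyMeasurable D (Eventually.of_forall hD)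

theorem memLp_laplacianΓ (hμ : HasAllMoments μ) : MemLp (laplacianΓ d C.val) 2 μ := by
  rw [funext C.laplacianΓ_val]
  exact C.isBoundedOn_laplacianAt.memLp_tsum C.isCompact_supp hμ

theorem memLp_innerΓ (D : CylinderData d X) (hμ : HasAllMoments μ) :
    MemLp (innerΓ (d := d) (gradΓ C.val) (gradΓ D.val)) 2 μ := by
  rw [funext (C.innerΓ_val D)]
  exact (C.isBoundedOn_inner_gradAt D).memLp_tsum C.isCompact_supp hμ

theorem memLp_innerΓ_logDeriv (hρ : Measurable (Function.uncurry ρ))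
    (hgradρ : @Measurable (Config X × X) (TangentBundle (𝓡 d) X) _ (borel _)
      fun p => ⟨p.2, gradρ p.1 p.2⟩)
    (hB : ∀ Λ : Set X, IsOpen Λ → IsCompact (closure Λ) →
      ∫⁻ γ, (∑' x : (γ.carrier ∩ Λ : Set X), ‖logDeriv ρ gradρ γ x‖ₑ) ^ 2 ∂μ < ⊤) :
    MemLp (innerΓ (d := d) (gradΓ C.val) (logDeriv ρ gradρ)) 2 μ := by
  obtain ⟨b, hb, hle⟩ := C.exists_sq_integrable_bound hB
  have h0 : ∀ γ, ∀ x ∉ C.supp, (inner ℝ (C.gradAt γ x) (logDeriv ρ gradρ γ x) : ℝ) = 0 :=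
    fun γ x hx => by rw [C.gradAt_eq_zero γ hx, inner_zero_left]
  rw [funext (C.innerΓ_val_left (logDeriv ρ gradρ))]
  exact memLp_two_of_enorm_le (measurable_tsum_carrier (C.measurable_inner_logDeriv hρ hgradρ)
    C.isCompact_supp h0).aestronglyMeasurable hb fun γ =>
      (enorm_tsum_carrier_le γ C.isCompact_supp (h0 γ)).trans (hle γ)

theorem memLp_hamiltonian (hμ : HasAllMoments μ) (hρ : Measurable (Function.uncurry ρ))
    (hgradρ : @Measurable (Config X × X) (TangentBundle (𝓡 d) X) _ (borel _)
      fun p => ⟨p.2, gradρ p.1 p.2⟩)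
    (hB : ∀ Λ : Set X, IsOpen Λ → IsCompact (closure Λ) →
      ∫⁻ γ, (∑' x : (γ.carrier ∩ Λ : Set X), ‖logDeriv ρ gradρ γ x‖ₑ) ^ 2 ∂μ < ⊤) :
    MemLp (hamiltonian (logDeriv ρ gradρ) C.val) 2 μ :=
  (C.memLp_laplacianΓ hμ).neg.sub (C.memLp_innerΓ_logDeriv hρ hgradρ hB)

/-- The bounded part `⟨∇F₁, ∇F₂⟩ + F₂ ΔF₁` of the divergence of `F₂ ∇F₁`. -/
def boundedPart (D : CylinderData d X) (p : Config X × X) : ℝ :=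
  inner ℝ (C.gradAt p.1 p.2) (D.gradAt p.1 p.2) + D.val p.1 * C.laplacianAt p.1 p.2

/-- The divergence of `F₂ ∇F₁` with respect to `μ`, in the direction of one point. -/
def divergenceAt (D : CylinderData d X) (ρ : Config X → X → ℝ≥0)
    (gradρ : Config X → (x : X) → TangentSpace (𝓡 d) x) (p : Config X × X) : ℝ :=
  C.boundedPart D p + D.val p.1 * inner ℝ (C.gradAt p.1 p.2) (logDeriv ρ gradρ p.1 p.2)

theorem isBoundedOn_boundedPart (D : CylinderData d X) :
    IsBoundedOn C.supp (C.boundedPart D) :=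
  (C.isBoundedOn_inner_gradAt D).add
    (C.isBoundedOn_laplacianAt.mul_left D.measurable_val D.exists_bound_val)

/-- For `x ∉ γ`, adding `x` and erasing it again returns `γ`, and `ρ` cancels in `ρ · ∇ρ/ρ` where it
is positive. The integrand is thus `ρ div V + ⟨∇ρ, V⟩` with `V = F₂ ∇F₁` along the added point, and
the weak gradient identity annihilates its integral. -/
theorem integral_divergenceAt_eq_zero (D : CylinderData d X) {m : Measure X} {γ : Config X}
    (hγ : ∀ᵐ x ∂m, x ∉ γ.carrier) (hpos : ∀ᵐ x ∂m, 0 < ρ γ x)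
    (hweak : Riem.IsWeakGradient m (fun x => (ρ γ x : ℝ)) (gradρ γ)) :
    ∫ x, (ρ γ x : ℝ) * C.divergenceAt D ρ gradρ (γ.add x, x) ∂m = 0 := by
  have hK : ∀ x ∉ C.supp, Riem.grad (d := d) (C.sect γ) x = 0 := by
    intro x hx
    refine (Riem.grad_comp (C.contDiff_shift γ) C.contMDiff x).trans ?_
    exact Finset.sum_eq_zero fun i _ => by
      rw [Riem.grad_eq_zero_of_notMem_tsupport (C.notMem_tsupport hx i), smul_zero]
  rw [← hweak.integral_add_eq_zero (D.contMDiff_sect γ) (C.contMDiff_sect γ) C.isCompact_supp hK]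
  refine integral_congr_ae ?_
  filter_upwards [hγ, hpos] with x hx hρx
  have hρ0 : (ρ γ x : ℝ) ≠ 0 := (NNReal.coe_pos.2 hρx).ne'
  rw [Riem.divergence_smul (D.contMDiff_sect γ x) (Riem.isSmoothFieldAt_grad (C.contMDiff_sect γ) x)]
  change _ = (ρ γ x : ℝ) * (D.sect γ x * Riem.laplacian (d := d) (C.sect γ) x + _) + _
  rw [C.grad_sect hx, D.grad_sect hx, C.laplacian_sect hx, ← D.val_add hx, divergenceAt,
    boundedPart, logDeriv]
  simp only [add_erase_self hx, real_inner_smul_right]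
  rw [real_inner_comm (C.gradAt (γ.add x) x)]
  field_simp
  ring

/-- The summands of the divergence vanish if the tangent spaces are trivial. -/
theorem divergenceAt_of_isEmpty [IsEmpty (Fin d)] (D : CylinderData d X) (p : Config X × X) :
    C.divergenceAt D ρ gradρ p = 0 := by
  have : Subsingleton (TangentSpace (𝓡 d) p.2) :=
    inferInstanceAs (Subsingleton (EuclideanSpace ℝ (Fin d)))
  have h : C.gradAt p.1 p.2 = 0 := Subsingleton.elim _ _
  have hl : C.laplacianAt p.1 p.2 = 0 := by
    refine Finset.sum_eq_zero fun i _ => ?_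
    have h1 : ∀ j, Riem.grad (d := d) (C.φ j) p.2 = 0 := fun j => Subsingleton.elim _ _
    have h2 : Riem.laplacian (d := d) (C.φ i) p.2 = 0 := by
      simp [Riem.laplacian, Riem.divergence]
    simp [h1, h2]
  simp [divergenceAt, boundedPart, h, hl]

/-- The Mecke identity rewrites the sum over points as an integral over added points, whose inner
integral vanishes for almost every `γ`. -/
theorem integral_tsum_divergenceAt [IsFiniteMeasure μ] [Nonempty X] (D : CylinderData d X)
    (hμ : HasAllMoments μ) {σ : Kernel (Config X) X} (hMecke : MeckeIdentity μ σ)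
    (hρ : Measurable (Function.uncurry ρ))
    (hσρ : ∀ᵐ γ ∂μ, σ γ = (Riem.vol d X).withDensity fun x => (ρ γ x : ℝ≥0∞))
    (hρpos : ∀ᵐ p ∂(μ.prod (Riem.vol d X)), 0 < ρ p.1 p.2)
    (hgradρ : @Measurable (Config X × X) (TangentBundle (𝓡 d) X) _ (borel _)
      fun p => ⟨p.2, gradρ p.1 p.2⟩)
    (hweak : ∀ᵐ γ ∂μ, Riem.IsWeakGradient (Riem.vol d X) (fun x => (ρ γ x : ℝ)) (gradρ γ))
    (hB : ∀ Λ : Set X, IsOpen Λ → IsCompact (closure Λ) →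
      ∫⁻ γ, (∑' x : (γ.carrier ∩ Λ : Set X), ‖logDeriv ρ gradρ γ x‖ₑ) ^ 2 ∂μ < ⊤) :
    ∫ γ, ∑' x : γ.carrier, C.divergenceAt D ρ gradρ (γ, x) ∂μ = 0 := by
  -- In dimension zero points may carry mass, so `x ∉ γ` need not hold almost everywhere; there,
  -- however, all summands vanish.
  rcases isEmpty_or_nonempty (Fin d) with hd | hd
  · simp [C.divergenceAt_of_isEmpty D]
  have hbp := C.isBoundedOn_boundedPart D
  rw [integral_tsum_carrier hMecke hρ hσρ
    (G := C.divergenceAt D ρ gradρ) (hbp.measurable.add ((D.measurable_val.comp measurable_fst).mul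
      (C.measurable_inner_logDeriv hρ hgradρ))) C.isCompact_supp (fun γ x hx => by
        rw [divergenceAt, hbp.eq_zero γ x hx, C.gradAt_eq_zero γ hx, inner_zero_left, mul_zero,
          add_zero])]
  · refine integral_eq_zero_of_ae ?_
    filter_upwards [hweak, Measure.ae_ae_of_ae_prod hρpos] with γ h1 h2
    refine C.integral_divergenceAt_eq_zero D ?_ h2 h1
    exact measure_eq_zero_iff_ae_notMem.1 (Riem.vol_countable γ.countable_carrier)
  · obtain ⟨b, hb, hle⟩ := C.exists_sq_integrable_bound hB
    obtain ⟨χ, hχ, hχle⟩ := hbp.exists_abs_tsum_le C.isCompact_supp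
    obtain ⟨M, hM0, hM⟩ := D.exists_bound_val
    have h1 := lintegral_lt_top_of_sq (hμ.lintegral_pair_sq_lt_top hχ)
    have h2 := lintegral_lt_top_of_sq hb
    refine lt_of_le_of_lt (lintegral_mono (g := fun γ =>
      ENNReal.ofReal (pair χ γ) + ENNReal.ofReal M * b γ) fun γ => ?_) ?_
    · refine (ENNReal.tsum_le_tsum fun x => enorm_add_le _ _).trans ?_
      rw [ENNReal.tsum_add]
      refine add_le_add (hχle γ) ?_
      simp_rw [enorm_mul]
      rw [ENNReal.tsum_mul_left]
      refine mul_le_mul' ?_ (hle γ)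
      rw [Real.enorm_eq_ofReal_abs]
      exact ENNReal.ofReal_le_ofReal (hM γ)
    · rw [lintegral_add_left (measurable_pair χ).ennreal_ofReal,
        lintegral_const_mul' _ _ ENNReal.ofReal_ne_top]
      exact ENNReal.add_lt_top.2 ⟨h1, ENNReal.mul_lt_top ENNReal.ofReal_lt_top h2⟩

/-- Integration by parts. -/
theorem energy_eq_integral_hamiltonian [IsFiniteMeasure μ] [Nonempty X] (D : CylinderData d X)
    (hμ : HasAllMoments μ) {σ : Kernel (Config X) X} (hMecke : MeckeIdentity μ σ)
    (hρ : Measurable (Function.uncurry ρ))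
    (hσρ : ∀ᵐ γ ∂μ, σ γ = (Riem.vol d X).withDensity fun x => (ρ γ x : ℝ≥0∞))
    (hρpos : ∀ᵐ p ∂(μ.prod (Riem.vol d X)), 0 < ρ p.1 p.2)
    (hgradρ : @Measurable (Config X × X) (TangentBundle (𝓡 d) X) _ (borel _)
      fun p => ⟨p.2, gradρ p.1 p.2⟩)
    (hweak : ∀ᵐ γ ∂μ, Riem.IsWeakGradient (Riem.vol d X) (fun x => (ρ γ x : ℝ)) (gradρ γ))
    (hB : ∀ Λ : Set X, IsOpen Λ → IsCompact (closure Λ) →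
      ∫⁻ γ, (∑' x : (γ.carrier ∩ Λ : Set X), ‖logDeriv ρ gradρ γ x‖ₑ) ^ 2 ∂μ < ⊤) :
    energy d μ C.val D.val = ∫ γ, hamiltonian (logDeriv ρ gradρ) C.val γ * D.val γ ∂μ := by
  have h0 := C.integral_tsum_divergenceAt D hμ hMecke hρ hσρ hρpos hgradρ hweak hB
  have hI : Integrable (innerΓ (d := d) (gradΓ C.val) (gradΓ D.val)) μ :=
    (C.memLp_innerΓ D hμ).integrable one_le_two
  have hH : Integrable (fun γ => hamiltonian (logDeriv ρ gradρ) C.val γ * D.val γ) μ :=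
    (C.memLp_hamiltonian hμ hρ hgradρ hB).integrable_mul D.memLp_val
  -- Pointwise in `γ`, all four series are finite sums over the points of `γ` in one compact set, so
  -- they may be split and recombined freely.
  have h1 : ∀ γ, ∑' x : γ.carrier, C.divergenceAt D ρ gradρ (γ, x) =
      innerΓ (d := d) (gradΓ C.val) (gradΓ D.val) γ -
        hamiltonian (logDeriv ρ gradρ) C.val γ * D.val γ := by
    intro γ
    have hG := fun x hx => C.gradAt_eq_zero γ (x := x) hx
    rw [hamiltonian, C.innerΓ_val D, C.laplacianΓ_val, C.innerΓ_val_left,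
      tsum_eq_sum_finsetIn γ C.isCompact_supp (f := fun x => C.divergenceAt D ρ gradρ (γ, x)),
      tsum_eq_sum_finsetIn γ C.isCompact_supp
        (f := fun x => (inner ℝ (C.gradAt γ x) (D.gradAt γ x) : ℝ)),
      tsum_eq_sum_finsetIn γ C.isCompact_supp (f := C.laplacianAt γ),
      tsum_eq_sum_finsetIn γ C.isCompact_supp
        (f := fun x => (inner ℝ (C.gradAt γ x) (logDeriv ρ gradρ γ x) : ℝ))]
    · simp only [divergenceAt, boundedPart, Finset.sum_add_distrib, ← Finset.mul_sum]
      ring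
    · exact fun x hx => by rw [hG x hx, inner_zero_left]
    · exact C.isBoundedOn_laplacianAt.eq_zero γ
    · exact fun x hx => by rw [hG x hx, inner_zero_left]
    · exact fun x hx => by
        rw [divergenceAt, (C.isBoundedOn_boundedPart D).eq_zero γ x hx, hG x hx, inner_zero_left,
          mul_zero, add_zero]
  rw [integral_congr_ae (Eventually.of_forall h1), integral_sub hI hH, sub_eq_zero] at h0
  exact h0

end CylinderData

end Config

/-! ### Totality of cylinder functions in `L²(μ)`. -/

namespace Config

variable {d : ℕ} {X : Type*} [MetricSpace X] [LocallyCompactSpace X] [SecondCountableTopology X]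
  [MeasurableSpace X] [BorelSpace X] [ChartedSpace (EuclideanSpace ℝ (Fin d)) X]
  [IsManifold (𝓡 d) ∞ X]

/-- Uniform smooth approximations supported inside the support of `f` suffice, as only finitely many
points of `γ` contribute. -/
theorem exists_smooth_tendsto_pair (d : ℕ) [ChartedSpace (EuclideanSpace ℝ (Fin d)) X]
    [IsManifold (𝓡 d) ∞ X] (f : C_c(X, ℝ)) :
    ∃ φ : ℕ → X → ℝ, (∀ n, ContMDiff (𝓡 d) 𝓘(ℝ, ℝ) ∞ (φ n) ∧ HasCompactSupport (φ n)) ∧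
      ∀ γ, Tendsto (fun n => pair (φ n) γ) atTop (𝓝 (pair f γ)) := by
  have h : ∀ n : ℕ, ∃ φ : X → ℝ, ContMDiff (𝓡 d) 𝓘(ℝ, ℝ) ∞ φ ∧
      (∀ x, dist (φ x) (f x) < 1 / ((n : ℝ) + 1)) ∧ Function.support φ ⊆ Function.support f := by
    intro n
    obtain ⟨g, hg, hs⟩ := f.continuous.exists_contMDiff_approx (𝓡 d) ⊤
      (ε := fun _ => 1 / ((n : ℝ) + 1)) continuous_const fun _ => by positivity
    exact ⟨g, g.contMDiff, hg, hs⟩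
  choose φ hφ hd hs using h
  have hcs : ∀ n, HasCompactSupport (φ n) := fun n =>
    f.hasCompactSupport.mono (hs n)
  refine ⟨φ, fun n => ⟨hφ n, hcs n⟩, fun γ => ?_⟩
  have hK : IsCompact (tsupport f) := f.hasCompactSupport
  have h0 : ∀ x ∉ tsupport f, f x = 0 := eq_zero_of_notMem_tsupport
  rw [pair_eq_sum γ hK h0]
  simp_rw [fun n => pair_eq_sum γ hK (f := φ n) fun x hx => by
    by_contra h
    exact hx (subset_tsupport _ (hs n h))]
  refine tendsto_finsetSum _ fun x _ => ?_
  rw [tendsto_iff_dist_tendsto_zero]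
  exact squeeze_zero (fun _ => dist_nonneg) (fun n => (hd n x).le)
    tendsto_one_div_add_atTop_nhds_zero_nat

/-- The Borel `σ`-algebra is generated by the functions `⟨φ, γ⟩` with `φ` smooth and compactly
supported. -/
theorem borel_eq_generateFrom_pair (d : ℕ) [ChartedSpace (EuclideanSpace ℝ (Fin d)) X]
    [IsManifold (𝓡 d) ∞ X] : borel (Config X) =
    MeasurableSpace.generateFrom {s | ∃ (φ : X → ℝ) (a : ℝ), ContMDiff (𝓡 d) 𝓘(ℝ, ℝ) ∞ φ ∧
      HasCompactSupport φ ∧ s = {γ : Config X | a < pair φ γ}} := by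
  refine le_antisymm ?_ (MeasurableSpace.generateFrom_le ?_)
  · rw [borel_eq_comap]
    refine measurable_iff_comap_le.1 (@measurable_pi_lambda _ _ _ (.generateFrom _) _ _ fun i => ?_)
    obtain ⟨φ, hφ, hlim⟩ := exists_smooth_tendsto_pair d (basicFun X i)
    refine @measurable_of_tendsto_metrizable _ _ (.generateFrom _) _ _ _ _ _ _
      (fun n => ?_) (tendsto_pi_nhds.2 hlim)
    exact @measurable_of_Ioi _ _ _ _ _ (.generateFrom _) _ _ _ _ fun a =>
      MeasurableSpace.measurableSet_generateFrom ⟨φ n, a, (hφ n).1, (hφ n).2, rfl⟩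
  · rintro _ ⟨φ, a, hφ, hφ', rfl⟩
    exact measurableSet_lt measurable_const
      (continuous_pair_of_hasCompactSupport hφ.continuous hφ').measurable

variable [RiemannianBundle (fun x : X => TangentSpace (𝓡 d) x)]
  [IsContMDiffRiemannianBundle (𝓡 d) ∞ (EuclideanSpace ℝ (Fin d))
    (fun x : X => TangentSpace (𝓡 d) x)]

theorem IsCylinder.measurable {F : Config X → ℝ} (hF : IsCylinder d F) : Measurable F := by
  obtain ⟨C, rfl⟩ := hF.exists_data
  exact C.measurable_val

variable (d) in
/-- Sets whose indicator is a pointwise limit of cylinder functions with values in `[0, 1]`. -/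
def IsCylinderLimit (s : Set (Config X)) : Prop :=
  ∃ F : ℕ → Config X → ℝ, (∀ n, IsCylinder d (F n)) ∧ (∀ n γ, 0 ≤ F n γ ∧ F n γ ≤ 1) ∧
    ∀ γ, Tendsto (fun n => F n γ) atTop (𝓝 (s.indicator 1 γ))

theorem IsCylinderLimit.inter {s t : Set (Config X)} (hs : IsCylinderLimit d s)
    (ht : IsCylinderLimit d t) : IsCylinderLimit d (s ∩ t) := by
  obtain ⟨F, hF, hF1, hFs⟩ := hs
  obtain ⟨G, hG, hG1, hGt⟩ := ht
  refine ⟨fun n γ => F n γ * G n γ, fun n => (hF n).mul (hG n), fun n γ =>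
    ⟨mul_nonneg (hF1 n γ).1 (hG1 n γ).1, mul_le_one₀ (hF1 n γ).2 (hG1 n γ).1 (hG1 n γ).2⟩,
    fun γ => ?_⟩
  rw [inter_indicator_one]
  exact (hFs γ).mul (hGt γ)

theorem IsCylinderLimit.measurableSet {s : Set (Config X)} (hs : IsCylinderLimit d s) :
    MeasurableSet s := by
  obtain ⟨F, hF, -, hFs⟩ := hs
  have h := measurable_of_tendsto_metrizable (fun n => (hF n).measurable) (tendsto_pi_nhds.2 hFs)
  have h2 := h (measurableSet_singleton 1)
  convert h2 using 1
  ext γ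
  by_cases hγ : γ ∈ s <;> simp [hγ]

/-- As a function of `t = ⟨φ, γ⟩`, the transition function of `n (t - a)` vanishes for `t ≤ a` and
equals one from `t = a + 1/n` on. -/
theorem isCylinderLimit_setOf_lt_pair {φ : X → ℝ} (hφ : ContMDiff (𝓡 d) 𝓘(ℝ, ℝ) ∞ φ)
    (hφ' : HasCompactSupport φ) (a : ℝ) : IsCylinderLimit d {γ : Config X | a < pair φ γ} := by
  refine ⟨fun n γ => Real.smoothTransition (n * pair φ γ + -(n * a)), fun n => ?_, fun n γ =>
    ⟨Real.smoothTransition.nonneg _, Real.smoothTransition.le_one _⟩, fun γ => ?_⟩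
  · exact IsCylinder.comp_pair hφ hφ' (g := fun t => Real.smoothTransition (n * t + -(n * a)))
      ((BoundedDerivs.smoothTransition.comp_add_const (-(n * a))).comp_clm
        ((n : ℝ) • ContinuousLinearMap.id ℝ ℝ))
  · by_cases hγ : a < pair φ γ
    · rw [indicator_of_mem (show γ ∈ {γ : Config X | a < pair φ γ} from hγ)]
      refine tendsto_const_nhds.congr' ?_
      obtain ⟨N, hN⟩ := exists_nat_gt (1 / (pair φ γ - a))
      filter_upwards [eventually_ge_atTop N] with n hn
      rw [Real.smoothTransition.one_of_one_le]
      · rfl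
      have h1 : (N : ℝ) ≤ n := by exact_mod_cast hn
      have h2 : 0 < pair φ γ - a := sub_pos.2 hγ
      rw [div_lt_iff₀ h2] at hN
      nlinarith
    · rw [indicator_of_notMem (show γ ∉ {γ : Config X | a < pair φ γ} from hγ)]
      refine tendsto_const_nhds.congr fun n => ?_
      refine (Real.smoothTransition.zero_of_nonpos ?_).symm
      have h2 := not_lt.1 hγ
      have h3 : (0 : ℝ) ≤ n := n.cast_nonneg
      nlinarith

/-- An integrable function orthogonal to all cylinder functions vanishes. -/
theorem ae_eq_zero_of_forall_integral_cylinder {μ : Measure (Config X)} {h : Config X → ℝ}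
    (hh : Integrable h μ) (h0 : ∀ F, IsCylinder d F → ∫ γ, F γ * h γ ∂μ = 0) : h =ᵐ[μ] 0 := by
  have hpi : IsPiSystem {s : Set (Config X) | IsCylinderLimit d s} := fun s hs t ht _ => hs.inter ht
  have hgen : borel (Config X) = MeasurableSpace.generateFrom {s | IsCylinderLimit d s} := by
    refine le_antisymm ?_ (MeasurableSpace.generateFrom_le fun s hs => hs.measurableSet)
    rw [borel_eq_generateFrom_pair d]
    refine MeasurableSpace.generateFrom_mono ?_
    rintro _ ⟨φ, a, hφ, hφ', rfl⟩
    exact isCylinderLimit_setOf_lt_pair hφ hφ' a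
  -- The constant one is a cylinder function; this total integral handles complements in the π-λ
  -- induction.
  have huniv : ∫ γ, h γ ∂μ = 0 := by simpa using h0 _ (IsCylinder.const 1)
  refine hh.ae_eq_zero_of_forall_setIntegral_eq_zero fun s hs hlt => ?_
  clear hlt
  induction s, hs using MeasurableSpace.induction_on_inter hgen hpi with
  | empty => simp
  | basic s hs =>
    obtain ⟨F, hF, hF1, hFs⟩ := id hs
    rw [← integral_indicator hs.measurableSet]
    have h1 : Tendsto (fun n => ∫ γ, F n γ * h γ ∂μ) atTop (𝓝 (∫ γ, s.indicator h γ ∂μ)) := by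
      refine tendsto_integral_of_dominated_convergence (fun γ => ‖h γ‖)
        (fun n => (hF n).measurable.aestronglyMeasurable.mul hh.aestronglyMeasurable) hh.norm
        (fun n => Eventually.of_forall fun γ => ?_) (Eventually.of_forall fun γ => ?_)
      · rw [norm_mul, Real.norm_of_nonneg (hF1 n γ).1]
        exact mul_le_of_le_one_left (norm_nonneg _) (hF1 n γ).2
      · have h2 := (hFs γ).mul_const (h γ)
        by_cases hγ : γ ∈ s <;> simpa [hγ] using h2
    simp_rw [fun n => h0 _ (hF n)] at h1
    exact (tendsto_nhds_unique h1 tendsto_const_nhds)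
  | compl s hs ih =>
    have h1 := integral_add_compl hs hh
    rw [ih, huniv, zero_add] at h1
    exact h1
  | iUnion f hd hf ih =>
    rw [integral_iUnion hf hd hh.integrableOn]
    simp only [ih, tsum_zero]

end Config

/-! ### From a symmetric operation on functions to an operator in `L²`. -/

theorem inner_eq_integral_mul {α : Type*} [MeasurableSpace α] {μ : Measure α} {u v : Lp ℝ 2 μ}
    {f g : α → ℝ} (hf : u =ᵐ[μ] f) (hg : v =ᵐ[μ] g) : inner ℝ u v = ∫ a, f a * g a ∂μ := by
  rw [L2.inner_def]
  refine integral_congr_ae ?_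
  filter_upwards [hf, hg] with a h1 h2
  rw [h1, h2]
  exact mul_comm _ _

/-- An operator on a class of functions which is symmetric with respect to the `L²` pairing and
whose domain is total induces a densely defined operator in `L²`. -/
theorem exists_linearPMap_of_symmetric {α : Type*} [MeasurableSpace α] {μ : Measure α}
    {P : (α → ℝ) → Prop} (h0 : P fun _ => 0) (hadd : ∀ {F G}, P F → P G → P fun a => F a + G a)
    (hmul : ∀ (c : ℝ) {F}, P F → P fun a => c * F a) (hP : ∀ F, P F → MemLp F 2 μ)
    {K : (α → ℝ) → α → ℝ} (hK : ∀ F, P F → MemLp (K F) 2 μ)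
    (hsymm : ∀ F G, P F → P G → ∫ a, K F a * G a ∂μ = ∫ a, F a * K G a ∂μ)
    (htotal : ∀ h, MemLp h 2 μ → (∀ F, P F → ∫ a, F a * h a ∂μ = 0) → h =ᵐ[μ] 0) :
    ∃ T : Lp ℝ 2 μ →ₗ.[ℝ] Lp ℝ 2 μ, Dense (T.domain : Set (Lp ℝ 2 μ)) ∧
      (∀ u, u ∈ T.domain ↔ ∃ F, P F ∧ u =ᵐ[μ] F) ∧
      ∀ (u : T.domain) (F : α → ℝ), P F → (u : Lp ℝ 2 μ) =ᵐ[μ] F → T u =ᵐ[μ] K F := by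
  let D : Submodule ℝ (Lp ℝ 2 μ) :=
    { carrier := {u | ∃ F, P F ∧ u =ᵐ[μ] F}
      zero_mem' := ⟨_, h0, Lp.coeFn_zero _ _ _⟩
      add_mem' := by
        rintro u v ⟨F, hF, hu⟩ ⟨G, hG, hv⟩
        exact ⟨_, hadd hF hG, (Lp.coeFn_add u v).trans (hu.add hv)⟩
      smul_mem' := by
        rintro c u ⟨F, hF, hu⟩
        exact ⟨_, hmul c hF, (Lp.coeFn_smul c u).trans (hu.const_smul c)⟩ }
  have hD : ∀ u : D, ∃ F, P F ∧ (u : Lp ℝ 2 μ) =ᵐ[μ] F := fun u => u.2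
  have hdense : Dense (D : Set (Lp ℝ 2 μ)) := by
    rw [Submodule.dense_iff_topologicalClosure_eq_top, ← Submodule.orthogonal_eq_bot_iff,
      Submodule.orthogonal_closure, Submodule.eq_bot_iff]
    intro h hh
    refine Lp.eq_zero_iff_ae_eq_zero.2 (htotal h (Lp.memLp h) fun F hF => ?_)
    rw [← inner_eq_integral_mul (hP F hF).coeFn_toLp (ae_eq_refl _)]
    exact (Submodule.mem_orthogonal _ _).1 hh _ ⟨F, hF, (hP F hF).coeFn_toLp⟩
  -- Each class gets an arbitrary representative; independence of this choice is recovered below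
  -- from symmetry and density.
  choose F hF hu using hD
  let T₀ : D → Lp ℝ 2 μ := fun u => (hK _ (hF u)).toLp _
  have hT : ∀ u v : D, inner ℝ (T₀ u) (v : Lp ℝ 2 μ) = inner ℝ (u : Lp ℝ 2 μ) (T₀ v) := by
    intro u v
    rw [inner_eq_integral_mul (hK _ (hF u)).coeFn_toLp (hu v),
      inner_eq_integral_mul (hu u) (hK _ (hF v)).coeFn_toLp, hsymm _ _ (hF u) (hF v)]
  have hext : ∀ x y : Lp ℝ 2 μ, (∀ w : D, inner ℝ x (w : Lp ℝ 2 μ) = inner ℝ y (w : Lp ℝ 2 μ)) →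
      x = y := fun x y h => hdense.eq_of_inner_left ℝ fun w hw => h ⟨w, hw⟩
  -- No linearity of `K` enters: `(T₀ u, w) = (u, T₀ w)` is linear in `u`, and the dense domain
  -- separates vectors.
  let T : D →ₗ[ℝ] Lp ℝ 2 μ :=
    { toFun := T₀
      map_add' := fun u v => hext _ _ fun w => by
        rw [inner_add_left, hT, hT, hT, ← inner_add_left]; rfl
      map_smul' := fun c u => hext _ _ fun w => by
        rw [RingHom.id_apply, real_inner_smul_left, hT, hT, ← real_inner_smul_left]; rfl }
  refine ⟨⟨D, T⟩, hdense, fun u => Iff.rfl, fun u G hG huG => ?_⟩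
  have h : T₀ u = (hK G hG).toLp _ := hext _ _ fun w => by
    rw [inner_eq_integral_mul (hK _ (hF u)).coeFn_toLp (hu w),
      inner_eq_integral_mul (hK _ hG).coeFn_toLp (hu w), hsymm _ _ (hF u) (hF w),
      hsymm _ _ hG (hF w)]
    refine integral_congr_ae ?_
    filter_upwards [hu u, huG] with a h1 h2
    rw [← h1, ← h2]
  change T₀ u =ᵐ[μ] K G
  rw [h]
  exact (hK G hG).coeFn_toLp

/-! ### Assembly of the theorem. -/

namespace Config

theorem innerΓ_comm {d : ℕ} {X : Type*} [TopologicalSpace X]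
    [ChartedSpace (EuclideanSpace ℝ (Fin d)) X] [IsManifold (𝓡 d) ∞ X]
    [RiemannianBundle (fun x : X => TangentSpace (𝓡 d) x)]
    (V W : Config X → (x : X) → TangentSpace (𝓡 d) x) : innerΓ V W = innerΓ W V :=
  funext fun _ => tsum_congr fun _ => real_inner_comm _ _

end Config

theorem theorem3p1 {d : ℕ} {X : Type*} [MetricSpace X] [CompleteSpace X] [ConnectedSpace X]
    [SecondCountableTopology X] [MeasurableSpace X] [BorelSpace X]
    [ChartedSpace (EuclideanSpace ℝ (Fin d)) X] [IsManifold (𝓡 d) ∞ X]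
    [RiemannianBundle (fun x : X => TangentSpace (𝓡 d) x)]
    [IsContMDiffRiemannianBundle (𝓡 d) ∞ (EuclideanSpace ℝ (Fin d))
      (fun x : X => TangentSpace (𝓡 d) x)]
    [IsRiemannianManifold (𝓡 d) X]
    (hvol : Riem.vol d X Set.univ = ⊤)
    (μ : Measure (Config X)) [IsProbabilityMeasure μ] (hmoments : Config.HasAllMoments μ)
    (σ : Kernel (Config X) X) (hMecke : Config.MeckeIdentity μ σ)
    (ρ : Config X → X → ℝ≥0) (hρ : Measurable (Function.uncurry ρ))
    (hσρ : ∀ᵐ γ ∂μ, σ γ = (Riem.vol d X).withDensity fun x => (ρ γ x : ℝ≥0∞))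
    (hρpos : ∀ᵐ p ∂(μ.prod (Riem.vol d X)), 0 < ρ p.1 p.2)
    (gradρ : Config X → (x : X) → TangentSpace (𝓡 d) x)
    (hgradρ : @Measurable (Config X × X) (TangentBundle (𝓡 d) X) _ (borel _)
      fun p => ⟨p.2, gradρ p.1 p.2⟩)
    (hweak : ∀ᵐ γ ∂μ, Riem.IsWeakGradient (Riem.vol d X) (fun x => (ρ γ x : ℝ)) (gradρ γ))
    (hB : ∀ Λ : Set X, IsOpen Λ → IsCompact (closure Λ) →
      ∫⁻ γ, (∑' x : (γ.carrier ∩ Λ : Set X), ‖Config.logDeriv ρ gradρ γ x‖ₑ) ^ 2 ∂μ < ⊤) :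
    (∀ F : Config X → ℝ, Config.IsCylinder d F →
      MemLp F 2 μ ∧ MemLp (Config.hamiltonian (Config.logDeriv ρ gradρ) F) 2 μ) ∧
    (∀ F₁ F₂ : Config X → ℝ, Config.IsCylinder d F₁ → Config.IsCylinder d F₂ →
      Integrable (Config.innerΓ (d := d) (Config.gradΓ F₁) (Config.gradΓ F₂)) μ ∧
      Config.energy d μ F₁ F₂ =
        ∫ γ, Config.hamiltonian (Config.logDeriv ρ gradρ) F₁ γ * F₂ γ ∂μ) ∧
    ∃ (E : PartialForm (Lp ℝ 2 μ)) (T : Lp ℝ 2 μ →ₗ.[ℝ] Lp ℝ 2 μ),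
      Config.IsEnergyForm d μ E ∧ Config.IsHamiltonian μ (Config.logDeriv ρ gradρ) T ∧
      E.IsClosable ∧
      ∃ (Ebar : PartialForm (Lp ℝ 2 μ)) (A : Lp ℝ 2 μ →ₗ.[ℝ] Lp ℝ 2 μ),
        Ebar.IsClosureOf E ∧ Ebar.IsAssociatedWith A ∧
        IsSelfAdjoint A ∧ (∀ u : A.domain, 0 ≤ inner ℝ (A u) (u : Lp ℝ 2 μ)) ∧
        IsFriedrichsExtension T A := by
  have : LocallyCompactSpace X := Manifold.locallyCompact_of_finiteDimensional (𝓡 d)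
  have h1 : ∀ F : Config X → ℝ, Config.IsCylinder d F →
      MemLp F 2 μ ∧ MemLp (Config.hamiltonian (Config.logDeriv ρ gradρ) F) 2 μ := by
    intro F hF
    obtain ⟨C, rfl⟩ := hF.exists_data
    exact ⟨C.memLp_val, C.memLp_hamiltonian hmoments hρ hgradρ hB⟩
  have h2 : ∀ F₁ F₂ : Config X → ℝ, Config.IsCylinder d F₁ → Config.IsCylinder d F₂ →
      Integrable (Config.innerΓ (d := d) (Config.gradΓ F₁) (Config.gradΓ F₂)) μ ∧
      Config.energy d μ F₁ F₂ =
        ∫ γ, Config.hamiltonian (Config.logDeriv ρ gradρ) F₁ γ * F₂ γ ∂μ := by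
    intro F₁ F₂ hF₁ hF₂
    obtain ⟨C, rfl⟩ := hF₁.exists_data
    obtain ⟨D, rfl⟩ := hF₂.exists_data
    exact ⟨(C.memLp_innerΓ D hmoments).integrable one_le_two,
      C.energy_eq_integral_hamiltonian D hmoments hMecke hρ hσρ hρpos hgradρ hweak hB⟩
  obtain ⟨T, hdense, hdom, happly⟩ := exists_linearPMap_of_symmetric (μ := μ)
    (P := Config.IsCylinder d (X := X)) (Config.IsCylinder.const 0) Config.IsCylinder.add
    (fun c _ hF => hF.const_mul c) (fun F hF => (h1 F hF).1)
    (K := Config.hamiltonian (Config.logDeriv ρ gradρ)) (fun F hF => (h1 F hF).2)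
    (fun F G hF hG => by
      rw [← (h2 F G hF hG).2, Config.energy, Config.innerΓ_comm]
      refine (h2 G F hG hF).2.trans (integral_congr_ae (Eventually.of_forall fun γ => ?_))
      exact mul_comm _ _)
    (fun h hh h0 => Config.ae_eq_zero_of_forall_integral_cylinder (hh.integrable one_le_two) h0)
  -- The form of the operator is the energy of arbitrary representatives, so the energy depends on
  -- the classes only and its closability is that of an operator form.
  have hform : ∀ (u v : T.domain) (F G : Config X → ℝ), Config.IsCylinder d F →
      Config.IsCylinder d G → (u : Lp ℝ 2 μ) =ᵐ[μ] F → (v : Lp ℝ 2 μ) =ᵐ[μ] G →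
      inner ℝ (T u) (v : Lp ℝ 2 μ) = Config.energy d μ F G := by
    intro u v F G hF hG hu hv
    rw [inner_eq_integral_mul (happly u F hF hu) hv, (h2 F G hF hG).2]
  have hsymm : ∀ u v : T.domain,
      inner ℝ (T u) (v : Lp ℝ 2 μ) = inner ℝ (u : Lp ℝ 2 μ) (T v) := by
    intro u v
    obtain ⟨F, hF, hu⟩ := (hdom u).1 u.2
    obtain ⟨G, hG, hv⟩ := (hdom v).1 v.2
    rw [real_inner_comm (T v), hform u v F G hF hG hu hv, hform v u G F hG hF hv hu,
      Config.energy, Config.innerΓ_comm, Config.energy]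
  have hnonneg : ∀ u : T.domain, 0 ≤ inner ℝ (T u) (u : Lp ℝ 2 μ) := by
    intro u
    obtain ⟨F, hF, hu⟩ := (hdom u).1 u.2
    rw [hform u u F F hF hF hu hu]
    exact integral_nonneg fun γ => tsum_nonneg fun x => real_inner_self_nonneg
  obtain ⟨hcl, p, A, hp⟩ := exists_isFriedrichsExtension hdense hsymm hnonneg
  exact ⟨h1, h2, PartialForm.ofOperator T, T, ⟨hdom, hform⟩, ⟨hdom, happly⟩, hcl, p, A, hp⟩
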